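/- Setting. Let $A\in\mathbb{R}^{n_z\times n_z}$, $B\in\mathbb{R}^{n_z\times n_s}$, $S\in\mathbb{R}^{n_q\times n_z}$, $N\in\mathbb{R}^{n_z\times n_w}$, $C\in\mathbb{R}^{n_y\times n_z}$, $C_p\in\mathbb{R}^{n_p\times n_z}$, $L\in\mathbb{R}^{n_z\times n_y}$, $H\in\mathbb{R}^{n_y\times n_y}$, let $\psi\colon\mathbb{R}^{n_q}\to\mathbb{R}^{n_s}$ be Lipschitz with constant $\ell>0$, and let $0<T_1\le T_2$, $\lambda_t>0$, $\gamma>0$. The plant is $\dot z=Az+B\psi(Sz)+Nw$, $y=Cz+\eta$. The output $y$ is available only at sampling times $t_1<t_2<\dots$ with $0\le t_1\le T_2$ and $T_1\le t_{k+1}-t_k\le T_2$. The observer is $$\dot{\hat z}=A\hat z+B\psi(S\hat z)+L\theta,\quad \dot\theta=H\theta\quad (t\ne t_k),\qquad \hat z(t_k^+)=\hat z(t_k),\quad \theta(t_k^+)=y(t_k)-C\hat z(t_k).$$ With $\varepsilon=z-\hat z$, $\tilde\theta=C(z-\hat z)-\theta$, $\zeta(z,\varepsilon)=\psi(Sz)-\psi(S(z-\varepsilon))$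 and a timer $\tau$, let $\mathcal H_e$ be the hybrid system with state $x=(z,\varepsilon,\tilde\theta,\tau)\in\mathbb{R}^{2n_z+n_y+1}$, input $u=(w,\eta)$ and output $y_p=C_p\varepsilon$ that flows, $\dot x=f(x,w)$, when $\tau\in[0,T_2]$, with $$f(x,w)=\begin{pmatrix}Az+B\psi(Sz)+Nw\\ (A-LC)\varepsilon+L\tilde\theta+B\zeta(z,\varepsilon)+Nw\\ (CA-CLC-HC)\varepsilon+(CL+H)\tilde\theta+CB\zeta(z,\varepsilon)+CNw\\ -1\end{pmatrix},$$ and jumps when $\tau=0$, according to $x^+\in\{(z,\varepsilon,-\eta)\}\times[T_1,T_2]$. Solution pairs $(\phi,u)$ are defined on hybrid time domains in $\mathbb{R}_{\ge0}\times\mathbb{N}$: $\phi(\cdot,j)$ is locally absolutely continuous, $u(\cdot,j)$ is measurable and essentially bounded on bounded time intervals, and $\phi$ starts in and obeys the data above. Let $\mathcal A=\mathbb{R}^{n_z}\times\{0\}\times\{0\}\times[0,T_2]$, let $|x|_{\mathcal A}$ be the Euclidean distance to $\mathcal A$, and let $\|u\|_\infty$ be the larger of the essential supremum of $|u|$ over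 flow times and its supremum over jump times. Assumption. There are $C^1$ functions $V_1\colon\mathbb{R}^{n_z}\to\mathbb{R}$, $V_2\colon\mathbb{R}^{n_y+1}\to\mathbb{R}$ and positive $\alpha_1,\alpha_2,\omega_1,\omega_2$ such that, for all $x=(z,\varepsilon,\tilde\theta,\tau)$ with $\tau\in[0,T_2]$ and all $w$, $\alpha_1|\varepsilon|^2\le V_1(\varepsilon)\le\alpha_2|\varepsilon|^2$, $\omega_1|\tilde\theta|^2\le V_2(\tilde\theta,\tau)\le\omega_2|\tilde\theta|^2$, and $V(x)=V_1(\varepsilon)+V_2(\tilde\theta,\tau)$ satisfies $\langle\nabla V(x),f(x,w)\rangle\le-2\lambda_tV(x)-|C_p\varepsilon|^2+\gamma^2|w|^2$. Theorem. Under this assumption: (i) $\mathcal H_e$ is exponentially input-to-state stable with respect to $\mathcal A$: there are $\kappa,\lambda>0$ and a function $\rho$ of class $\mathcal K$ such that every solution pair $(\phi,u)$ with $\|u\|_\infty<\infty$ satisfies $|\phi(t,j)|_{\mathcal A}\le\max\{\kappa e^{-\lambda(t+j)}|\phi(0,0)|_{\mathcal A},\rho(\|u\|_\infty)\}$ for all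 $(t,j)\in\operatorname{dom}\phi$, and every maximal solution pair is complete, i.e. has an unbounded domain. (ii) There is $\alpha>0$ such that every solution pair with $\eta\equiv0$ satisfies $$\Big(\int_{\mathcal I}|y_p(s,j(s))|^2ds\Big)^{1/2}\le\alpha|\phi(0,0)|_{\mathcal A}+\gamma\Big(\int_{\mathcal I}|w(s,j(s))|^2ds\Big)^{1/2},$$ where $\mathcal I=\{s:\exists j,\ (s,j)\in\operatorname{dom}\phi\}$ and $j(s)=\min\{j:(s,j)\in\operatorname{dom}\phi\}$. (iii) The observer solves the estimation problem for the plant interconnected with it, uniformly over all sampling sequences as above. For all initial states, every measurable locally essentially bounded $w$ and every $\eta$, a trajectory $(z,\hat z,\theta)$ on $[0,\infty)$ exists. Writing $d(t)$ for the distance of $(z,\hat z,\theta)(t)$ to the set $\{z=\hat z,\ \theta=0\}$ (equivalently $\varepsilon=0$, $\tilde\theta=0$): (P1) if $w\equiv0$ and $\eta\equiv0$, then $d(t)\le\kappa e^{-\lambda_tt}d(0)$ for all $t\ge0$, with a constant $\kappa$ independent of the trajectory; (P2) $z-\hat z$ is bounded when $w$ and $\eta$ are bounded, with a bound that depends only on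 bounds on $w$, $\eta$ and $d(0)$; (P3) if $\eta\equiv0$, then $\|C_p(z-\hat z)\|_{L^2(0,\infty)}\le\alpha\,d(0)+\gamma\|w\|_{L^2(0,\infty)}$, with a constant $\alpha>0$ independent of the trajectory. -/

import Mathlib

open Set Filter Topology MeasureTheory
open scoped ENNReal NNReal

noncomputable section

/-! ### Hybrid time domains, hybrid signals, hybrid systems -/

/-- `ℝⁿ` with the Euclidean norm. -/
abbrev Eu (n : ℕ) : Type := EuclideanSpace ℝ (Fin n)

/-- The action `M v` of a real matrix on a Euclidean vector. -/
abbrev mulE {m n : ℕ} (M : Matrix (Fin m) (Fin n) ℝ) (v : Eu n) : Eu m :=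
  Matrix.toEuclideanLin M v

/-- Hybrid time domains: a union of finitely or infinitely many intervals `[t_j, t_{j+1}] × {j}`
with `0 = t_0 ≤ t_1 ≤ …`; if there are finitely many, the last one may also be of the form
`[t_J, T) × {J}` with `t_J < T ≤ ∞`. -/
def IsHybridTimeDomain (E : Set (ℝ × ℕ)) : Prop :=
  ∃ t : ℕ → ℝ, t 0 = 0 ∧ Monotone t ∧
    (E = {p | p.1 ∈ Icc (t p.2) (t (p.2 + 1))} ∨
      ∃ (J : ℕ) (I : Set ℝ),
        (I = Icc (t J) (t (J + 1)) ∨ (t J < t (J + 1) ∧ I = Ico (t J) (t (J + 1))) ∨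
          I = Ici (t J)) ∧
        E = {p | (p.2 < J ∧ p.1 ∈ Icc (t p.2) (t (p.2 + 1))) ∨ (p.2 = J ∧ p.1 ∈ I)})

/-- The set of ordinary times `t` with `(t, j) ∈ E`. -/
def slice (E : Set (ℝ × ℕ)) (j : ℕ) : Set ℝ := {t | (t, j) ∈ E}

/-- `dom_t`: the projection of a hybrid time domain onto ordinary time. -/
def domT (E : Set (ℝ × ℕ)) : Set ℝ := {t | ∃ j, (t, j) ∈ E}

/-- `j(t) = min {j : (t, j) ∈ E}`. -/
def jmin (E : Set (ℝ × ℕ)) (t : ℝ) : ℕ := sInf {j | (t, j) ∈ E}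

/-- `Γ`: the hybrid times at which a jump occurs. -/
def jumpTimes (E : Set (ℝ × ℕ)) : Set (ℝ × ℕ) := {p | p ∈ E ∧ (p.1, p.2 + 1) ∈ E}

/-- Hybrid inputs on `E`: each `u(·, j)` is measurable and locally essentially bounded, that is,
essentially bounded on bounded time intervals (no blow-up in finite time). -/
def IsHybridInput {U : Type*} [NormedAddCommGroup U] (E : Set (ℝ × ℕ)) (u : ℝ → ℕ → U) : Prop :=
  ∀ j, AEStronglyMeasurable (fun s => u s j) (volume.restrict (slice E j)) ∧
    ∀ T : ℝ, ∃ M : ℝ, ∀ᵐ s ∂(volume.restrict (slice E j ∩ Iic T)), ‖u s j‖ ≤ M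

/-- Hybrid arcs on `E`: each `φ(·, j)` is locally absolutely continuous. -/
def IsHybridArc {X : Type*} [PseudoMetricSpace X] (E : Set (ℝ × ℕ)) (φ : ℝ → ℕ → X) : Prop :=
  ∀ (j : ℕ) (a b : ℝ), a ≤ b → Icc a b ⊆ slice E j →
    AbsolutelyContinuousOnInterval (fun s => φ s j) a b

/-- The `T`-truncated `L∞` norm of a hybrid signal: the larger of the essential supremum over
the non-jump times and the supremum over the jump times `(s, k)` with `s + k ≤ T`. -/
def linfTrunc {U : Type*} [NormedAddCommGroup U] (E : Set (ℝ × ℕ)) (u : ℝ → ℕ → U) (T : ℝ) :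
    ℝ≥0∞ :=
  max
    (⨆ k : ℕ, essSup (fun s => ‖u s k‖ₑ)
      (volume.restrict {s | (s, k) ∈ E \ jumpTimes E ∧ s + k ≤ T}))
    (⨆ p ∈ {p : ℝ × ℕ | p ∈ jumpTimes E ∧ p.1 + p.2 ≤ T}, ‖u p.1 p.2‖ₑ)

/-- The `L∞` norm of a hybrid signal, the limit (equivalently, by monotonicity, the supremum) of
the truncated norms. -/
def linfNorm {U : Type*} [NormedAddCommGroup U] (E : Set (ℝ × ℕ)) (u : ℝ → ℕ → U) : ℝ≥0∞ :=
  ⨆ T : ℝ, linfTrunc E u T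

/-- A hybrid system `ẋ = f(x, w)` for `x ∈ C`, `x⁺ ∈ G(x, η)` for `x ∈ D`. -/
structure HybridSystem (X W Y : Type*) where
  flowMap : X → W → X
  flowSet : Set X
  jumpMap : X → Y → Set X
  jumpSet : Set X

namespace HybridSystem

variable {X W Y : Type*} [NormedAddCommGroup X] [NormedSpace ℝ X]
  [NormedAddCommGroup W] [NormedAddCommGroup Y]

/-- `(φ, u)`, `u = (w, η)`, is a solution pair with hybrid time domain `E`. -/
structure IsSolutionPair (S : HybridSystem X W Y) (E : Set (ℝ × ℕ))
    (φ : ℝ → ℕ → X) (u : ℝ → ℕ → WithLp 2 (W × Y)) : Prop where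
  dom : IsHybridTimeDomain E
  arc : IsHybridArc E φ
  input : IsHybridInput E u
  init : φ 0 0 ∈ S.flowSet ∪ S.jumpSet
  flow_mem : ∀ j, ∀ t ∈ interior (slice E j), φ t j ∈ S.flowSet
  flow : ∀ j, ∀ᵐ t ∂(volume.restrict (slice E j)),
    HasDerivAt (fun s => φ s j) (S.flowMap (φ t j) (u t j).fst) t
  jump : ∀ t j, (t, j) ∈ jumpTimes E →
    φ t j ∈ S.jumpSet ∧ φ t (j + 1) ∈ S.jumpMap (φ t j) (u t j).snd

/-- A solution pair is maximal if it is not a proper restriction of another solution pair. -/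
def IsMaximalPair (S : HybridSystem X W Y) (E : Set (ℝ × ℕ))
    (φ : ℝ → ℕ → X) (u : ℝ → ℕ → WithLp 2 (W × Y)) : Prop :=
  S.IsSolutionPair E φ u ∧
    ∀ E' φ' u', S.IsSolutionPair E' φ' u' → E ⊆ E' →
      (∀ t j, (t, j) ∈ E → φ' t j = φ t j ∧ u' t j = u t j) → E' = E

/-- Completeness: the hybrid time domain is unbounded. -/
def IsCompleteDom (E : Set (ℝ × ℕ)) : Prop := ∀ M : ℝ, ∃ p ∈ E, M < p.1 + p.2

/-- Pre-exponential input-to-state stability with respect to `A`; `ρ` is of class `𝒦`. -/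
def IsPreEISS (S : HybridSystem X W Y) (A : Set X) : Prop :=
  ∃ (κ lam : ℝ) (ρ : ℝ≥0 → ℝ≥0), 0 < κ ∧ 0 < lam ∧ Continuous ρ ∧ StrictMono ρ ∧ ρ 0 = 0 ∧
    ∀ E φ u, S.IsSolutionPair E φ u → linfNorm E u < ∞ →
      ∀ t j, (t, j) ∈ E →
        Metric.infDist (φ t j) A ≤
          max (κ * Real.exp (-lam * (t + j)) * Metric.infDist (φ 0 0) A)
            (ρ (linfNorm E u).toNNReal)

/-- Exponential input-to-state stability with respect to `A`: the pre-eISS estimate, and every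
maximal solution pair is complete. -/
def IsEISS (S : HybridSystem X W Y) (A : Set X) : Prop :=
  S.IsPreEISS A ∧ ∀ E φ u, S.IsMaximalPair E φ u → IsCompleteDom E

end HybridSystem

/-! ### The plant, the observer and the hybrid error system -/

/-- Data of the plant `ż = A z + B ψ(S z) + N w`, `y = C z + η`, with performance output
`y_p = C_p (z - ẑ)`. -/
structure Plant (nz nw ny ns nq np : ℕ) where
  A : Matrix (Fin nz) (Fin nz) ℝ
  B : Matrix (Fin nz) (Fin ns) ℝ
  S : Matrix (Fin nq) (Fin nz) ℝ
  N : Matrix (Fin nz) (Fin nw) ℝ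
  C : Matrix (Fin ny) (Fin nz) ℝ
  Cp : Matrix (Fin np) (Fin nz) ℝ
  ψ : Eu nq → Eu ns

/-- The state `x = (z, ε, θ̃, τ)`, with the Euclidean norm of `ℝ^(2 n_z + n_y + 1)`. -/
abbrev ErrState (nz ny : ℕ) : Type :=
  WithLp 2 (Eu nz × WithLp 2 (Eu nz × WithLp 2 (Eu ny × ℝ)))

namespace ErrState

variable {nz ny : ℕ}

/-- The point `(z, ε, θ̃, τ)`. -/
def mk (z ε : Eu nz) (θ : Eu ny) (τ : ℝ) : ErrState nz ny :=
  WithLp.toLp 2 (z, WithLp.toLp 2 (ε, WithLp.toLp 2 (θ, τ)))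

/-- The component `z`. -/
def z (x : ErrState nz ny) : Eu nz := x.fst

/-- The component `ε`. -/
def ε (x : ErrState nz ny) : Eu nz := x.snd.fst

/-- The component `θ̃`. -/
def θ (x : ErrState nz ny) : Eu ny := x.snd.snd.fst

/-- The component `τ`. -/
def τ (x : ErrState nz ny) : ℝ := x.snd.snd.snd

end ErrState

namespace Plant

variable {nz nw ny ns nq np : ℕ}

/-- `ζ(v₁, v₂) = ψ(S v₁) - ψ(S (v₁ - v₂))`. -/
def ζ (P : Plant nz nw ny ns nq np) (v₁ v₂ : Eu nz) : Eu ns :=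
  P.ψ (mulE P.S v₁) - P.ψ (mulE P.S (v₁ - v₂))

/-- The flow map of the hybrid error system: the blocks of `ℱ (ε, θ̃) + 𝒬 ζ(z, ε) + 𝒯 w` are
written out. -/
def errFlow (P : Plant nz nw ny ns nq np) (L : Matrix (Fin nz) (Fin ny) ℝ)
    (H : Matrix (Fin ny) (Fin ny) ℝ) (x : ErrState nz ny) (w : Eu nw) : ErrState nz ny :=
  ErrState.mk
    (mulE P.A x.z + mulE P.B (P.ψ (mulE P.S x.z)) + mulE P.N w)
    (mulE (P.A - L * P.C) x.ε + mulE L x.θ + mulE P.B (P.ζ x.z x.ε) + mulE P.N w)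
    (mulE (P.C * P.A - P.C * L * P.C - H * P.C) x.ε + mulE (P.C * L + H) x.θ
      + mulE (P.C * P.B) (P.ζ x.z x.ε) + mulE (P.C * P.N) w)
    (-1)

/-- The hybrid error system `ℋ_e`. -/
def errSystem (P : Plant nz nw ny ns nq np) (L : Matrix (Fin nz) (Fin ny) ℝ)
    (H : Matrix (Fin ny) (Fin ny) ℝ) (T₁ T₂ : ℝ) :
    HybridSystem (ErrState nz ny) (Eu nw) (Eu ny) where
  flowMap := P.errFlow L H
  flowSet := {x | x.τ ∈ Icc 0 T₂}
  jumpMap x η := {g | ∃ v ∈ Icc T₁ T₂, g = ErrState.mk x.z x.ε (-η) v}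
  jumpSet := {x | x.τ = 0}

/-- The set `𝒜 = ℝ^{n_z} × {0} × {0} × [0, T₂]`. -/
def errSet (nz ny : ℕ) (T₂ : ℝ) : Set (ErrState nz ny) :=
  {x | x.ε = 0 ∧ x.θ = 0 ∧ x.τ ∈ Icc 0 T₂}

/-- The function `V(x) = V₁(ε) + V₂(θ̃, τ)`. -/
def lyap (V₁ : Eu nz → ℝ) (V₂ : Eu ny × ℝ → ℝ) (x : ErrState nz ny) : ℝ :=
  V₁ x.ε + V₂ (x.θ, x.τ)

/-- The Lyapunov-type assumption with decay rate `lt` (that is, `λ_t`) and gain `γ`. Here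
`⟨∇V(x), v⟩` is the derivative of `V` at `x` in the direction `v`. -/
def DissipationAssumption (P : Plant nz nw ny ns nq np) (L : Matrix (Fin nz) (Fin ny) ℝ)
    (H : Matrix (Fin ny) (Fin ny) ℝ) (T₂ lt γ : ℝ) : Prop :=
  ∃ (V₁ : Eu nz → ℝ) (V₂ : Eu ny × ℝ → ℝ) (α₁ α₂ ω₁ ω₂ : ℝ),
    ContDiff ℝ 1 V₁ ∧ ContDiff ℝ 1 V₂ ∧ 0 < α₁ ∧ 0 < α₂ ∧ 0 < ω₁ ∧ 0 < ω₂ ∧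
    (∀ ε, α₁ * ‖ε‖ ^ 2 ≤ V₁ ε ∧ V₁ ε ≤ α₂ * ‖ε‖ ^ 2) ∧
    (∀ θ, ∀ τ ∈ Icc 0 T₂, ω₁ * ‖θ‖ ^ 2 ≤ V₂ (θ, τ) ∧ V₂ (θ, τ) ≤ ω₂ * ‖θ‖ ^ 2) ∧
    (∀ x : ErrState nz ny, x.τ ∈ Icc 0 T₂ → ∀ w : Eu nw,
      fderiv ℝ (lyap V₁ V₂) x (P.errFlow L H x w) ≤
        -2 * lt * lyap V₁ V₂ x - ‖mulE P.Cp x.ε‖ ^ 2 + γ ^ 2 * ‖w‖ ^ 2)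

/-! ### The plant interconnected with the observer, in ordinary time -/

/-- Sampling sequences; `t k` is the `(k+1)`-st sampling instant. -/
def IsSamplingSeq (T₁ T₂ : ℝ) (t : ℕ → ℝ) : Prop :=
  0 ≤ t 0 ∧ t 0 ≤ T₂ ∧ ∀ k, T₁ ≤ t (k + 1) - t k ∧ t (k + 1) - t k ≤ T₂

/-- Measurable, locally essentially bounded functions on `[0, ∞)`. -/
def IsLocBddInput (w : ℝ → Eu nw) : Prop :=
  AEStronglyMeasurable w (volume.restrict (Ici 0)) ∧
    ∀ T : ℝ, ∃ M : ℝ, ∀ᵐ s ∂(volume.restrict (Icc 0 T)), ‖w s‖ ≤ M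

/-- `(z, ẑ, θ)` is, on `[0, ∞)`, a trajectory of the plant with inputs `w`, `η` interconnected
with the observer
`ẑ' = A ẑ + B ψ(S ẑ) + L θ`, `θ' = H θ` off the sampling instants, and
`ẑ⁺ = ẑ`, `θ⁺ = y - C ẑ` at the sampling instants, where `y = C z + η`. At a sampling instant,
`θ` takes its value before the reset. -/
structure IsTrajectory (P : Plant nz nw ny ns nq np) (L : Matrix (Fin nz) (Fin ny) ℝ)
    (H : Matrix (Fin ny) (Fin ny) ℝ) (t : ℕ → ℝ) (w : ℝ → Eu nw) (η : ℝ → Eu ny)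
    (z zh : ℝ → Eu nz) (θ : ℝ → Eu ny) : Prop where
  plant_ac : ∀ b, 0 ≤ b → AbsolutelyContinuousOnInterval z 0 b
  plant_ode : ∀ᵐ s ∂(volume.restrict (Ici 0)),
    HasDerivAt z (mulE P.A (z s) + mulE P.B (P.ψ (mulE P.S (z s))) + mulE P.N (w s)) s
  est_cont : ContinuousOn zh (Ici 0)
  est_ode : ∀ s, 0 < s → s ∉ range t →
    HasDerivAt zh (mulE P.A (zh s) + mulE P.B (P.ψ (mulE P.S (zh s))) + mulE L (θ s)) s
  inj_ode : ∀ s, 0 < s → s ∉ range t → HasDerivAt θ (mulE H (θ s)) s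
  inj_zero : 0 ∉ range t → ContinuousWithinAt θ (Ici 0) 0
  inj_left : ∀ k, 0 < t k → ContinuousWithinAt θ (Iic (t k)) (t k)
  inj_reset : ∀ k, Tendsto θ (𝓝[>] (t k))
    (𝓝 (mulE P.C (z (t k)) + η (t k) - mulE P.C (zh (t k))))

/-- The state `(z, ẑ, θ)` of the interconnection, with the Euclidean norm. -/
def obsState (z zh : Eu nz) (θ : Eu ny) : WithLp 2 (Eu nz × WithLp 2 (Eu nz × Eu ny)) :=
  WithLp.toLp 2 (z, WithLp.toLp 2 (zh, θ))

/-- The target set `z = ẑ`, `θ = 0` (equivalently `ε = 0`, `θ̃ = C (z - ẑ) - θ = 0`) of the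
interconnection. -/
def targetSet (nz ny : ℕ) : Set (WithLp 2 (Eu nz × WithLp 2 (Eu nz × Eu ny))) :=
  {p | ∃ z : Eu nz, p = obsState z z 0}

/-- The observer with gains `L`, `H` solves the estimation problem with prescribed decay rate `lt`
(in ordinary time) and prescribed `L²` gain `γ`, uniformly over all sampling sequences. -/
structure SolvesEstimationProblem (P : Plant nz nw ny ns nq np)
    (L : Matrix (Fin nz) (Fin ny) ℝ) (H : Matrix (Fin ny) (Fin ny) ℝ)
    (T₁ T₂ lt γ : ℝ) : Prop where
  /-- Trajectories of the interconnection exist on `[0, ∞)`. -/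
  exist : ∀ t, IsSamplingSeq T₁ T₂ t → ∀ (w : ℝ → Eu nw) (η : ℝ → Eu ny), IsLocBddInput w →
    ∀ (z₀ zh₀ : Eu nz) (θ₀ : Eu ny), ∃ z zh θ,
      P.IsTrajectory L H t w η z zh θ ∧ z 0 = z₀ ∧ zh 0 = zh₀ ∧ θ 0 = θ₀
  /-- Global exponential stability with rate `lt` of the target set without disturbances. -/
  exp_stable : ∃ κ : ℝ, 0 < κ ∧ ∀ t, IsSamplingSeq T₁ T₂ t → ∀ z zh θ,
    P.IsTrajectory L H t (fun _ => 0) (fun _ => 0) z zh θ → ∀ s, 0 ≤ s →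
      Metric.infDist (obsState (z s) (zh s) (θ s)) (targetSet nz ny) ≤
        κ * Real.exp (-lt * s) *
          Metric.infDist (obsState (z 0) (zh 0) (θ 0)) (targetSet nz ny)
  /-- The estimation error is bounded when the disturbances are bounded. -/
  bounded : ∀ r : ℝ, ∃ M : ℝ, ∀ t, IsSamplingSeq T₁ T₂ t → ∀ (w : ℝ → Eu nw) (η : ℝ → Eu ny),
    IsLocBddInput w → (∀ᵐ s ∂(volume.restrict (Ici 0)), ‖w s‖ ≤ r) → (∀ k, ‖η (t k)‖ ≤ r) →
    ∀ z zh θ, P.IsTrajectory L H t w η z zh θ →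
      Metric.infDist (obsState (z 0) (zh 0) (θ 0)) (targetSet nz ny) ≤ r →
      ∀ s, 0 ≤ s → ‖z s - zh s‖ ≤ M
  /-- `L²` stability from `w` to the performance output, with gain `γ`, when `η ≡ 0`. -/
  l2_gain : ∃ α : ℝ, 0 < α ∧ ∀ t, IsSamplingSeq T₁ T₂ t → ∀ w : ℝ → Eu nw, IsLocBddInput w →
    ∀ z zh θ, P.IsTrajectory L H t w (fun _ => 0) z zh θ →
      (∫⁻ s in Ici 0, ‖mulE P.Cp (z s - zh s)‖ₑ ^ 2) ^ (1 / 2 : ℝ) ≤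
        ENNReal.ofReal
            (α * Metric.infDist (obsState (z 0) (zh 0) (θ 0)) (targetSet nz ny)) +
          ENNReal.ofReal γ * (∫⁻ s in Ici 0, ‖w s‖ₑ ^ 2) ^ (1 / 2 : ℝ)

end Plant

end

/-! ### Absolutely continuous curves -/

/-! The sum `V₁(ε) + V₂(θ̃, τ)` is a storage function. Along flows it obeys, almost everywhere, `V'
≤ -2 λ_t V - |C_p ε|² + γ² |w|²`. A jump leaves `ε` alone and replaces `θ̃` by `-η`, so it discards
a nonnegative part of `V` and adds at most a multiple of `|η|²`.

For the stability estimate the output term is dropped and `V` is compared with a scalar linear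
equation on each interval of flow. The timer decreases at unit rate and restarts in `[T₁, T₂]`, so
consecutive jumps are at least `T₁` apart, apart from the gap before the first one. The
contributions of `η` at the jumps are therefore damped geometrically, with ratio `exp (-2 λ_t T₁)`,
and stay bounded: this is `Plant.lyapunov_le`. The same spacing bounds the number of jumps by an
affine function of time, which turns decay in `t` into decay in `t + j`. The quadratic bounds on `V`
convert everything to distances.

For the `L²` gain the decay term is dropped instead. The inequality is integrated over each slice
and the results telescope, because `V` cannot increase at a jump when `η = 0`
(`Plant.lintegral_output_le`).

A maximal solution is complete because a bounded domain can always be enlarged. The flow map has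
linear growth, so a solution on a bounded half-open slice is Lipschitz and its limit can be added.
At a closed end point the solution jumps if the timer is zero, and otherwise flows on with zero
input until the timer is zero.

A trajectory of plant and observer becomes a hybrid solution when `τ` is taken to be the time left
to the next sample (`Plant.IsTrajectory.isSolutionPair`). The distance to the target set is
equivalent to the norm of `(ε, θ̃)`, so the hybrid estimates carry over. For existence, subtracting
`N ∫ w` makes the plant equation continuous in time, and the observer is solved piece by piece
between samples. -/

/-- Post-composition with a map that is Lipschitz on the range preserves absolute continuity. -/
theorem LipschitzOnWith.comp_absolutelyContinuousOnInterval {X Y : Type*} [PseudoMetricSpace X]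
    [PseudoMetricSpace Y] {K : ℝ≥0} {f : X → Y} {s : Set X} (hf : LipschitzOnWith K f s)
    {φ : ℝ → X} {a b : ℝ} (hφ : AbsolutelyContinuousOnInterval φ a b)
    (hs : MapsTo φ (uIcc a b) s) : AbsolutelyContinuousOnInterval (fun x => f (φ x)) a b := by
  rw [absolutelyContinuousOnInterval_iff] at hφ ⊢
  intro ε hε
  -- Dividing by `K + 1` rather than `K` also covers `K = 0`.
  obtain ⟨δ, hδ, h⟩ := hφ (ε / (K + 1)) (by positivity)
  refine ⟨δ, hδ, fun E hE hlt => ?_⟩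
  have h1 := h E hE hlt
  calc ∑ i ∈ Finset.range E.1, dist (f (φ (E.2 i).1)) (f (φ (E.2 i).2))
      ≤ ∑ i ∈ Finset.range E.1, K * dist (φ (E.2 i).1) (φ (E.2 i).2) :=
        Finset.sum_le_sum fun i hi =>
          hf.dist_le_mul _ (hs (hE.1 i hi).1) _ (hs (hE.1 i hi).2)
    _ = K * ∑ i ∈ Finset.range E.1, dist (φ (E.2 i).1) (φ (E.2 i).2) := by rw [Finset.mul_sum]
    _ ≤ (K + 1) * ∑ i ∈ Finset.range E.1, dist (φ (E.2 i).1) (φ (E.2 i).2) := by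
        gcongr
        linarith
    _ < (K + 1) * (ε / (K + 1)) := by gcongr
    _ = ε := by field_simp

theorem LipschitzWith.comp_absolutelyContinuousOnInterval {X Y : Type*} [PseudoMetricSpace X]
    [PseudoMetricSpace Y] {K : ℝ≥0} {f : X → Y} (hf : LipschitzWith K f)
    {φ : ℝ → X} {a b : ℝ} (hφ : AbsolutelyContinuousOnInterval φ a b) :
    AbsolutelyContinuousOnInterval (fun x => f (φ x)) a b :=
  (hf.lipschitzOnWith (s := univ)).comp_absolutelyContinuousOnInterval hφ (mapsTo_univ _ _)

/-- A `C¹` function of an absolutely continuous curve is absolutely continuous. -/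
theorem ContDiff.comp_absolutelyContinuousOnInterval {E F : Type*} [NormedAddCommGroup E]
    [NormedSpace ℝ E] [FiniteDimensional ℝ E] [NormedAddCommGroup F] [NormedSpace ℝ F]
    {f : E → F} (hf : ContDiff ℝ 1 f) {φ : ℝ → E} {a b : ℝ}
    (hφ : AbsolutelyContinuousOnInterval φ a b) :
    AbsolutelyContinuousOnInterval (fun x => f (φ x)) a b := by
  obtain ⟨C, hC⟩ := hφ.exists_bound
  have : ProperSpace E := FiniteDimensional.proper ℝ E
  obtain ⟨K, hK⟩ := hf.contDiffOn.exists_lipschitzOnWith (s := Metric.closedBall (0 : E) C)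
    (by decide) (convex_closedBall _ _) (isCompact_closedBall _ _)
  exact hK.comp_absolutelyContinuousOnInterval hφ fun x hx => by simpa using hC x hx

theorem AbsolutelyContinuousOnInterval.congr {X : Type*} [PseudoMetricSpace X] {f g : ℝ → X}
    {a b : ℝ} (hf : AbsolutelyContinuousOnInterval f a b) (h : EqOn f g (uIcc a b)) :
    AbsolutelyContinuousOnInterval g a b := by
  rw [absolutelyContinuousOnInterval_iff] at hf ⊢
  intro ε hε
  obtain ⟨δ, hδ, hE⟩ := hf ε hε
  refine ⟨δ, hδ, fun E hEd hlt => ?_⟩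
  have h1 := hE E hEd hlt
  rwa [Finset.sum_congr rfl fun i hi => by rw [h (hEd.1 i hi).1, h (hEd.1 i hi).2]] at h1

/-- The increment of an absolutely continuous function is at most the integral of an upper bound
for its derivative. -/
theorem AbsolutelyContinuousOnInterval.sub_le_integral {g h : ℝ → ℝ} {a b : ℝ} (hab : a ≤ b)
    (hg : AbsolutelyContinuousOnInterval g a b)
    (hd : ∀ᵐ x ∂(volume.restrict (Icc a b)), ∃ d, HasDerivAt g d x ∧ d ≤ h x)
    (hh : IntervalIntegrable h volume a b) : g b - g a ≤ ∫ x in a..b, h x := by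
  rw [← hg.integral_deriv_eq_sub]
  refine intervalIntegral.integral_mono_ae_restrict hab hg.intervalIntegrable_deriv hh ?_
  filter_upwards [hd] with x ⟨d, h1, h2⟩
  rwa [h1.deriv]

/-- Comparison with the scalar equation `v' = c v + k`. -/
theorem AbsolutelyContinuousOnInterval.add_div_le_exp_mul {v : ℝ → ℝ} {a b c k : ℝ} (hab : a ≤ b)
    (hc : c ≠ 0) (hv : AbsolutelyContinuousOnInterval v a b)
    (hd : ∀ᵐ x ∂(volume.restrict (Icc a b)), ∃ d, HasDerivAt v d x ∧ d ≤ c * v x + k) :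
    v b + k / c ≤ Real.exp (c * (b - a)) * (v a + k / c) := by
  have hexp : AbsolutelyContinuousOnInterval (fun x => Real.exp (-c * x)) a b :=
    (by fun_prop : ContDiff ℝ 1 fun x => Real.exp (-c * x)).contDiffOn.absolutelyContinuousOnInterval
  have hconst : AbsolutelyContinuousOnInterval (fun _ : ℝ => k / c) a b :=
    (by fun_prop : ContDiff ℝ 1 fun _ : ℝ => k / c).contDiffOn.absolutelyContinuousOnInterval
  -- Integrating factor: `exp (-c x) (v + k / c)` has nonpositive derivative almost everywhere.
  have hg := hexp.fun_mul (hv.fun_add hconst)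
  have key := hg.sub_le_integral (h := fun _ => 0) hab ?_ (by simp)
  · simp only [intervalIntegral.integral_zero, sub_nonpos] at key
    have h1 : Real.exp (c * b) * (Real.exp (-c * b) * (v b + k / c)) ≤
        Real.exp (c * b) * (Real.exp (-c * a) * (v a + k / c)) := by gcongr
    rw [← mul_assoc, ← mul_assoc, ← Real.exp_add, ← Real.exp_add] at h1
    have e1 : c * b + -c * b = 0 := by ring
    have e2 : c * b + -c * a = c * (b - a) := by ring
    rwa [e1, e2, Real.exp_zero, one_mul] at h1
  · filter_upwards [hd] with x ⟨d, h1, h2⟩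
    have h3 : HasDerivAt (fun x => Real.exp (-c * x)) (Real.exp (-c * x) * (-c)) x := by
      simpa using ((hasDerivAt_id x).const_mul (-c)).exp
    refine ⟨_, h3.mul (h1.add_const (k / c)), ?_⟩
    have e : Real.exp (-c * x) * -c * (v x + k / c) + Real.exp (-c * x) * d =
        Real.exp (-c * x) * (d - (c * v x + k)) := by field_simp; ring
    rw [e]
    exact mul_nonpos_of_nonneg_of_nonpos (Real.exp_nonneg _) (by linarith)

/-- An absolutely continuous curve with bounded velocity is Lipschitz. -/
theorem AbsolutelyContinuousOnInterval.norm_sub_le {E : Type*} [NormedAddCommGroup E]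
    [InnerProductSpace ℝ E] {φ : ℝ → E} {a b M : ℝ} (hab : a ≤ b)
    (hφ : AbsolutelyContinuousOnInterval φ a b)
    (hd : ∀ᵐ x ∂(volume.restrict (Icc a b)), ∃ d, HasDerivAt φ d x ∧ ‖d‖ ≤ M) :
    ‖φ b - φ a‖ ≤ M * (b - a) := by
  set v := φ b - φ a with hv
  rcases eq_or_ne v 0 with h0 | h0
  -- With zero increment only `0 ≤ M` is needed. It follows from any one point where the velocity
  -- bound holds, and such a point exists because the interval has positive measure.
  · rcases hab.eq_or_lt with rfl | hlt
    · simp [h0]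
    · have hne : (volume.restrict (Icc a b)) ≠ 0 := by
        simp [Measure.restrict_eq_zero, hlt]
      have : NeZero (volume.restrict (Icc a b)) := ⟨hne⟩
      obtain ⟨x, d, -, h2⟩ := hd.exists
      rw [h0, norm_zero]
      exact mul_nonneg ((norm_nonneg d).trans h2) (by linarith)
  -- Pairing with the increment `v` itself reduces the claim to a scalar function.
  · have h1 := ((innerSL ℝ v).lipschitz.comp_absolutelyContinuousOnInterval hφ).sub_le_integral
      (h := fun _ => ‖v‖ * M) hab ?_ (by simp)
    · simp only [innerSL_apply_apply, ← inner_sub_right, ← hv, real_inner_self_eq_norm_sq,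
        intervalIntegral.integral_const, smul_eq_mul] at h1
      have : 0 < ‖v‖ := norm_pos_iff.2 h0
      nlinarith
    · filter_upwards [hd] with x ⟨d, h1, h2⟩
      refine ⟨_, (innerSL ℝ v).hasFDerivAt.comp_hasDerivAt x h1, ?_⟩
      rw [innerSL_apply_apply]
      exact (real_inner_le_norm _ _).trans (by gcongr)

/-! ### Global solutions of Lipschitz differential equations -/

section GlobalODE

variable {E : Type*} [NormedAddCommGroup E] [NormedSpace ℝ E]

/-- On time intervals of length `1 / (2 (K + 1))`, a `K`-Lipschitz differential equation has a
solution with any given initial value. -/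
theorem exists_hasDerivWithinAt_Icc_of_lipschitz [CompleteSpace E] {f : ℝ → E → E} {K : ℝ≥0}
    (hf : ∀ t, LipschitzWith K (f t)) (hc : ∀ x, Continuous fun t => f t x) (s : ℝ) (x₀ : E) :
    ∃ α : ℝ → E, α s = x₀ ∧ ∀ t ∈ Icc s (s + 1 / (2 * (K + 1))),
      HasDerivWithinAt α (f t (α t)) (Icc s (s + 1 / (2 * (K + 1)))) t := by
  set h : ℝ := 1 / (2 * (K + 1)) with hh
  have hpos : 0 < h := by positivity
  obtain ⟨M, hM⟩ := isCompact_Icc.exists_bound_of_continuousOn (s := Icc s (s + h))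
    (hc x₀).continuousOn
  have hM0 : 0 ≤ M := (norm_nonneg _).trans (hM s ⟨le_rfl, by linarith⟩)
  lift M to ℝ≥0 using hM0
  have hK1 : (K : ℝ) * h + h = 1 / 2 := by rw [hh]; field_simp
  -- On the ball of radius `M` about `x₀` the field is bounded by `M + K M`. Since `(K + 1) h = 1 /
  -- 2`, the displacement is at most `M / 2`, and the solution stays in the ball.
  have hpl : IsPicardLindelof f (tmin := s) (tmax := s + h) ⟨s, le_rfl, by linarith⟩ x₀ M 0
      (M + K * M) K := by
    refine ⟨fun t _ => (hf t).lipschitzOnWith, fun x _ => (hc x).continuousOn, fun t ht x hx => ?_,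
      ?_⟩
    · have h1 := (hf t).dist_le_mul x x₀
      rw [dist_eq_norm] at h1
      have h2 : dist x x₀ ≤ M := hx
      push_cast
      calc ‖f t x‖ = ‖f t x₀ + (f t x - f t x₀)‖ := by congr 1; abel
        _ ≤ ‖f t x₀‖ + ‖f t x - f t x₀‖ := norm_add_le _ _
        _ ≤ M + K * M := by
          gcongr
          · exact hM t ht
          · exact h1.trans (by gcongr)
    · have : max (s + h - s) (s - s) = h := by simp [hpos.le]
      push_cast
      rw [this]
      have := M.2
      have h3 : (M : ℝ) * (K * h + h) = M * (1 / 2) := by rw [hK1]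
      have h4 : (0 : ℝ) ≤ M := M.2
      nlinarith
  exact hpl.exists_eq_forall_mem_Icc_hasDerivWithinAt₀

/-- Grönwall uniqueness for solutions whose intervals may differ in length, as needed to compare
solutions on growing intervals. -/
theorem hasDerivWithinAt_Icc_unique {f : ℝ → E → E} {K : ℝ≥0}
    (hf : ∀ t, LipschitzWith K (f t)) {α β : ℝ → E} {a b c : ℝ} (h0 : α a = β a)
    (hα : ∀ t ∈ Icc a b, HasDerivWithinAt α (f t (α t)) (Icc a b) t)
    (hβ : ∀ t ∈ Icc a c, HasDerivWithinAt β (f t (β t)) (Icc a c) t) {t : ℝ} (ha : a ≤ t)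
    (hb : t ≤ b) (hc : t ≤ c) : α t = β t := by
  have aux : ∀ {γ : ℝ → E} {d : ℝ}, t ≤ d →
      (∀ t ∈ Icc a d, HasDerivWithinAt γ (f t (γ t)) (Icc a d) t) →
      ContinuousOn γ (Icc a t) ∧ ∀ s ∈ Ico a t, HasDerivWithinAt γ (f s (γ s)) (Ici s) s := by
    intro γ d hd hγ
    refine ⟨fun s hs => ((hγ s ⟨hs.1, hs.2.trans hd⟩).mono (Icc_subset_Icc_right hd)).continuousWithinAt,
      fun s hs => (hγ s ⟨hs.1, hs.2.le.trans hd⟩).mono_of_mem_nhdsWithin ?_⟩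
    exact mem_of_superset (Icc_mem_nhdsGE (hs.2.trans_le hd)) (Icc_subset_Icc_left hs.1)
  have h1 := aux hb hα
  have h2 := aux hc hβ
  exact ODE_solution_unique hf h1.1 h1.2 h2.1 h2.2 h0 ⟨ha, le_rfl⟩

/-- Global existence on `[0, ∞)` for Lipschitz differential equations. -/
theorem exists_hasDerivWithinAt_Ici_of_lipschitz [CompleteSpace E] {f : ℝ → E → E} {K : ℝ≥0}
    (hf : ∀ t, LipschitzWith K (f t)) (hc : ∀ x, Continuous fun t => f t x) (x₀ : E) :
    ∃ α : ℝ → E, α 0 = x₀ ∧ ∀ t, 0 ≤ t → HasDerivWithinAt α (f t (α t)) (Ici 0) t := by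
  set h : ℝ := 1 / (2 * (K + 1)) with hh
  have hpos : 0 < h := by positivity
  have step : ∀ n : ℕ, ∃ α : ℝ → E, α 0 = x₀ ∧
      ∀ t ∈ Icc 0 ((n + 1 : ℕ) * h), HasDerivWithinAt α (f t (α t)) (Icc 0 ((n + 1 : ℕ) * h)) t := by
    intro n
    induction n with
    | zero => simpa [← hh] using exists_hasDerivWithinAt_Icc_of_lipschitz hf hc 0 x₀
    | succ n ih =>
      obtain ⟨α, h0, hα⟩ := ih
      set c : ℝ := (n + 1 : ℕ) * h with hcdef
      have hc0 : 0 < c := by positivity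
      have hc1 : ((n + 1 + 1 : ℕ) : ℝ) * h = c + h := by rw [hcdef]; push_cast; ring
      obtain ⟨β, hβ0, hβ⟩ := exists_hasDerivWithinAt_Icc_of_lipschitz hf hc c (α c)
      rw [← hh] at hβ
      rw [hc1]
      set g : ℝ → E := fun t => if t ≤ c then α t else β t with hg
      have gα : ∀ t ∈ Icc 0 c, g t = α t := fun t ht => if_pos ht.2
      have gβ : ∀ t ∈ Icc c (c + h), g t = β t := fun t ht => by
        rcases ht.1.eq_or_lt with rfl | hlt
        · rw [gα c ⟨hc0.le, le_rfl⟩, hβ0]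
        · exact if_neg hlt.not_ge
      refine ⟨g, (gα 0 ⟨le_rfl, hc0.le⟩).trans h0, fun t ht => ?_⟩
      rw [← Icc_union_Icc_eq_Icc hc0.le (by linarith : c ≤ c + h)]
      have l : ∀ t ∈ Icc 0 c, HasDerivWithinAt g (f t (g t)) (Icc 0 c) t := fun t ht => by
        rw [gα t ht]; exact (hα t ht).congr gα (gα t ht)
      have r : ∀ t ∈ Icc c (c + h), HasDerivWithinAt g (f t (g t)) (Icc c (c + h)) t :=
        fun t ht => by rw [gβ t ht]; exact (hβ t ht).congr gβ (gβ t ht)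
      -- Outside a closed interval any derivative within it is vacuously correct, so each half of
      -- the union can be treated separately.
      have nl : ∀ {a b : ℝ}, t ∉ Icc a b → ∀ d, HasDerivWithinAt g d (Icc a b) t := fun hn d =>
        HasFDerivWithinAt.of_notMem_closure (by rwa [isClosed_Icc.closure_eq])
      refine HasDerivWithinAt.union ?_ ?_
      · by_cases h1 : t ∈ Icc 0 c
        · exact l t h1
        · exact nl h1 _
      · by_cases h1 : t ∈ Icc c (c + h)
        · exact r t h1
        · exact nl h1 _
  choose α h0 hα using step
  have hlarge : ∀ t : ℝ, 0 ≤ t → t < (⌈t / h⌉₊ + 1 : ℕ) * h := fun t ht => by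
    have h1 := Nat.le_ceil (t / h)
    rw [div_le_iff₀ hpos] at h1
    push_cast
    nlinarith
  -- The solution with index `n` lives on `[0, (n + 1) h]`, so the one used at `t` extends strictly
  -- beyond `t`. By uniqueness it agrees nearby with the glued curve.
  refine ⟨fun t => α ⌈t / h⌉₊ t, by simpa using h0 0, fun t ht => ?_⟩
  set n := ⌈t / h⌉₊
  have heq : ∀ s, 0 ≤ s → s < (n + 1 : ℕ) * h → α ⌈s / h⌉₊ s = α n s := fun s hs hs' =>
    hasDerivWithinAt_Icc_unique hf ((h0 _).trans (h0 _).symm) (hα _) (hα _) hs (hlarge s hs).le hs'.le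
  have h1 := hα n t ⟨ht, (hlarge t ht).le⟩
  have h2 : HasDerivWithinAt (α n) (f t (α n t)) (Ici 0) t := by
    refine h1.mono_of_mem_nhdsWithin ?_
    rw [mem_nhdsWithin]
    exact ⟨Iio _, isOpen_Iio, hlarge t ht, fun s hs => ⟨hs.2, hs.1.le⟩⟩
  refine h2.congr_of_eventuallyEq ?_ rfl
  have : Iio ((n + 1 : ℕ) * h) ∈ 𝓝[Ici 0] t := mem_nhdsWithin_of_mem_nhds (Iio_mem_nhds (hlarge t ht))
  filter_upwards [this, self_mem_nhdsWithin] with s hs hs'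
  exact heq s hs' hs

end GlobalODE

/-! ### Hybrid time domains -/

/-- `t` lists the left end points of the slices of the hybrid time domain `E`. -/
structure IsSliceSeq (E : Set (ℝ × ℕ)) (t : ℕ → ℝ) : Prop where
  zero : t 0 = 0
  mono : Monotone t
  nonempty : (slice E 0).Nonempty
  shape : ∀ j, slice E j = ∅ ∨ slice E j = Icc (t j) (t (j + 1)) ∨
    (t j < t (j + 1) ∧ slice E j = Ico (t j) (t (j + 1))) ∨ slice E j = Ici (t j)
  prev : ∀ j, (slice E (j + 1)).Nonempty → slice E j = Icc (t j) (t (j + 1))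

/-- The hybrid time domain with `J` jumps at the times `t 1, …, t J`, and last slice `I`. -/
def finiteDomain (t : ℕ → ℝ) (J : ℕ) (I : Set ℝ) : Set (ℝ × ℕ) :=
  {p | (p.2 < J ∧ p.1 ∈ Icc (t p.2) (t (p.2 + 1))) ∨ (p.2 = J ∧ p.1 ∈ I)}

theorem slice_finiteDomain_of_lt {t : ℕ → ℝ} {J j : ℕ} {I : Set ℝ} (hj : j < J) :
    slice (finiteDomain t J I) j = Icc (t j) (t (j + 1)) := by
  ext s; simp [finiteDomain, slice, hj, hj.ne]

theorem slice_finiteDomain_self (t : ℕ → ℝ) (J : ℕ) (I : Set ℝ) :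
    slice (finiteDomain t J I) J = I := by
  ext s; simp [finiteDomain, slice]

theorem slice_finiteDomain_of_gt {t : ℕ → ℝ} {J j : ℕ} {I : Set ℝ} (hj : J < j) :
    slice (finiteDomain t J I) j = ∅ := by
  ext s; simp [finiteDomain, slice, hj.not_gt, hj.ne']

theorem isSliceSeq_finiteDomain {t : ℕ → ℝ} {J : ℕ} {I : Set ℝ} (h0 : t 0 = 0)
    (hm : Monotone t) (hI : I = Icc (t J) (t (J + 1)) ∨
      (t J < t (J + 1) ∧ I = Ico (t J) (t (J + 1))) ∨ I = Ici (t J)) :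
    IsSliceSeq (finiteDomain t J I) t := by
  have hle : ∀ j, t j ≤ t (j + 1) := fun j => hm j.le_succ
  refine ⟨h0, hm, ?_, fun j => ?_, fun j hj => ?_⟩
  · rcases J.eq_zero_or_pos with rfl | hJ
    · rw [slice_finiteDomain_self]
      refine ⟨t 0, ?_⟩
      rcases hI with rfl | ⟨h, rfl⟩ | rfl
      exacts [⟨le_rfl, hle 0⟩, ⟨le_rfl, h⟩, mem_Ici.2 le_rfl]
    · exact ⟨t 0, by rw [slice_finiteDomain_of_lt hJ]; exact ⟨le_rfl, hle 0⟩⟩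
  · rcases lt_trichotomy j J with hj | rfl | hj
    · exact Or.inr (Or.inl (slice_finiteDomain_of_lt hj))
    · rw [slice_finiteDomain_self]; exact Or.inr hI
    · exact Or.inl (slice_finiteDomain_of_gt hj)
  · refine slice_finiteDomain_of_lt (not_le.1 fun hJ => ?_)
    rw [slice_finiteDomain_of_gt (by omega : J < j + 1)] at hj
    exact not_nonempty_empty hj

/-- Gives finite and infinite domains a common description. For a finite domain, the values of `t`
beyond the last slice play no role. -/
theorem IsHybridTimeDomain.exists_isSliceSeq {E : Set (ℝ × ℕ)} (hE : IsHybridTimeDomain E) :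
    ∃ t, IsSliceSeq E t := by
  obtain ⟨t, h0, hm, h⟩ := hE
  refine ⟨t, ?_⟩
  rcases h with rfl | ⟨J, I, hI, rfl⟩
  · have hs : ∀ j, slice {p : ℝ × ℕ | p.1 ∈ Icc (t p.2) (t (p.2 + 1))} j =
      Icc (t j) (t (j + 1)) := fun j => rfl
    exact ⟨h0, hm, ⟨t 0, by rw [hs]; exact ⟨le_rfl, hm (Nat.le_succ 0)⟩⟩,
      fun j => Or.inr (Or.inl (hs j)), fun j _ => hs j⟩
  · exact isSliceSeq_finiteDomain h0 hm hI

namespace IsSliceSeq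

variable {E : Set (ℝ × ℕ)} {t : ℕ → ℝ}

theorem start_mem (h : IsSliceSeq E t) {s : ℝ} {j : ℕ} (hs : s ∈ slice E j) :
    t j ∈ slice E j ∧ t j ≤ s := by
  have hle : t j ≤ t (j + 1) := h.mono j.le_succ
  rcases h.shape j with h1 | h1 | ⟨h2, h1⟩ | h1 <;> rw [h1] at hs ⊢
  · exact hs.elim
  · exact ⟨⟨le_rfl, hle⟩, hs.1⟩
  · exact ⟨⟨le_rfl, h2⟩, hs.1⟩
  · exact ⟨mem_Ici.2 le_rfl, hs⟩

theorem ordConnected (h : IsSliceSeq E t) (j : ℕ) : (slice E j).OrdConnected := by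
  rcases h.shape j with h1 | h1 | ⟨_, h1⟩ | h1 <;> rw [h1]
  exacts [ordConnected_empty, ordConnected_Icc, ordConnected_Ico, ordConnected_Ici]

theorem Icc_subset (h : IsSliceSeq E t) {s : ℝ} {j : ℕ} (hs : s ∈ slice E j) :
    Icc (t j) s ⊆ slice E j :=
  (h.ordConnected j).out (h.start_mem hs).1 hs

theorem measurableSet_slice (h : IsSliceSeq E t) (j : ℕ) : MeasurableSet (slice E j) :=
  (h.ordConnected j).measurableSet

theorem jump_mem (h : IsSliceSeq E t) {j : ℕ} (hj : (slice E (j + 1)).Nonempty) :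
    (t (j + 1), j) ∈ jumpTimes E := by
  obtain ⟨s, hs⟩ := hj
  refine ⟨?_, (h.start_mem hs).1⟩
  have : t (j + 1) ∈ slice E j := by
    rw [h.prev j ⟨s, hs⟩]; exact ⟨h.mono j.le_succ, le_rfl⟩
  exact this

/-- Once slice `j + 1` is nonempty, slice `j` ends at `t (j + 1)`, which is where the next one
starts; this is the only time they share. -/
theorem eq_of_jump (h : IsSliceSeq E t) {s : ℝ} {j : ℕ} (hs : (s, j) ∈ jumpTimes E) :
    s = t (j + 1) := by
  have h1 : s ∈ slice E (j + 1) := hs.2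
  have h2 : s ∈ slice E j := hs.1
  rw [h.prev j ⟨s, h1⟩] at h2
  exact le_antisymm h2.2 (h.start_mem h1).2

theorem nonempty_of_succ (h : IsSliceSeq E t) {j : ℕ} (hj : (slice E (j + 1)).Nonempty) :
    (slice E j).Nonempty :=
  ⟨_, (h.jump_mem hj).1⟩

theorem nonneg (h : IsSliceSeq E t) (j : ℕ) : 0 ≤ t j := h.zero ▸ h.mono j.zero_le

theorem mem_jumpTimes_finiteDomain {J : ℕ} {I : Set ℝ} (h : IsSliceSeq (finiteDomain t J I) t)
    (hI : I.Nonempty) {s : ℝ} {j : ℕ} :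
    (s, j) ∈ jumpTimes (finiteDomain t J I) ↔ j < J ∧ s = t (j + 1) := by
  constructor
  · intro hs
    refine ⟨not_le.1 fun hJ => ?_, h.eq_of_jump hs⟩
    have h1 : s ∈ slice (finiteDomain t J I) (j + 1) := hs.2
    rw [slice_finiteDomain_of_gt (by omega)] at h1
    exact h1
  · rintro ⟨hj, rfl⟩
    refine h.jump_mem ?_
    rcases (Nat.succ_le_of_lt hj).lt_or_eq with h1 | rfl
    · rw [slice_finiteDomain_of_lt h1]
      exact ⟨_, le_rfl, h.mono (Nat.le_succ _)⟩
    · rwa [slice_finiteDomain_self]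

end IsSliceSeq

/-! ### The supremum norm of hybrid signals -/

section LinfNorm

variable {U : Type*} [NormedAddCommGroup U] {E : Set (ℝ × ℕ)} {t : ℕ → ℝ} (u : ℝ → ℕ → U)

theorem enorm_le_linfNorm_of_jump {s : ℝ} {j : ℕ} (hp : (s, j) ∈ jumpTimes E) :
    ‖u s j‖ₑ ≤ linfNorm E u := by
  refine le_trans ?_ (le_iSup (linfTrunc E u) (s + j))
  refine le_trans ?_ (le_max_right _ _)
  exact le_iSup₂_of_le (f := fun (p : ℝ × ℕ) (_ : p ∈ {p : ℝ × ℕ | p ∈ jumpTimes E ∧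
    p.1 + p.2 ≤ s + j}) => ‖u p.1 p.2‖ₑ) (s, j) ⟨hp, le_rfl⟩ le_rfl

/-- The norm takes essential suprema only off the jump times, but a slice contains at most one of
these, a null set. Integer truncations exhaust the rest. -/
theorem ae_enorm_le_linfNorm (h : IsSliceSeq E t) (j : ℕ) :
    ∀ᵐ s ∂(volume.restrict (slice E j)), ‖u s j‖ₑ ≤ linfNorm E u := by
  have h1 : ∀ n : ℕ, ∀ᵐ s ∂(volume.restrict {s | (s, j) ∈ E \ jumpTimes E ∧ s + j ≤ (n : ℝ)}),
      ‖u s j‖ₑ ≤ linfNorm E u := fun n => by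
    filter_upwards [ENNReal.ae_le_essSup (fun s => ‖u s j‖ₑ)] with s hs
    refine hs.trans (le_trans ?_ (le_iSup (linfTrunc E u) (n : ℝ)))
    refine le_trans ?_ (le_max_left _ _)
    exact le_iSup (fun k : ℕ => essSup (fun s => ‖u s k‖ₑ)
      (volume.restrict {s | (s, k) ∈ E \ jumpTimes E ∧ s + k ≤ (n : ℝ)})) j
  have h2 := (ae_restrict_iUnion_iff _ _).2 h1
  have h3 : ∀ᵐ s ∂(volume.restrict {t (j + 1)}), ‖u s j‖ₑ ≤ linfNorm E u := by
    rw [Measure.restrict_singleton]; simp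
  refine ae_restrict_of_ae_restrict_of_subset ?_ ((ae_restrict_union_iff _ _ _).2 ⟨h2, h3⟩)
  intro s hs
  by_cases hj : (s, j) ∈ jumpTimes E
  · exact Or.inr (h.eq_of_jump hj)
  · obtain ⟨n, hn⟩ := exists_nat_ge (s + j)
    exact Or.inl (mem_iUnion.2 ⟨n, ⟨⟨hs, hj⟩, hn⟩⟩)

end LinfNorm

/-! ### The state space of the error system -/

/-- The action of a matrix as a continuous linear map. -/
noncomputable abbrev mulL {m n : ℕ} (M : Matrix (Fin m) (Fin n) ℝ) : Eu n →L[ℝ] Eu m :=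
  LinearMap.toContinuousLinearMap (Matrix.toEuclideanLin M)

theorem NormedSpace.continuousSMul (F : Type*) [NormedAddCommGroup F] [NormedSpace ℝ F] :
    ContinuousSMul ℝ F :=
  inferInstance

namespace ErrState

variable {nz ny : ℕ}

/-- A shortcut for instance search, which otherwise times out. -/
instance instContinuousSMul : ContinuousSMul ℝ (ErrState nz ny) := NormedSpace.continuousSMul _

/-- The coordinate `z` as a continuous linear map. -/
def zL : ErrState nz ny →L[ℝ] Eu nz := WithLp.fstL 2 ℝ _ _

/-- The coordinate `ε` as a continuous linear map. -/
def εL : ErrState nz ny →L[ℝ] Eu nz := (WithLp.fstL 2 ℝ _ _).comp (WithLp.sndL 2 ℝ _ _)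

/-- The coordinate `θ̃` as a continuous linear map. -/
def θL : ErrState nz ny →L[ℝ] Eu ny :=
  (WithLp.fstL 2 ℝ _ _).comp ((WithLp.sndL 2 ℝ _ _).comp (WithLp.sndL 2 ℝ _ _))

/-- The coordinate `τ` as a continuous linear map. -/
def τL : ErrState nz ny →L[ℝ] ℝ :=
  (WithLp.sndL 2 ℝ _ _).comp ((WithLp.sndL 2 ℝ _ _).comp (WithLp.sndL 2 ℝ _ _))

/-- The four coordinates determine the state, as a continuous linear map. -/
def mkL : (Eu nz × Eu nz × Eu ny × ℝ) →L[ℝ] ErrState nz ny :=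
  (WithLp.prodContinuousLinearEquiv 2 ℝ _ _).symm.toContinuousLinearMap.comp
    ((ContinuousLinearMap.id ℝ _).prodMap
      ((WithLp.prodContinuousLinearEquiv 2 ℝ _ _).symm.toContinuousLinearMap.comp
        ((ContinuousLinearMap.id ℝ _).prodMap
          (WithLp.prodContinuousLinearEquiv 2 ℝ _ _).symm.toContinuousLinearMap)))

@[simp] theorem εL_apply (x : ErrState nz ny) : εL x = x.ε := rfl
@[simp] theorem θL_apply (x : ErrState nz ny) : θL x = x.θ := rfl
@[simp] theorem τL_apply (x : ErrState nz ny) : τL x = x.τ := rfl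
@[simp] theorem mkL_apply (p : Eu nz × Eu nz × Eu ny × ℝ) :
    mkL p = mk p.1 p.2.1 p.2.2.1 p.2.2.2 := rfl
@[simp] theorem mk_z (z ε : Eu nz) (θ : Eu ny) (τ : ℝ) : (mk z ε θ τ).z = z := rfl
@[simp] theorem mk_ε (z ε : Eu nz) (θ : Eu ny) (τ : ℝ) : (mk z ε θ τ).ε = ε := rfl
@[simp] theorem mk_θ (z ε : Eu nz) (θ : Eu ny) (τ : ℝ) : (mk z ε θ τ).θ = θ := rfl
@[simp] theorem mk_τ (z ε : Eu nz) (θ : Eu ny) (τ : ℝ) : (mk z ε θ τ).τ = τ := rfl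

theorem norm_sq (x : ErrState nz ny) :
    ‖x‖ ^ 2 = ‖x.z‖ ^ 2 + (‖x.ε‖ ^ 2 + (‖x.θ‖ ^ 2 + ‖x.τ‖ ^ 2)) := by
  rw [WithLp.prod_norm_sq_eq_of_L2, WithLp.prod_norm_sq_eq_of_L2, WithLp.prod_norm_sq_eq_of_L2]
  rfl

/-- Compare with the point that has the same `z` and `τ`; it lies in the set only when the timer is
in range. The reverse inequality needs no such condition on `x`. -/
theorem infDist_errSet_sq_le {T₂ : ℝ} (x : ErrState nz ny) (hx : x.τ ∈ Icc 0 T₂) :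
    Metric.infDist x (Plant.errSet nz ny T₂) ^ 2 ≤ ‖x.ε‖ ^ 2 + ‖x.θ‖ ^ 2 := by
  have hmem : mk x.z 0 0 x.τ ∈ Plant.errSet nz ny T₂ := ⟨rfl, rfl, hx⟩
  have h1 := Metric.infDist_le_dist_of_mem (x := x) hmem
  have h2 : dist x (mk x.z 0 0 x.τ) ^ 2 = ‖x.ε‖ ^ 2 + ‖x.θ‖ ^ 2 := by
    rw [dist_eq_norm, norm_sq]
    have e1 : (x - mk x.z 0 0 x.τ).z = x.z - x.z := rfl
    have e2 : (x - mk x.z 0 0 x.τ).ε = x.ε - 0 := rfl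
    have e3 : (x - mk x.z 0 0 x.τ).θ = x.θ - 0 := rfl
    have e4 : (x - mk x.z 0 0 x.τ).τ = x.τ - x.τ := rfl
    rw [e1, e2, e3, e4]
    simp
  rw [← h2]
  exact pow_le_pow_left₀ Metric.infDist_nonneg h1 2

theorem le_infDist_errSet_sq {T₂ : ℝ} (hT : 0 ≤ T₂) (x : ErrState nz ny) :
    ‖x.ε‖ ^ 2 + ‖x.θ‖ ^ 2 ≤ Metric.infDist x (Plant.errSet nz ny T₂) ^ 2 := by
  have hne : (Plant.errSet nz ny T₂).Nonempty := ⟨mk 0 0 0 0, rfl, rfl, le_rfl, hT⟩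
  have h1 : √(‖x.ε‖ ^ 2 + ‖x.θ‖ ^ 2) ≤ Metric.infDist x (Plant.errSet nz ny T₂) := by
    rw [Metric.le_infDist hne]
    intro y ⟨h1, h2, _⟩
    rw [dist_eq_norm]
    refine Real.sqrt_le_iff.2 ⟨norm_nonneg _, ?_⟩
    rw [norm_sq]
    have e2 : (x - y).ε = x.ε - y.ε := rfl
    have e3 : (x - y).θ = x.θ - y.θ := rfl
    rw [e2, e3, h1, h2, sub_zero, sub_zero]
    nlinarith [sq_nonneg ‖(x - y).z‖, sq_nonneg ‖(x - y).τ‖]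
  calc _ = √(‖x.ε‖ ^ 2 + ‖x.θ‖ ^ 2) ^ 2 := (Real.sq_sqrt (by positivity)).symm
    _ ≤ _ := pow_le_pow_left₀ (Real.sqrt_nonneg _) h1 2

end ErrState

/-! ### Lyapunov estimates along hybrid solutions -/

namespace Plant

variable {nz nw ny ns nq np : ℕ}

/-- `V₁ + V₂` is a Lyapunov function for the hybrid error system, with quadratic bounds given by
`a` and `b`. -/
structure IsLyapunov (P : Plant nz nw ny ns nq np) (L : Matrix (Fin nz) (Fin ny) ℝ)
    (H : Matrix (Fin ny) (Fin ny) ℝ) (T₂ lt γ : ℝ) (V : ErrState nz ny → ℝ) (a b : ℝ) :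
    Prop where
  contDiff : ContDiff ℝ 1 V
  a_pos : 0 < a
  b_pos : 0 < b
  le_self : ∀ x : ErrState nz ny, x.τ ∈ Icc 0 T₂ → a * (‖x.ε‖ ^ 2 + ‖x.θ‖ ^ 2) ≤ V x
  self_le : ∀ x : ErrState nz ny, x.τ ∈ Icc 0 T₂ → V x ≤ b * (‖x.ε‖ ^ 2 + ‖x.θ‖ ^ 2)
  reset : ∀ x : ErrState nz ny, x.τ ∈ Icc 0 T₂ → ∀ (η : Eu ny), ∀ v ∈ Icc 0 T₂,
    V (ErrState.mk x.z x.ε (-η) v) ≤ V x + b * ‖η‖ ^ 2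
  dissip : ∀ x : ErrState nz ny, x.τ ∈ Icc 0 T₂ → ∀ w : Eu nw,
    fderiv ℝ V x (P.errFlow L H x w) ≤
      -2 * lt * V x - ‖mulE P.Cp x.ε‖ ^ 2 + γ ^ 2 * ‖w‖ ^ 2

/-- The reset inequality is the only new content: the old value of `V₂` is nonnegative and may be
dropped, and the new one is at most `ω₂ |η|²`. -/
theorem DissipationAssumption.exists_isLyapunov {P : Plant nz nw ny ns nq np}
    {L : Matrix (Fin nz) (Fin ny) ℝ} {H : Matrix (Fin ny) (Fin ny) ℝ} {T₂ lt γ : ℝ}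
    (hA : P.DissipationAssumption L H T₂ lt γ) :
    ∃ V a b, P.IsLyapunov L H T₂ lt γ V a b := by
  obtain ⟨V₁, V₂, α₁, α₂, ω₁, ω₂, hV₁, hV₂, hα₁, hα₂, hω₁, hω₂, h₁, h₂, hd⟩ := hA
  refine ⟨lyap V₁ V₂, min α₁ ω₁, max α₂ ω₂, ?_, lt_min hα₁ hω₁, lt_max_of_lt_left hα₂,
    fun x hx => ?_, fun x hx => ?_, fun x hx η v hv => ?_, hd⟩
  · exact (hV₁.comp ErrState.εL.contDiff).add
      (hV₂.comp (ErrState.θL.prod ErrState.τL).contDiff)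
  · have e1 := (h₁ x.ε).1
    have e2 := (h₂ x.θ x.τ hx).1
    have e3 : min α₁ ω₁ * ‖x.ε‖ ^ 2 ≤ α₁ * ‖x.ε‖ ^ 2 := by gcongr; exact min_le_left _ _
    have e4 : min α₁ ω₁ * ‖x.θ‖ ^ 2 ≤ ω₁ * ‖x.θ‖ ^ 2 := by gcongr; exact min_le_right _ _
    simp only [lyap]
    linarith
  · have e1 := (h₁ x.ε).2
    have e2 := (h₂ x.θ x.τ hx).2
    have e3 : α₂ * ‖x.ε‖ ^ 2 ≤ max α₂ ω₂ * ‖x.ε‖ ^ 2 := by gcongr; exact le_max_left _ _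
    have e4 : ω₂ * ‖x.θ‖ ^ 2 ≤ max α₂ ω₂ * ‖x.θ‖ ^ 2 := by gcongr; exact le_max_right _ _
    simp only [lyap]
    linarith
  · have e1 := (h₂ x.θ x.τ hx).1
    have e2 := (h₂ (-η) v hv).2
    rw [norm_neg] at e2
    have e4 : ω₂ * ‖η‖ ^ 2 ≤ max α₂ ω₂ * ‖η‖ ^ 2 := by gcongr; exact le_max_right _ _
    have e5 : 0 ≤ ω₁ * ‖x.θ‖ ^ 2 := by positivity
    simp only [lyap, ErrState.mk_ε, ErrState.mk_θ, ErrState.mk_τ]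
    linarith

section Estimates

variable {P : Plant nz nw ny ns nq np} {L : Matrix (Fin nz) (Fin ny) ℝ}
  {H : Matrix (Fin ny) (Fin ny) ℝ} {T₁ T₂ lt γ : ℝ} {V : ErrState nz ny → ℝ} {a b : ℝ}
  {E : Set (ℝ × ℕ)} {φ : ℝ → ℕ → ErrState nz ny} {u : ℝ → ℕ → WithLp 2 (Eu nw × Eu ny)}
  {t : ℕ → ℝ}

/-- After a jump the timer lies in `[T₁, T₂]`. -/
theorem timer_start_mem (hsol : (P.errSystem L H T₁ T₂).IsSolutionPair E φ u)
    (ht : IsSliceSeq E t) {j : ℕ} (hj : (slice E (j + 1)).Nonempty) :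
    (φ (t (j + 1)) (j + 1)).τ ∈ Icc T₁ T₂ := by
  obtain ⟨-, v, hv, h⟩ := hsol.jump _ _ (ht.jump_mem hj)
  rw [h]
  exact hv

/-- Solutions are required to lie in the flow set only in the interior of a slice. The left end
point is covered by the initial condition or by the last jump, all later points by closedness of
`[0, T₂]` and continuity. -/
theorem timer_mem (hsol : (P.errSystem L H T₁ T₂).IsSolutionPair E φ u)
    (ht : IsSliceSeq E t) (hT₁ : 0 < T₁) (hT : T₁ ≤ T₂) {s : ℝ} {j : ℕ} (hs : (s, j) ∈ E) :
    (φ s j).τ ∈ Icc 0 T₂ := by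
  have hs' : s ∈ slice E j := hs
  rcases (ht.start_mem hs').2.eq_or_lt with heq | hlt
  · subst heq
    cases j with
    | zero =>
      rw [ht.zero]
      rcases hsol.init with h | h
      · exact h
      · have h' : (φ 0 0).τ = 0 := h
        rw [h']
        exact ⟨le_rfl, hT₁.le.trans hT⟩
    | succ j =>
      have h := timer_start_mem hsol ht ⟨_, hs'⟩
      exact ⟨hT₁.le.trans h.1, h.2⟩
  · have hc : ContinuousOn (fun s => φ s j) (Icc (t j) s) := by
      have := (hsol.arc j (t j) s hlt.le (ht.Icc_subset hs')).continuousOn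
      rwa [uIcc_of_le hlt.le] at this
    have hc' : ContinuousWithinAt (fun s => (φ s j).τ) (Ioo (t j) s) s :=
      ErrState.τL.continuous.continuousAt.comp_continuousWithinAt
        ((hc s ⟨hlt.le, le_rfl⟩).mono Ioo_subset_Icc_self)
    have hne : (𝓝[Ioo (t j) s] s).NeBot := by
      rw [← mem_closure_iff_nhdsWithin_neBot, closure_Ioo hlt.ne]
      exact ⟨hlt.le, le_rfl⟩
    refine isClosed_Icc.mem_of_tendsto hc' ?_
    filter_upwards [self_mem_nhdsWithin] with r hr
    refine hsol.flow_mem j r ?_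
    exact interior_mono (ht.Icc_subset hs') (by rwa [interior_Icc])

theorem flow_ae (hsol : (P.errSystem L H T₁ T₂).IsSolutionPair E φ u) {j : ℕ} {c d : ℝ}
    (h : Icc c d ⊆ slice E j) : ∀ᵐ s ∂(volume.restrict (Icc c d)),
      HasDerivAt (fun s => φ s j) (P.errFlow L H (φ s j) (u s j).fst) s :=
  ae_restrict_of_ae_restrict_of_subset h (hsol.flow j)

theorem timer_ge (hsol : (P.errSystem L H T₁ T₂).IsSolutionPair E φ u)
    (ht : IsSliceSeq E t) {s : ℝ} {j : ℕ} (hs : (s, j) ∈ E) :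
    (φ (t j) j).τ ≤ (φ s j).τ + (s - t j) := by
  have hle := (ht.start_mem hs).2
  have hac := (-ErrState.τL).lipschitz.comp_absolutelyContinuousOnInterval
    (hsol.arc j (t j) s hle (ht.Icc_subset hs))
  have := hac.sub_le_integral (h := fun _ => 1) hle ?_ (by simp)
  · simp at this
    linarith
  · filter_upwards [flow_ae hsol (ht.Icc_subset hs)] with r hr
    refine ⟨_, (-ErrState.τL).hasFDerivAt.comp_hasDerivAt r hr, ?_⟩
    simp [errFlow]

/-- Jumps, except possibly the first two, are separated by at least `T₁`. -/
theorem slice_length_ge (hsol : (P.errSystem L H T₁ T₂).IsSolutionPair E φ u)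
    (ht : IsSliceSeq E t) {j : ℕ} (hj : (slice E (j + 2)).Nonempty) :
    T₁ ≤ t (j + 2) - t (j + 1) := by
  have h1 := ht.jump_mem hj
  have h2 := timer_ge hsol ht h1.1
  have h3 : (φ (t (j + 2)) (j + 1)).τ = 0 := (hsol.jump _ _ h1).1
  have h4 := (timer_start_mem hsol ht (ht.nonempty_of_succ hj)).1
  simp only [Nat.add_assoc, Nat.reduceAdd] at h2
  linarith

theorem mul_index_le (hsol : (P.errSystem L H T₁ T₂).IsSolutionPair E φ u)
    (ht : IsSliceSeq E t) {j : ℕ} (hj : (slice E (j + 1)).Nonempty) : T₁ * j ≤ t (j + 1) := by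
  induction j with
  | zero => simpa using ht.nonneg 1
  | succ j ih =>
    have h1 := ih (ht.nonempty_of_succ hj)
    have h2 := slice_length_ge hsol ht hj
    push_cast
    simp only [Nat.add_assoc, Nat.reduceAdd]
    linarith

/-- Ordinary time controls the jump count. The shift by one is there because the first jump may come
at any time, even at time zero. -/
theorem mul_le_time (hsol : (P.errSystem L H T₁ T₂).IsSolutionPair E φ u)
    (ht : IsSliceSeq E t) (hT₁ : 0 < T₁) {s : ℝ} {j : ℕ} (hs : (s, j) ∈ E) :
    T₁ * (j - 1) ≤ s := by
  have h1 := (ht.start_mem hs).2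
  cases j with
  | zero => have := ht.nonneg 0; push_cast; linarith
  | succ j =>
    have := mul_index_le hsol ht ⟨s, hs⟩
    push_cast
    linarith

/-- The dissipation inequality along flows. -/
theorem lyapunov_flow (hV : P.IsLyapunov L H T₂ lt γ V a b)
    (hsol : (P.errSystem L H T₁ T₂).IsSolutionPair E φ u) (ht : IsSliceSeq E t)
    (hT₁ : 0 < T₁) (hT : T₁ ≤ T₂) {j : ℕ} {c d : ℝ} (hcd : c ≤ d) (h : Icc c d ⊆ slice E j) :
    AbsolutelyContinuousOnInterval (fun s => V (φ s j)) c d ∧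
      ∀ᵐ s ∂(volume.restrict (Icc c d)), ∃ v, HasDerivAt (fun s => V (φ s j)) v s ∧
        v ≤ -2 * lt * V (φ s j) - ‖mulE P.Cp (φ s j).ε‖ ^ 2 + γ ^ 2 * ‖(u s j).fst‖ ^ 2 := by
  refine ⟨hV.contDiff.comp_absolutelyContinuousOnInterval (hsol.arc j c d hcd h), ?_⟩
  filter_upwards [flow_ae hsol h, ae_restrict_mem measurableSet_Icc] with s hs hmem
  refine ⟨_, ((hV.contDiff.differentiable one_ne_zero) _).hasFDerivAt.comp_hasDerivAt s hs, ?_⟩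
  exact hV.dissip _ (timer_mem hsol ht hT₁ hT (h hmem)) _

theorem lyapunov_jump (hV : P.IsLyapunov L H T₂ lt γ V a b)
    (hsol : (P.errSystem L H T₁ T₂).IsSolutionPair E φ u) (ht : IsSliceSeq E t)
    (hT₁ : 0 < T₁) (hT : T₁ ≤ T₂) {j : ℕ} (hj : (slice E (j + 1)).Nonempty) :
    V (φ (t (j + 1)) (j + 1)) ≤ V (φ (t (j + 1)) j) + b * ‖(u (t (j + 1)) j).snd‖ ^ 2 := by
  have h1 := ht.jump_mem hj
  obtain ⟨-, v, hv, h⟩ := hsol.jump _ _ h1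
  rw [h]
  exact hV.reset _ (timer_mem hsol ht hT₁ hT h1.1) _ _ ⟨hT₁.le.trans hv.1, hv.2⟩

/-- Decay of the Lyapunov function up to the contribution of the disturbances. -/
theorem lyapunov_le (hV : P.IsLyapunov L H T₂ lt γ V a b)
    (hsol : (P.errSystem L H T₁ T₂).IsSolutionPair E φ u) (hT₁ : 0 < T₁) (hT : T₁ ≤ T₂)
    (hlt : 0 < lt) {r : ℝ} (hw : ∀ j, ∀ᵐ s ∂(volume.restrict (slice E j)), ‖(u s j).fst‖ ≤ r)
    (hη : ∀ s j, (s, j) ∈ jumpTimes E → ‖(u s j).snd‖ ≤ r) {s : ℝ} {j : ℕ} (hs : (s, j) ∈ E) :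
    V (φ s j) ≤ Real.exp (-2 * lt * s) * V (φ 0 0) +
      (γ ^ 2 / (2 * lt) + b / (1 - Real.exp (-2 * lt * T₁))) * r ^ 2 := by
  obtain ⟨t, ht⟩ := hsol.dom.exists_isSliceSeq
  set β := Real.exp (-2 * lt * T₁) with hβ
  have hβ1 : β < 1 := Real.exp_lt_one_iff.2 (by nlinarith)
  -- `q` is the equilibrium of `v' = -2 λ_t v + γ² r²`; below, `R` is the fixed point of `x ↦ β x +
  -- b r²`, which describes one interval of flow and one jump.
  set q := γ ^ 2 / (2 * lt) * r ^ 2 with hq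
  set R := b / (1 - β) * r ^ 2 with hR
  have hRβ : β * R + b * r ^ 2 = R := by
    rw [hR]
    have : (1 - β) ≠ 0 := by linarith
    field_simp
    ring
  have hb := hV.b_pos
  have hR0 : 0 ≤ R := mul_nonneg (div_nonneg hb.le (by linarith)) (sq_nonneg _)
  have hq0 : 0 ≤ q := by positivity
  have flow : ∀ {s : ℝ} {j : ℕ}, (s, j) ∈ E →
      V (φ s j) - q ≤ Real.exp (-2 * lt * (s - t j)) * (V (φ (t j) j) - q) := by
    intro s j hs
    obtain ⟨h1, h2⟩ := lyapunov_flow hV hsol ht hT₁ hT (ht.start_mem hs).2 (ht.Icc_subset hs)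
    have h3 := h1.add_div_le_exp_mul (c := -2 * lt) (k := γ ^ 2 * r ^ 2) (ht.start_mem hs).2
      (by linarith) ?_
    · have e : γ ^ 2 * r ^ 2 / (-2 * lt) = -q := by rw [hq]; field_simp
      rwa [e, ← sub_eq_add_neg, ← sub_eq_add_neg] at h3
    · filter_upwards [h2, ae_restrict_of_ae_restrict_of_subset (ht.Icc_subset hs) (hw j)]
        with x ⟨v, hv1, hv2⟩ hx
      refine ⟨v, hv1, hv2.trans ?_⟩
      have : γ ^ 2 * ‖(u x j).fst‖ ^ 2 ≤ γ ^ 2 * r ^ 2 := by gcongr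
      nlinarith [sq_nonneg ‖mulE P.Cp (φ x j).ε‖]
  have jump : ∀ {j : ℕ}, (slice E (j + 1)).Nonempty →
      V (φ (t (j + 1)) (j + 1)) ≤ V (φ (t (j + 1)) j) + b * r ^ 2 := by
    intro j hj
    refine (lyapunov_jump hV hsol ht hT₁ hT hj).trans ?_
    gcongr
    exact hη _ _ (ht.jump_mem hj)
  have hexp : ∀ x y : ℝ, Real.exp (-2 * lt * (x - y)) * Real.exp (-2 * lt * y) =
      Real.exp (-2 * lt * x) := fun x y => by rw [← Real.exp_add]; congr 1; ring
  have flow' : ∀ {s : ℝ} {j : ℕ} {c : ℝ}, (s, j) ∈ E →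
      V (φ (t j) j) ≤ Real.exp (-2 * lt * t j) * V (φ 0 0) + q + c →
      V (φ s j) ≤ Real.exp (-2 * lt * s) * V (φ 0 0) + q + Real.exp (-2 * lt * (s - t j)) * c := by
    intro s j c hs h
    have h1 := flow hs
    have h2 : Real.exp (-2 * lt * (s - t j)) * (V (φ (t j) j) - q) ≤
        Real.exp (-2 * lt * (s - t j)) * (Real.exp (-2 * lt * t j) * V (φ 0 0) + c) := by
      gcongr; linarith
    rw [mul_add, ← mul_assoc, hexp] at h2
    linarith
  have base : V (φ (t 0) 0) ≤ Real.exp (-2 * lt * t 0) * V (φ 0 0) + q + 0 := by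
    rw [ht.zero]; simp [hq0]
  have start : ∀ j, (slice E (j + 1)).Nonempty →
      V (φ (t (j + 1)) (j + 1)) ≤ Real.exp (-2 * lt * t (j + 1)) * V (φ 0 0) + q + R := by
    intro j
    induction j with
    | zero =>
      -- The first slice may be arbitrarily short, so its decay is of no use. But no jump precedes
      -- it, and `b r² = R - β R ≤ R`.
      intro hj
      have h1 := flow' (ht.jump_mem hj).1 base
      have h2 := jump hj
      have h3 : 0 ≤ β * R := mul_nonneg (Real.exp_nonneg _) hR0
      linarith
    | succ j ih =>
      intro hj
      have h1 := flow' (ht.jump_mem hj).1 (ih (ht.nonempty_of_succ hj))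
      have h2 := jump hj
      have h4 : Real.exp (-2 * lt * (t (j + 1 + 1) - t (j + 1))) ≤ β := by
        refine Real.exp_le_exp.2 ?_
        have := slice_length_ge hsol ht hj
        simp only [Nat.add_assoc, Nat.reduceAdd] at this ⊢
        nlinarith
      have h5 := mul_le_mul_of_nonneg_right h4 hR0
      linarith
  rw [add_mul, ← hq, ← hR, ← add_assoc]
  cases j with
  | zero => have := flow' hs base; linarith
  | succ j =>
    have h1 := flow' hs (start j ⟨s, hs⟩)
    have h2 : Real.exp (-2 * lt * (s - t (j + 1))) ≤ 1 := by
      refine Real.exp_le_one_iff.2 ?_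
      nlinarith [(ht.start_mem hs).2]
    nlinarith

end Estimates

end Plant

/-! ### The input-to-state estimate -/

/-! ### Integration over hybrid time domains -/

namespace IsSliceSeq

variable {E : Set (ℝ × ℕ)} {t : ℕ → ℝ}

/-- A bound for integrals over compact initial parts of a slice bounds the integral over the
slice. -/
theorem lintegral_slice_le (h : IsSliceSeq E t) (j : ℕ) {f : ℝ → ℝ≥0∞} {C : ℝ≥0∞}
    (hC : ∀ s ∈ slice E j, ∫⁻ x in Icc (t j) s, f x ≤ C) : ∫⁻ x in slice E j, f x ≤ C := by
  -- Monotone convergence along an exhaustion by compact intervals; it serves the half-open and the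
  -- unbounded slices.
  have aux : ∀ c : ℕ → ℝ, Monotone c → (∀ n, c n ∈ slice E j) →
      slice E j ⊆ ⋃ n, Icc (t j) (c n) → ∫⁻ x in slice E j, f x ≤ C := by
    intro c hc hmem hsub
    refine (lintegral_mono_set hsub).trans ?_
    rw [setLIntegral_iUnion_of_directed]
    · exact iSup_le fun n => hC _ (hmem n)
    · exact Monotone.directed_le fun m n hmn => Icc_subset_Icc_right (hc hmn)
  rcases h.shape j with h1 | h1 | ⟨h2, h1⟩ | h1
  · simp [h1]
  · rw [h1]
    exact hC _ (by rw [h1]; exact ⟨h.mono j.le_succ, le_rfl⟩)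
  · obtain ⟨c, hc, hmem, hlim⟩ := exists_seq_strictMono_tendsto' h2
    refine aux c hc.monotone (fun n => by rw [h1]; exact Ioo_subset_Ico_self (hmem n)) ?_
    intro s hs
    rw [h1] at hs
    obtain ⟨n, hn⟩ := (hlim.eventually (lt_mem_nhds hs.2)).exists
    exact mem_iUnion.2 ⟨n, hs.1, hn.le⟩
  · refine aux (fun n => t j + n) (fun m n hmn => by simpa using hmn) (fun n => by simp [h1]) ?_
    intro s hs
    obtain ⟨n, hn⟩ := exists_nat_ge (s - t j)
    rw [h1] at hs
    exact mem_iUnion.2 ⟨n, hs, by linarith⟩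

/-- Slice `i` ends at `t (i + 1) ≤ t j`, whereas slice `j` starts at `t j`. So distinct slices
overlap in a null set, and `jmin` picks the right index at almost every time. -/
theorem le_of_mem_slice (h : IsSliceSeq E t) {i j : ℕ} (hij : i < j) {s : ℝ}
    (hi : s ∈ slice E i) (hj : s ∈ slice E j) : s = t j := by
  have hne : ∀ k, (slice E (i + 1 + k)).Nonempty → (slice E (i + 1)).Nonempty := by
    intro k
    induction k with
    | zero => exact id
    | succ k ih => exact fun hk => ih (h.nonempty_of_succ hk)
  obtain ⟨k, rfl⟩ := Nat.exists_eq_add_of_le (Nat.succ_le_of_lt hij)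
  rw [h.prev i (hne k ⟨s, hj⟩)] at hi
  exact le_antisymm (hi.2.trans (h.mono (by omega))) (h.start_mem hj).2

theorem jmin_eq (h : IsSliceSeq E t) {j : ℕ} {s : ℝ} (hs : s ∈ slice E j) (hne : s ≠ t j) :
    jmin E s = j := by
  have hmem : s ∈ slice E (jmin E s) := Nat.sInf_mem (s := {j | (s, j) ∈ E}) ⟨j, hs⟩
  have hle : jmin E s ≤ j := Nat.sInf_le hs
  by_contra hj
  exact hne (h.le_of_mem_slice (lt_of_le_of_ne hle hj) hmem hs)

/-- Integration over ordinary time, slice by slice. -/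
theorem lintegral_domT (h : IsSliceSeq E t) (f : ℝ → ℕ → ℝ≥0∞) :
    ∫⁻ s in domT E, f s (jmin E s) = ∑' j, ∫⁻ s in slice E j, f s j := by
  have h1 : domT E = ⋃ j, slice E j := by ext s; simp [domT, slice]
  rw [h1, lintegral_iUnion₀ (fun j => (h.measurableSet_slice j).nullMeasurableSet)]
  · refine tsum_congr fun j => setLIntegral_congr_fun_ae (h.measurableSet_slice j) ?_
    filter_upwards [Measure.ae_ne volume (t j)] with s hs hmem
    rw [h.jmin_eq hmem hs]
  · have aux : ∀ i j, i < j → AEDisjoint volume (slice E i) (slice E j) := fun i j hij =>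
      measure_mono_null (fun s hs => h.le_of_mem_slice hij hs.1 hs.2)
        (Real.volume_singleton (a := t j))
    intro i j hij
    rcases lt_or_gt_of_ne hij with h2 | h2
    · exact aux i j h2
    · exact (aux j i h2).symm

end IsSliceSeq

namespace Plant

variable {nz nw ny ns nq np : ℕ}

section Estimates

variable {P : Plant nz nw ny ns nq np} {L : Matrix (Fin nz) (Fin ny) ℝ}
  {H : Matrix (Fin ny) (Fin ny) ℝ} {T₁ T₂ lt γ : ℝ} {V : ErrState nz ny → ℝ} {a b : ℝ}
  {E : Set (ℝ × ℕ)} {φ : ℝ → ℕ → ErrState nz ny} {u : ℝ → ℕ → WithLp 2 (Eu nw × Eu ny)}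
  {t : ℕ → ℝ}

theorem error_sq_le (hV : P.IsLyapunov L H T₂ lt γ V a b)
    (hsol : (P.errSystem L H T₁ T₂).IsSolutionPair E φ u) (hT₁ : 0 < T₁) (hT : T₁ ≤ T₂)
    (hlt : 0 < lt) {r : ℝ} (hw : ∀ j, ∀ᵐ s ∂(volume.restrict (slice E j)), ‖(u s j).fst‖ ≤ r)
    (hη : ∀ s j, (s, j) ∈ jumpTimes E → ‖(u s j).snd‖ ≤ r) {s : ℝ} {j : ℕ} (hs : (s, j) ∈ E) :
    ‖(φ s j).ε‖ ^ 2 + ‖(φ s j).θ‖ ^ 2 ≤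
      b / a * (Real.exp (-2 * lt * s) * (‖(φ 0 0).ε‖ ^ 2 + ‖(φ 0 0).θ‖ ^ 2)) +
      (γ ^ 2 / (2 * lt) + b / (1 - Real.exp (-2 * lt * T₁))) / a * r ^ 2 := by
  obtain ⟨t, ht⟩ := hsol.dom.exists_isSliceSeq
  have ha := hV.a_pos
  have h00 : ((0 : ℝ), 0) ∈ E := by
    have := (ht.start_mem ht.nonempty.some_mem).1
    rwa [ht.zero] at this
  have h1 := lyapunov_le hV hsol hT₁ hT hlt hw hη hs
  have h2 := hV.le_self _ (timer_mem hsol ht hT₁ hT hs)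
  have h3 : Real.exp (-2 * lt * s) * V (φ 0 0) ≤
      Real.exp (-2 * lt * s) * (b * (‖(φ 0 0).ε‖ ^ 2 + ‖(φ 0 0).θ‖ ^ 2)) := by
    gcongr
    exact hV.self_le _ (timer_mem hsol ht hT₁ hT h00)
  rw [← mul_le_mul_iff_right₀ ha]
  refine (h2.trans (h1.trans (add_le_add_left h3 _))).trans (le_of_eq ?_)
  field_simp

/-- The hybrid error system is pre-exponentially input-to-state stable. -/
theorem isPreEISS (hV : P.IsLyapunov L H T₂ lt γ V a b) (hT₁ : 0 < T₁) (hT : T₁ ≤ T₂)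
    (hlt : 0 < lt) : (P.errSystem L H T₁ T₂).IsPreEISS (errSet nz ny T₂) := by
  have ha := hV.a_pos
  have hb := hV.b_pos
  set c := (γ ^ 2 / (2 * lt) + b / (1 - Real.exp (-2 * lt * T₁))) / a with hc
  have hc0 : 0 ≤ c := by
    have hβ1 : Real.exp (-2 * lt * T₁) < 1 := Real.exp_lt_one_iff.2 (by nlinarith)
    have : 0 ≤ 1 - Real.exp (-2 * lt * T₁) := by linarith
    positivity
  -- From `j - 1 ≤ s / T₁` one gets `lam (s + j) ≤ λ_t s + lam`. The extra `lam` is the factor `exp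
  -- lam` in the overshoot constant.
  set lam := lt / (1 + 1 / T₁) with hlam
  have hlam0 : 0 < lam := by positivity
  -- The added `1` makes the gain strictly increasing without a proof that `c` is positive.
  set k : ℝ≥0 := ⟨√(2 * c) + 1, by positivity⟩ with hk
  refine ⟨√(2 * (b / a)) * Real.exp lam, lam, fun r => k * r, by positivity, hlam0, by fun_prop,
    ?_, by simp, fun E φ u hsol hu s j hs => ?_⟩
  · refine strictMono_mul_left_of_pos ?_
    exact NNReal.coe_pos.1 (by rw [hk]; change 0 < √(2 * c) + 1; positivity)
  obtain ⟨t, ht⟩ := hsol.dom.exists_isSliceSeq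
  set r := (linfNorm E u).toNNReal with hr
  have hnorm : ∀ x : WithLp 2 (Eu nw × Eu ny), ‖x‖ₑ ≤ linfNorm E u → ‖x‖ ≤ r := fun x hx => by
    rw [← ENNReal.coe_toNNReal hu.ne, enorm_eq_nnnorm] at hx
    exact_mod_cast hx
  have hT₂ : 0 ≤ T₂ := hT₁.le.trans hT
  have hw : ∀ j, ∀ᵐ s ∂(volume.restrict (slice E j)), ‖(u s j).fst‖ ≤ (r : ℝ) := fun j => by
    filter_upwards [ae_enorm_le_linfNorm u ht j] with s hs
    exact (WithLp.norm_fst_le _ (u s j)).trans (hnorm _ hs)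
  have hη : ∀ s j, (s, j) ∈ jumpTimes E → ‖(u s j).snd‖ ≤ (r : ℝ) := fun s j hj =>
    (WithLp.norm_snd_le _ (u s j)).trans (hnorm _ (enorm_le_linfNorm_of_jump u hj))
  have h1 := error_sq_le hV hsol hT₁ hT hlt hw hη hs
  rw [← hc] at h1
  set D := Metric.infDist (φ s j) (errSet nz ny T₂) with hD
  set D₀ := Metric.infDist (φ 0 0) (errSet nz ny T₂) with hD₀
  have hD0 : 0 ≤ D := Metric.infDist_nonneg
  have hD₀0 : 0 ≤ D₀ := Metric.infDist_nonneg
  have h2 : D ^ 2 ≤ b / a * (Real.exp (-2 * lt * s) * D₀ ^ 2) + c * r ^ 2 := by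
    refine ((ErrState.infDist_errSet_sq_le _ (timer_mem hsol ht hT₁ hT hs)).trans h1).trans ?_
    gcongr
    exact ErrState.le_infDist_errSet_sq hT₂ _
  have hexp : Real.exp (-2 * lt * s) ≤ (Real.exp lam * Real.exp (-lam * (s + j))) ^ 2 := by
    rw [← Real.exp_add, ← Real.exp_nat_mul]
    refine Real.exp_le_exp.2 ?_
    have h3 := mul_le_time hsol ht hT₁ hs
    have h4 : (j : ℝ) - 1 ≤ s / T₁ := by rw [le_div_iff₀ hT₁]; linarith
    have h5 : lam * (s + s / T₁) = lt * s := by rw [hlam]; field_simp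
    have h6 := mul_le_mul_of_nonneg_left h4 hlam0.le
    push_cast
    linarith
  set e := Real.exp lam * Real.exp (-lam * (s + j)) with he
  have hX : D ^ 2 ≤ b / a * (e * D₀) ^ 2 + c * r ^ 2 := by
    refine h2.trans ?_
    rw [mul_pow]
    gcongr
  have hr0 : (0 : ℝ) ≤ r := r.2
  -- A sum is at most twice its larger term; hence the factors `2` under the square roots.
  rcases le_total (b / a * (e * D₀) ^ 2) (c * (r : ℝ) ^ 2) with hle | hle
  · refine le_max_of_le_right ?_
    change D ≤ (√(2 * c) + 1) * r
    have h7 : D ≤ √(2 * c) * r := by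
      refine le_of_sq_le_sq ?_ (by positivity)
      rw [mul_pow, Real.sq_sqrt (by positivity)]
      linarith
    linarith
  · refine le_max_of_le_left ?_
    have h7 : D ≤ √(2 * (b / a)) * (e * D₀) := by
      refine le_of_sq_le_sq ?_ (by positivity)
      rw [mul_pow, Real.sq_sqrt (by positivity)]
      linarith
    rw [he] at h7
    linarith

/-! ### The `L²` gain -/

/-- Integrated dissipation, with the decay term discarded since `V ≥ 0`. In `ℝ≥0∞` the bounds can be
summed over slices even when the total integrals are infinite. -/
theorem integral_dissipation (hV : P.IsLyapunov L H T₂ lt γ V a b)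
    (hsol : (P.errSystem L H T₁ T₂).IsSolutionPair E φ u) (ht : IsSliceSeq E t)
    (hT₁ : 0 < T₁) (hT : T₁ ≤ T₂) (hlt : 0 < lt) {j : ℕ} {c d : ℝ} (hcd : c ≤ d)
    (h : Icc c d ⊆ slice E j) :
    (∫⁻ s in Icc c d, ‖mulE P.Cp (φ s j).ε‖ₑ ^ 2) + ENNReal.ofReal (V (φ d j)) ≤
      ENNReal.ofReal (V (φ c j)) +
        ENNReal.ofReal (γ ^ 2) * ∫⁻ s in Icc c d, ‖(u s j).fst‖ₑ ^ 2 := by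
  have hVnn : ∀ s ∈ Icc c d, 0 ≤ V (φ s j) := fun s hs => by
    refine le_trans ?_ (hV.le_self _ (timer_mem hsol ht hT₁ hT (h hs)))
    have := hV.a_pos
    positivity
  obtain ⟨h1, h2⟩ := lyapunov_flow hV hsol ht hT₁ hT hcd h
  have hY : IntervalIntegrable (fun s => ‖mulE P.Cp (φ s j).ε‖ ^ 2) volume c d := by
    refine ContinuousOn.intervalIntegrable ?_
    have h3 := (hsol.arc j c d hcd h).continuousOn
    exact (((mulL P.Cp).continuous.comp ErrState.εL.continuous).comp_continuousOn h3).norm.pow 2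
  -- Square integrability of `w` on a compact interval comes from local essential boundedness of the
  -- input.
  have hW : IntervalIntegrable (fun s => ‖(u s j).fst‖ ^ 2) volume c d := by
    obtain ⟨hm, hbd⟩ := hsol.input j
    obtain ⟨M, hM⟩ := hbd d
    have hsub : Ioc c d ⊆ slice E j ∩ Iic d := fun s hs => ⟨h (Ioc_subset_Icc_self hs), hs.2⟩
    have hM' := ae_restrict_of_ae_restrict_of_subset hsub hM
    have hm' : AEStronglyMeasurable (fun s => (u s j).fst) (volume.restrict (Ioc c d)) :=
      (WithLp.fstL 2 ℝ (Eu nw) (Eu ny)).continuous.comp_aestronglyMeasurable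
        (hm.mono_set (hsub.trans inter_subset_left))
    rw [intervalIntegrable_iff_integrableOn_Ioc_of_le hcd]
    refine Integrable.of_bound (hm'.norm.pow 2) (M ^ 2) ?_
    filter_upwards [hM'] with s hs
    rw [norm_pow, norm_norm]
    exact pow_le_pow_left₀ (norm_nonneg _) ((WithLp.norm_fst_le _ _).trans hs) 2
  have h3 := h1.sub_le_integral
    (h := fun s => γ ^ 2 * ‖(u s j).fst‖ ^ 2 - ‖mulE P.Cp (φ s j).ε‖ ^ 2) hcd
    (by
      filter_upwards [h2, ae_restrict_mem measurableSet_Icc] with s ⟨v, hv1, hv2⟩ hs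
      refine ⟨v, hv1, ?_⟩
      have := mul_nonneg hlt.le (hVnn s hs)
      linarith)
    ((hW.const_mul _).sub hY)
  rw [intervalIntegral.integral_sub (hW.const_mul _) hY, intervalIntegral.integral_const_mul] at h3
  have conv : ∀ {F : ℝ → ℝ} {f : ℝ → ℝ≥0∞}, IntervalIntegrable (fun s => F s ^ 2) volume c d →
      (∀ s, f s = ENNReal.ofReal (F s ^ 2)) →
      ∫⁻ s in Icc c d, f s = ENNReal.ofReal (∫ s in c..d, F s ^ 2) := by
    intro F f hF hf
    rw [intervalIntegral.integral_of_le hcd, ofReal_integral_eq_lintegral_ofReal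
      ((intervalIntegrable_iff_integrableOn_Ioc_of_le hcd).1 hF)
      (Eventually.of_forall fun s => sq_nonneg _), restrict_Ioc_eq_restrict_Icc]
    exact lintegral_congr hf
  have he : ∀ {F : Type} [NormedAddCommGroup F] (x : F), ‖x‖ₑ ^ 2 = ENNReal.ofReal (‖x‖ ^ 2) :=
    fun x => by rw [ENNReal.ofReal_pow (norm_nonneg _), ofReal_norm]
  rw [conv hY (fun s => he _), conv hW (fun s => he _),
    ← ENNReal.ofReal_mul (sq_nonneg γ), ← ENNReal.ofReal_add _ (hVnn d ⟨hcd, le_rfl⟩),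
    ← ENNReal.ofReal_add (hVnn c ⟨le_rfl, hcd⟩)]
  · exact ENNReal.ofReal_le_ofReal (by linarith)
  · exact mul_nonneg (sq_nonneg _) (intervalIntegral.integral_nonneg hcd fun s _ => sq_nonneg _)
  · exact intervalIntegral.integral_nonneg hcd fun s _ => sq_nonneg _

/-- The storage at the end of a slice pays for the storage at the start of the next, since jumps do
not increase `V` when `η = 0`. The sum over slices telescopes. -/
theorem lintegral_output_le (hV : P.IsLyapunov L H T₂ lt γ V a b)
    (hsol : (P.errSystem L H T₁ T₂).IsSolutionPair E φ u) (hT₁ : 0 < T₁) (hT : T₁ ≤ T₂)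
    (hlt : 0 < lt) (hη : ∀ t j, (t, j) ∈ E → (u t j).snd = 0) :
    ∫⁻ s in domT E, ‖mulE P.Cp (φ s (jmin E s)).ε‖ₑ ^ 2 ≤ ENNReal.ofReal (V (φ 0 0)) +
      ENNReal.ofReal (γ ^ 2) * ∫⁻ s in domT E, ‖(u s (jmin E s)).fst‖ₑ ^ 2 := by
  classical
  obtain ⟨t, ht⟩ := hsol.dom.exists_isSliceSeq
  rw [ht.lintegral_domT fun s j => ‖mulE P.Cp (φ s j).ε‖ₑ ^ 2,
    ht.lintegral_domT fun s j => ‖(u s j).fst‖ₑ ^ 2]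
  set A : ℕ → ℝ≥0∞ := fun j => ∫⁻ s in slice E j, ‖mulE P.Cp (φ s j).ε‖ₑ ^ 2 with hA
  set B : ℕ → ℝ≥0∞ := fun j => ∫⁻ s in slice E j, ‖(u s j).fst‖ₑ ^ 2 with hB
  -- The value `0` after the last slice makes the one-step inequality true for every `j`, however
  -- the domain ends.
  set v : ℕ → ℝ≥0∞ :=
    fun j => if (slice E j).Nonempty then ENNReal.ofReal (V (φ (t j) j)) else 0 with hv
  have step : ∀ j, A j + v (j + 1) ≤ v j + ENNReal.ofReal (γ ^ 2) * B j := by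
    intro j
    by_cases hj1 : (slice E (j + 1)).Nonempty
    · have hj := ht.nonempty_of_succ hj1
      have hle := ht.mono j.le_succ
      have h1 := integral_dissipation hV hsol ht hT₁ hT hlt hle (ht.prev j hj1).ge
      have h2 := lyapunov_jump hV hsol ht hT₁ hT hj1
      rw [hη _ _ (ht.jump_mem hj1).1, norm_zero] at h2
      simp only [hA, hB, hv, if_pos hj, if_pos hj1]
      rw [ht.prev j hj1]
      refine le_trans ?_ h1
      gcongr
      linarith
    · simp only [hv, if_neg hj1, add_zero]
      by_cases hj : (slice E j).Nonempty
      · rw [if_pos hj]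
        -- The last slice may have no right end point, so the bound is proved on its compact initial
        -- parts.
        refine ht.lintegral_slice_le j fun s hs => ?_
        have h1 := integral_dissipation hV hsol ht hT₁ hT hlt (ht.start_mem hs).2
          (ht.Icc_subset hs)
        refine le_self_add.trans (h1.trans ?_)
        gcongr
        exact lintegral_mono_set (ht.Icc_subset hs)
      · rw [if_neg hj]
        simp [hA, not_nonempty_iff_eq_empty.1 hj]
  have hsum : ∀ n, ∑ j ∈ Finset.range n, A j + v n ≤
      v 0 + ENNReal.ofReal (γ ^ 2) * ∑ j ∈ Finset.range n, B j := by
    intro n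
    induction n with
    | zero => simp
    | succ n ih =>
      rw [Finset.sum_range_succ, Finset.sum_range_succ, add_assoc, mul_add]
      refine (add_le_add le_rfl (step n)).trans ?_
      rw [← add_assoc, ← add_assoc]
      exact add_le_add ih le_rfl
  have hv0 : v 0 = ENNReal.ofReal (V (φ 0 0)) := by
    simp only [hv, if_pos ht.nonempty, ht.zero]
  rw [← hv0]
  refine ENNReal.tsum_le_of_sum_range_le fun n => le_self_add.trans ((hsum n).trans ?_)
  gcongr
  exact ENNReal.sum_le_tsum _

/-- The `L²` gain of the hybrid error system. -/
theorem l2_gain_hybrid (hV : P.IsLyapunov L H T₂ lt γ V a b)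
    (hsol : (P.errSystem L H T₁ T₂).IsSolutionPair E φ u) (hT₁ : 0 < T₁) (hT : T₁ ≤ T₂)
    (hlt : 0 < lt) (hγ : 0 < γ) (hη : ∀ t j, (t, j) ∈ E → (u t j).snd = 0) :
    (∫⁻ s in domT E, ‖mulE P.Cp (φ s (jmin E s)).ε‖ₑ ^ 2) ^ (1 / 2 : ℝ) ≤
      ENNReal.ofReal (√b * √(‖(φ 0 0).ε‖ ^ 2 + ‖(φ 0 0).θ‖ ^ 2)) +
        ENNReal.ofReal γ * (∫⁻ s in domT E, ‖(u s (jmin E s)).fst‖ₑ ^ 2) ^ (1 / 2 : ℝ) := by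
  obtain ⟨t, ht⟩ := hsol.dom.exists_isSliceSeq
  have h00 : ((0 : ℝ), 0) ∈ E := by
    have := (ht.start_mem ht.nonempty.some_mem).1
    rwa [ht.zero] at this
  have hb := hV.b_pos
  have hhalf : (0 : ℝ) ≤ 1 / 2 := by norm_num
  refine (ENNReal.rpow_le_rpow (lintegral_output_le hV hsol hT₁ hT hlt hη) hhalf).trans ?_
  -- Subadditivity of the square root separates the initial condition from the input without
  -- enlarging the gain `γ`.
  refine (ENNReal.rpow_add_le_add_rpow _ _ hhalf (by norm_num)).trans ?_
  refine add_le_add ?_ (le_of_eq ?_)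
  · rw [ENNReal.ofReal_rpow_of_nonneg _ hhalf]
    · refine ENNReal.ofReal_le_ofReal ?_
      rw [← Real.sqrt_eq_rpow, ← Real.sqrt_mul hb.le]
      exact Real.sqrt_le_sqrt (hV.self_le _ (timer_mem hsol ht hT₁ hT h00))
    · refine le_trans ?_ (hV.le_self _ (timer_mem hsol ht hT₁ hT h00))
      have := hV.a_pos
      positivity
  · rw [ENNReal.mul_rpow_of_nonneg _ _ hhalf, ENNReal.ofReal_rpow_of_nonneg (sq_nonneg _) hhalf,
      ← Real.sqrt_eq_rpow, Real.sqrt_sq hγ.le]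

end Estimates

end Plant

/-! ### Lipschitz continuity of the flow map -/

/-- Lipschitz continuity with an unspecified constant. -/
def IsLip {X Y : Type*} [SeminormedAddCommGroup X] [SeminormedAddCommGroup Y] (f : X → Y) : Prop :=
  ∃ K, LipschitzWith K f

namespace IsLip

variable {X Y Z : Type*} [SeminormedAddCommGroup X]

theorem comp [SeminormedAddCommGroup Y] [SeminormedAddCommGroup Z] {g : Y → Z} {f : X → Y}
    (hg : IsLip g) (hf : IsLip f) : IsLip fun x => g (f x) :=
  let ⟨_, h⟩ := hg; let ⟨_, h'⟩ := hf; ⟨_, h.comp h'⟩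

theorem add [SeminormedAddCommGroup Y] {f g : X → Y} (hf : IsLip f) (hg : IsLip g) :
    IsLip fun x => f x + g x :=
  let ⟨_, h⟩ := hf; let ⟨_, h'⟩ := hg; ⟨_, h.add h'⟩

theorem sub [SeminormedAddCommGroup Y] {f g : X → Y} (hf : IsLip f) (hg : IsLip g) :
    IsLip fun x => f x - g x :=
  let ⟨_, h⟩ := hf; let ⟨_, h'⟩ := hg; ⟨_, h.sub h'⟩

theorem prodMk [SeminormedAddCommGroup Y] [SeminormedAddCommGroup Z] {f : X → Y} {g : X → Z}
    (hf : IsLip f) (hg : IsLip g) : IsLip fun x => (f x, g x) :=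
  let ⟨_, h⟩ := hf; let ⟨_, h'⟩ := hg; ⟨_, h.prodMk h'⟩

theorem fst [SeminormedAddCommGroup Y] : IsLip fun p : X × Y => p.1 := ⟨_, LipschitzWith.prod_fst⟩

theorem snd [SeminormedAddCommGroup Y] : IsLip fun p : X × Y => p.2 := ⟨_, LipschitzWith.prod_snd⟩

theorem const [SeminormedAddCommGroup Y] (y : Y) : IsLip fun _ : X => y := ⟨_, LipschitzWith.const y⟩

theorem clm [SeminormedAddCommGroup Y] [NormedSpace ℝ Y] [SeminormedAddCommGroup Z]
    [NormedSpace ℝ Z] (A : Y →L[ℝ] Z) : IsLip A := ⟨_, A.lipschitz⟩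

theorem mulE {m n : ℕ} (M : Matrix (Fin m) (Fin n) ℝ) {f : X → Eu n} (hf : IsLip f) :
    IsLip fun x => _root_.mulE M (f x) := (clm (mulL M)).comp hf

end IsLip

namespace Plant

variable {nz nw ny ns nq np : ℕ}

theorem isLip_psi {P : Plant nz nw ny ns nq np} {ℓ : ℝ} (hℓ : 0 < ℓ)
    (hψ : ∀ v₁ v₂, ‖P.ψ v₁ - P.ψ v₂‖ ≤ ℓ * ‖v₁ - v₂‖) : IsLip P.ψ :=
  ⟨⟨ℓ, hℓ.le⟩, LipschitzWith.of_dist_le_mul fun x y => by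
    rw [dist_eq_norm, dist_eq_norm]; exact hψ x y⟩

theorem isLip_errFlow {P : Plant nz nw ny ns nq np} (L : Matrix (Fin nz) (Fin ny) ℝ)
    (H : Matrix (Fin ny) (Fin ny) ℝ) (hψ : IsLip P.ψ) :
    IsLip fun p : ErrState nz ny × Eu nw => P.errFlow L H p.1 p.2 := by
  have hz : IsLip fun p : ErrState nz ny × Eu nw => p.1.z := (IsLip.clm ErrState.zL).comp .fst
  have hε : IsLip fun p : ErrState nz ny × Eu nw => p.1.ε := (IsLip.clm ErrState.εL).comp .fst
  have hθ : IsLip fun p : ErrState nz ny × Eu nw => p.1.θ := (IsLip.clm ErrState.θL).comp .fst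
  have hw : IsLip fun p : ErrState nz ny × Eu nw => p.2 := .snd
  have hζ : IsLip fun p : ErrState nz ny × Eu nw => P.ζ p.1.z p.1.ε :=
    (hψ.comp (.mulE _ hz)).sub (hψ.comp (.mulE _ (hz.sub hε)))
  have h₁ := ((IsLip.mulE P.A hz).add (.mulE P.B (hψ.comp (.mulE P.S hz)))).add (.mulE P.N hw)
  have h₂ := (((IsLip.mulE (P.A - L * P.C) hε).add (.mulE L hθ)).add (.mulE P.B hζ)).add
    (.mulE P.N hw)
  have h₃ := (((IsLip.mulE (P.C * P.A - P.C * L * P.C - H * P.C) hε).add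
    (.mulE (P.C * L + H) hθ)).add (.mulE (P.C * P.B) hζ)).add (.mulE (P.C * P.N) hw)
  have h := (IsLip.clm (ErrState.mkL (nz := nz) (ny := ny))).comp
    (h₁.prodMk (h₂.prodMk (h₃.prodMk (.const (-1)))))
  simp only [ErrState.mkL_apply] at h
  unfold Plant.errFlow
  exact h

theorem exists_norm_errFlow_le {P : Plant nz nw ny ns nq np} (L : Matrix (Fin nz) (Fin ny) ℝ)
    (H : Matrix (Fin ny) (Fin ny) ℝ) (hψ : IsLip P.ψ) :
    ∃ c, 0 < c ∧ ∀ x w, ‖P.errFlow L H x w‖ ≤ c * (‖x‖ + ‖w‖ + 1) := by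
  obtain ⟨K, hK⟩ := isLip_errFlow L H hψ
  refine ⟨K + ‖P.errFlow L H 0 0‖ + 1, by positivity, fun x w => ?_⟩
  have h1 := hK.dist_le_mul (x, w) (0, 0)
  rw [dist_eq_norm, dist_eq_norm] at h1
  have h2 : ‖((x, w) : ErrState nz ny × Eu nw) - (0, 0)‖ ≤ ‖x‖ + ‖w‖ := by
    rw [Prod.mk_sub_mk, sub_zero, sub_zero, Prod.norm_mk]
    exact max_le (le_add_of_nonneg_right (norm_nonneg _)) (le_add_of_nonneg_left (norm_nonneg _))
  have h3 : ‖P.errFlow L H x w‖ ≤ ‖P.errFlow L H x w - P.errFlow L H 0 0‖ +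
      ‖P.errFlow L H 0 0‖ := by
    simpa using norm_add_le (P.errFlow L H x w - P.errFlow L H 0 0) (P.errFlow L H 0 0)
  have h4 := mul_le_mul_of_nonneg_left h2 K.2
  have h5 : (0 : ℝ) ≤ K := K.2
  simp only [NNReal.val_eq_coe] at h4
  have := norm_nonneg x
  have := norm_nonneg w
  have h6 := norm_nonneg (P.errFlow L H 0 0)
  have h7 := mul_nonneg h6 (add_nonneg (norm_nonneg x) (norm_nonneg w))
  dsimp only at h1
  nlinarith

end Plant

/-! ### Extension of solution pairs -/

/-- The frontier of a convex set is null. This lets differentiability be checked in the interior,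
where curves that agree on the slice agree near the point. -/
theorem Set.OrdConnected.ae_mem_interior {s : Set ℝ} (hs : s.OrdConnected) :
    ∀ᵐ x ∂(volume.restrict s), x ∈ interior s := by
  rw [ae_restrict_iff' hs.measurableSet]
  have h := hs.convex.addHaar_frontier volume
  filter_upwards [compl_mem_ae_iff.2 h] with x hx hxs
  by_contra hi
  exact hx ⟨subset_closure hxs, hi⟩

namespace HybridSystem

variable {X W Y : Type*} [NormedAddCommGroup X] [NormedSpace ℝ X]
  [NormedAddCommGroup W] [NormedAddCommGroup Y]

open Classical in
/-- A solution pair extends to a larger hybrid time domain by curves on the new slices, with the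
input continued by zero. -/
theorem IsSolutionPair.extend {S : HybridSystem X W Y} {E E' : Set (ℝ × ℕ)}
    {φ φ' : ℝ → ℕ → X} {u : ℝ → ℕ → WithLp 2 (W × Y)} (hsol : S.IsSolutionPair E φ u)
    (hE' : IsHybridTimeDomain E') (hφ : ∀ s j, (s, j) ∈ E → φ' s j = φ s j)
    (harc : ∀ j, slice E' j ≠ slice E j → ∀ a b, a ≤ b → Icc a b ⊆ slice E' j →
      AbsolutelyContinuousOnInterval (fun s => φ' s j) a b)
    (hmem : ∀ j, slice E' j ≠ slice E j → ∀ s ∈ interior (slice E' j), φ' s j ∈ S.flowSet)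
    (hflow : ∀ j, slice E' j ≠ slice E j → ∀ᵐ s ∂(volume.restrict (slice E' j)),
      HasDerivAt (fun s => φ' s j)
        (S.flowMap (φ' s j) (if (s, j) ∈ E then u s j else 0).fst) s)
    (hjump : ∀ s j, (s, j) ∈ jumpTimes E' → (s, j) ∉ jumpTimes E →
      (s, j) ∈ E ∧ φ s j ∈ S.jumpSet ∧ φ' s (j + 1) ∈ S.jumpMap (φ s j) (u s j).snd) :
    S.IsSolutionPair E' φ' fun s j => if (s, j) ∈ E then u s j else 0 := by
  obtain ⟨t, ht⟩ := hsol.dom.exists_isSliceSeq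
  have h00 : ((0 : ℝ), 0) ∈ E := by
    have := (ht.start_mem ht.nonempty.some_mem).1
    rwa [ht.zero] at this
  refine ⟨hE', fun j a b hab hs => ?_, fun j => ⟨?_, fun T => ?_⟩, ?_, fun j => ?_, fun j => ?_,
    fun s j hs => ?_⟩
  · by_cases hj : slice E' j = slice E j
    · rw [hj] at hs
      refine (hsol.arc j a b hab hs).congr fun s hs' => (hφ s j ?_).symm
      rw [uIcc_of_le hab] at hs'
      exact hs hs'
    · exact harc j hj a b hab hs
  · have h1 : (fun s => if (s, j) ∈ E then u s j else 0) =
        (slice E j).indicator (fun s => u s j) := by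
      ext1 s; rfl
    rw [h1]
    exact ((aestronglyMeasurable_indicator_iff (ht.measurableSet_slice j)).2
      (hsol.input j).1).mono_measure Measure.restrict_le_self
  · obtain ⟨M, hM⟩ := (hsol.input j).2 T
    obtain ⟨t', ht'⟩ := hE'.exists_isSliceSeq
    refine ⟨max M 0, ?_⟩
    rw [ae_restrict_iff' ((ht.measurableSet_slice j).inter measurableSet_Iic)] at hM
    rw [ae_restrict_iff' ((ht'.measurableSet_slice j).inter measurableSet_Iic)]
    filter_upwards [hM] with s h1 h2
    split_ifs with h3
    · exact (h1 ⟨h3, h2.2⟩).trans (le_max_left _ _)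
    · simp
  · rw [hφ 0 0 h00]
    exact hsol.init
  · by_cases hj : slice E' j = slice E j
    · intro s hs
      rw [hj] at hs
      have hsE : s ∈ slice E j := interior_subset hs
      rw [hφ s j hsE]
      exact hsol.flow_mem j s hs
    · exact hmem j hj
  · by_cases hj : slice E' j = slice E j
    · rw [hj]
      filter_upwards [hsol.flow j, (ht.ordConnected j).ae_mem_interior] with s h1 h2
      have hsE : s ∈ slice E j := interior_subset h2
      rw [if_pos (show (s, j) ∈ E from hsE), hφ s j hsE]
      refine h1.congr_of_eventuallyEq ?_
      filter_upwards [isOpen_interior.mem_nhds h2] with r hr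
      have hrE : r ∈ slice E j := interior_subset hr
      exact hφ r j hrE
    · exact hflow j hj
  · by_cases hj : (s, j) ∈ jumpTimes E
    · rw [if_pos hj.1, hφ s j hj.1, hφ s (j + 1) hj.2]
      exact hsol.jump s j hj
    · obtain ⟨h1, h2, h3⟩ := hjump s j hs hj
      rw [if_pos h1, hφ s j h1]
      exact ⟨h2, h3⟩

end HybridSystem

/-! ### Maximal solution pairs are complete -/

namespace Plant

variable {nz nw ny ns nq np : ℕ} {P : Plant nz nw ny ns nq np} {L : Matrix (Fin nz) (Fin ny) ℝ}
  {H : Matrix (Fin ny) (Fin ny) ℝ} {T₁ T₂ : ℝ}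
  {E : Set (ℝ × ℕ)} {φ : ℝ → ℕ → ErrState nz ny} {u : ℝ → ℕ → WithLp 2 (Eu nw × Eu ny)}
  {t : ℕ → ℝ}

/-- Linear growth of the flow map and boundedness of the input rule out finite escape, by comparison
for `|φ|²`. -/
theorem exists_norm_le_on_slice (hψ : IsLip P.ψ)
    (hsol : (P.errSystem L H T₁ T₂).IsSolutionPair E φ u) (ht : IsSliceSeq E t) (j : ℕ) (d : ℝ) :
    ∃ M W, ∀ s ∈ slice E j, s ≤ d → ‖φ s j‖ ≤ M ∧
      ∀ᵐ s ∂(volume.restrict (slice E j ∩ Iic d)), ‖(u s j).fst‖ ≤ W := by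
  obtain ⟨c, hc, hF⟩ := exists_norm_errFlow_le (nw := nw) L H hψ
  obtain ⟨W, hW⟩ := (hsol.input j).2 d
  have hW' : ∀ᵐ s ∂(volume.restrict (slice E j ∩ Iic d)), ‖(u s j).fst‖ ≤ W := by
    filter_upwards [hW] with s hs
    exact (WithLp.norm_fst_le _ (u s j)).trans hs
  set k := c * (W + 1) with hk
  -- `2 |φ| (c |φ| + k) ≤ (2 c + 1) |φ|² + k²`, by completing the square.
  set e := 2 * c + 1 with he
  have he0 : 0 < e := by positivity
  set R := Real.exp (e * (d - t j)) * (‖φ (t j) j‖ ^ 2 + k ^ 2 / e) with hR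
  refine ⟨√R, W, fun s hs hsd => ⟨?_, hW'⟩⟩
  have hle := (ht.start_mem hs).2
  have hac := (contDiff_norm_sq ℝ).comp_absolutelyContinuousOnInterval
    (hsol.arc j (t j) s hle (ht.Icc_subset hs))
  have hsub : Icc (t j) s ⊆ slice E j ∩ Iic d := fun x hx =>
    ⟨ht.Icc_subset hs hx, hx.2.trans hsd⟩
  have h1 := hac.add_div_le_exp_mul (c := e) (k := k ^ 2) hle he0.ne' ?_
  · refine Real.le_sqrt_of_sq_le ?_
    have h2 : 0 ≤ k ^ 2 / e := by positivity
    have h3 : Real.exp (e * (s - t j)) * (‖φ (t j) j‖ ^ 2 + k ^ 2 / e) ≤ R := by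
      rw [hR]
      gcongr
    linarith
  · filter_upwards [flow_ae hsol (ht.Icc_subset hs),
      ae_restrict_of_ae_restrict_of_subset hsub hW'] with x hx hw
    refine ⟨_, hx.norm_sq, ?_⟩
    have h2 : inner ℝ (φ x j) (P.errFlow L H (φ x j) (u x j).fst) ≤
        ‖φ x j‖ * (c * ‖φ x j‖ + k) := by
      refine (real_inner_le_norm _ _).trans ?_
      gcongr
      refine (hF _ _).trans ?_
      have := mul_le_mul_of_nonneg_left hw hc.le
      rw [hk]
      linarith
    rw [he]
    nlinarith [sq_nonneg (‖φ x j‖ - k)]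

/-- On bounded parts of a slice, solutions are Lipschitz. -/
theorem exists_lipschitzOnWith_slice (hψ : IsLip P.ψ)
    (hsol : (P.errSystem L H T₁ T₂).IsSolutionPair E φ u) (ht : IsSliceSeq E t) (j : ℕ) (d : ℝ) :
    ∃ M : ℝ≥0, ∀ x y, x ∈ slice E j → y ∈ slice E j → x ≤ y → y ≤ d →
      ‖φ y j - φ x j‖ ≤ M * (y - x) := by
  obtain ⟨c, hc, hF⟩ := exists_norm_errFlow_le (nw := nw) L H hψ
  obtain ⟨M, W, h⟩ := exists_norm_le_on_slice hψ hsol ht j d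
  refine ⟨(c * (M + W + 1)).toNNReal, fun x y hx hy hxy hyd => ?_⟩
  have hsub : Icc x y ⊆ slice E j := (ht.ordConnected j).out hx hy
  have hsub' : Icc x y ⊆ slice E j ∩ Iic d := fun z hz => ⟨hsub hz, hz.2.trans hyd⟩
  refine ((hsol.arc j x y hxy hsub).norm_sub_le (M := c * (M + W + 1)) hxy ?_).trans ?_
  · filter_upwards [flow_ae hsol hsub, ae_restrict_mem measurableSet_Icc,
      ae_restrict_of_ae_restrict_of_subset hsub' (h y hy hyd).2] with z h1 h2 h3
    refine ⟨_, h1, (hF _ _).trans ?_⟩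
    gcongr
    exact (h z (hsub h2) (h2.2.trans hyd)).1
  · have : 0 ≤ y - x := by linarith
    gcongr
    exact Real.le_coe_toNNReal _

/-- Solutions of the flow equation without input. -/
theorem exists_flow (hψ : IsLip P.ψ) (L : Matrix (Fin nz) (Fin ny) ℝ)
    (H : Matrix (Fin ny) (Fin ny) ℝ) (x₀ : ErrState nz ny) :
    ∃ α : ℝ → ErrState nz ny, α 0 = x₀ ∧ (∀ s, 0 ≤ s →
      HasDerivWithinAt α (P.errFlow L H (α s) 0) (Ici 0) s) ∧
      ∀ s, 0 ≤ s → (α s).τ = x₀.τ - s := by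
  obtain ⟨K, hK⟩ := isLip_errFlow (nw := nw) L H hψ
  have hK' : LipschitzWith K fun x => P.errFlow L H x 0 := by
    refine LipschitzWith.of_dist_le_mul fun x y => ?_
    have := hK.dist_le_mul (x, 0) (y, 0)
    simpa using this
  have : CompleteSpace (ErrState nz ny) := FiniteDimensional.complete ℝ _
  obtain ⟨α, h0, hα⟩ := exists_hasDerivWithinAt_Ici_of_lipschitz
    (f := fun _ x => P.errFlow L H x 0) (fun _ => hK') (fun _ => continuous_const) x₀
  refine ⟨α, h0, hα, fun s hs => ?_⟩
  have hd : ∀ r, 0 ≤ r → HasDerivWithinAt (fun r => (α r).τ + r) 0 (Ici 0) r := fun r hr => by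
    have := (ErrState.τL.hasFDerivAt.comp_hasDerivWithinAt r (hα r hr)).add
      (hasDerivWithinAt_id r (Ici 0))
    simpa [errFlow, Function.comp_def, Pi.add_def] using! this
  have h1 := constant_of_has_deriv_right_zero (f := fun r => (α r).τ + r) (a := 0) (b := s)
    (fun r hr => (hd r hr.1).continuousWithinAt.mono Icc_subset_Ici_self)
    (fun r hr => (hd r hr.1).mono (Ici_subset_Ici.2 hr.1)) s ⟨hs, le_rfl⟩
  simp only [h0, add_zero] at h1
  linarith

end Plant

/-! ### Lipschitz curves and their limits at an end point -/

theorem lipschitzOnWith_of_norm_sub_le {E : Type*} [SeminormedAddCommGroup E] {f : ℝ → E}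
    {s : Set ℝ} {M : ℝ≥0} (h : ∀ x ∈ s, ∀ y ∈ s, x ≤ y → ‖f y - f x‖ ≤ M * (y - x)) :
    LipschitzOnWith M f s := by
  refine LipschitzOnWith.of_dist_le_mul fun x hx y hy => ?_
  rcases le_total x y with hxy | hxy
  · rw [dist_comm, dist_eq_norm, dist_comm, Real.dist_eq, abs_of_nonneg (by linarith)]
    exact h x hx y hy hxy
  · rw [dist_eq_norm, Real.dist_eq, abs_of_nonneg (by linarith)]
    exact h y hy x hx hxy

/-- A Lipschitz curve has a limit at the right end of its interval of definition. -/
theorem exists_lipschitz_limit {E : Type*} [NormedAddCommGroup E] [CompleteSpace E] {f : ℝ → E}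
    {a b : ℝ} {M : ℝ≥0} (hab : a < b)
    (h : ∀ x ∈ Ico a b, ∀ y ∈ Ico a b, x ≤ y → ‖f y - f x‖ ≤ M * (y - x)) :
    ∃ l, ∀ x ∈ Ico a b, ‖l - f x‖ ≤ M * (b - x) := by
  have hc : Cauchy (map f (𝓝[<] b)) := by
    have hu := (lipschitzOnWith_of_norm_sub_le h).uniformContinuousOn
    have hcb : Cauchy (𝓝[<] b) := cauchy_nhds.mono nhdsWithin_le_nhds
    refine hcb.map_of_le hu ?_
    rw [le_principal_iff]
    exact Ico_mem_nhdsLT hab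
  obtain ⟨l, hl⟩ := CompleteSpace.complete hc
  refine ⟨l, fun x hx => ?_⟩
  have h1 : Tendsto (fun y => ‖f y - f x‖) (𝓝[<] b) (𝓝 ‖l - f x‖) :=
    ((show Tendsto f (𝓝[<] b) (𝓝 l) from hl).sub_const _).norm
  refine le_of_tendsto h1 ?_
  filter_upwards [Ioo_mem_nhdsLT hx.2] with y hy
  refine (h x hx y ⟨hx.1.trans hy.1.le, hy.2⟩ hy.1.le).trans ?_
  gcongr
  exact hy.2.le

namespace HybridSystem

variable {X W Y : Type*} [NormedAddCommGroup X] [NormedSpace ℝ X]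
  [NormedAddCommGroup W] [NormedAddCommGroup Y]

/-- `(φ, u)` is a proper restriction of another solution pair. -/
def IsExtendable (S : HybridSystem X W Y) (E : Set (ℝ × ℕ)) (φ : ℝ → ℕ → X)
    (u : ℝ → ℕ → WithLp 2 (W × Y)) : Prop :=
  ∃ E' φ' u', S.IsSolutionPair E' φ' u' ∧ E ⊆ E' ∧
    (∀ t j, (t, j) ∈ E → φ' t j = φ t j ∧ u' t j = u t j) ∧ E' ≠ E

theorem IsMaximalPair.not_isExtendable {S : HybridSystem X W Y} {E : Set (ℝ × ℕ)}
    {φ : ℝ → ℕ → X} {u : ℝ → ℕ → WithLp 2 (W × Y)} (h : S.IsMaximalPair E φ u) :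
    ¬ S.IsExtendable E φ u :=
  fun ⟨E', φ', u', hsol, hsub, hag, hne⟩ => hne (h.2 E' φ' u' hsol hsub hag)

end HybridSystem

namespace Plant

variable {nz nw ny ns nq np : ℕ} {P : Plant nz nw ny ns nq np} {L : Matrix (Fin nz) (Fin ny) ℝ}
  {H : Matrix (Fin ny) (Fin ny) ℝ} {T₁ T₂ : ℝ}
  {φ : ℝ → ℕ → ErrState nz ny} {u : ℝ → ℕ → WithLp 2 (Eu nw × Eu ny)}
  {t : ℕ → ℝ} {J : ℕ}

/-- On a bounded slice the solution is Lipschitz, so it has a limit at the missing end point. Adding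
that one point creates no jump and changes the flow condition only on a null set. -/
theorem isExtendable_of_Ico (hψ : IsLip P.ψ) (h0 : t 0 = 0) (hm : Monotone t)
    (hlt : t J < t (J + 1)) (hsol : (P.errSystem L H T₁ T₂).IsSolutionPair
      (finiteDomain t J (Ico (t J) (t (J + 1)))) φ u) :
    (P.errSystem L H T₁ T₂).IsExtendable (finiteDomain t J (Ico (t J) (t (J + 1)))) φ u := by
  classical
  set I := Ico (t J) (t (J + 1)) with hI
  set I' := Icc (t J) (t (J + 1)) with hI'
  set E := finiteDomain t J I with hE
  set E' := finiteDomain t J I' with hE'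
  have ht : IsSliceSeq E t := isSliceSeq_finiteDomain h0 hm (Or.inr (Or.inl ⟨hlt, rfl⟩))
  have ht' : IsSliceSeq E' t := isSliceSeq_finiteDomain h0 hm (Or.inl rfl)
  have hsJ : slice E J = I := slice_finiteDomain_self ..
  have hsJ' : slice E' J = I' := slice_finiteDomain_self ..
  have hsl : ∀ j, j ≠ J → slice E' j = slice E j := fun j hj => by
    rcases lt_or_gt_of_ne hj with h | h
    · rw [hE, hE', slice_finiteDomain_of_lt h, slice_finiteDomain_of_lt h]
    · rw [hE, hE', slice_finiteDomain_of_gt h, slice_finiteDomain_of_gt h]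
  have hsub : E ⊆ E' := fun p hp => hp.imp id (And.imp id fun h => Ico_subset_Icc_self h)
  have hd : (t (J + 1), J) ∉ E := fun h => by
    have h' : t (J + 1) ∈ slice E J := h
    rw [hsJ] at h'
    exact lt_irrefl _ h'.2
  have hd' : (t (J + 1), J) ∈ E' := by
    change t (J + 1) ∈ slice E' J
    rw [hsJ']
    exact ⟨hlt.le, le_rfl⟩
  obtain ⟨M, hM⟩ := exists_lipschitzOnWith_slice hψ hsol ht J (t (J + 1))
  rw [hsJ] at hM
  have : CompleteSpace (ErrState nz ny) := FiniteDimensional.complete ℝ _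
  obtain ⟨l, hl⟩ := exists_lipschitz_limit (f := fun s => φ s J) hlt
    fun x hx y hy hxy => hM x y hx hy hxy hy.2.le
  set φ' : ℝ → ℕ → ErrState nz ny := fun s j => if (s, j) ∈ E then φ s j else l with hφ'
  have hag : ∀ s j, (s, j) ∈ E → φ' s j = φ s j := fun s j h => if_pos h
  have hφd : φ' (t (J + 1)) J = l := if_neg hd
  have hφI : ∀ s ∈ I, φ' s J = φ s J := fun s hs => hag s J (by rw [← hsJ] at hs; exact hs)
  have hsol' := hsol.extend (E' := E') (φ' := φ') ⟨t, h0, hm, Or.inr ⟨J, I', Or.inl rfl, rfl⟩⟩ hag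
    ?_ ?_ ?_ ?_
  · exact ⟨E', φ', _, hsol', hsub, fun s j hs => ⟨hag s j hs, if_pos hs⟩,
      fun h => hd (h ▸ hd')⟩
  · intro j hj a b hab hs
    obtain rfl : j = J := by_contra fun h => hj (hsl j h)
    rw [hsJ'] at hs
    have hlip : LipschitzOnWith M (fun s => φ' s j) I' := by
      refine lipschitzOnWith_of_norm_sub_le fun x hx y hy hxy => ?_
      rcases hy.2.lt_or_eq with hy2 | rfl
      · rw [hφI x ⟨hx.1, hxy.trans_lt hy2⟩, hφI y ⟨hy.1, hy2⟩]
        exact hM x y ⟨hx.1, hxy.trans_lt hy2⟩ ⟨hy.1, hy2⟩ hxy hy2.le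
      · rcases hx.2.lt_or_eq with hx2 | rfl
        · rw [hφd, hφI x ⟨hx.1, hx2⟩]
          exact hl x ⟨hx.1, hx2⟩
        · simp
    refine (hlip.mono ?_).absolutelyContinuousOnInterval
    rwa [uIcc_of_le hab]
  · intro j hj s hs
    obtain rfl : j = J := by_contra fun h => hj (hsl j h)
    rw [hsJ', hI', interior_Icc] at hs
    rw [hφI s ⟨hs.1.le, hs.2⟩]
    refine hsol.flow_mem j s ?_
    rwa [hsJ, hI, interior_Ico]
  · intro j hj
    obtain rfl : j = J := by_contra fun h => hj (hsl j h)
    have h1 := hsol.flow j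
    rw [hsJ, restrict_Ico_eq_restrict_Icc, ← restrict_Ioo_eq_restrict_Icc] at h1
    rw [hsJ', ← restrict_Ioo_eq_restrict_Icc]
    filter_upwards [h1, ae_restrict_mem measurableSet_Ioo] with s hs hmem
    have hsI : s ∈ I := ⟨hmem.1.le, hmem.2⟩
    have hsE : (s, j) ∈ E := by rw [← hsJ] at hsI; exact hsI
    rw [if_pos hsE, hφI s hsI]
    refine hs.congr_of_eventuallyEq ?_
    filter_upwards [isOpen_Ioo.mem_nhds hmem] with r hr
    exact hφI r ⟨hr.1.le, hr.2⟩
  · intro s j hj hj'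
    exact (hj' ((ht.mem_jumpTimes_finiteDomain ⟨t J, le_rfl, hlt⟩).2
      ((ht'.mem_jumpTimes_finiteDomain ⟨t J, le_rfl, hlt.le⟩).1 hj))).elim

/-- The end point lies in the jump set, so one jump can be appended, followed by a slice reduced to
a single time. The flow conditions there are void. -/
theorem isExtendable_of_timer_zero (hT : T₁ ≤ T₂) (h0 : t 0 = 0)
    (hm : Monotone t) (hsol : (P.errSystem L H T₁ T₂).IsSolutionPair
      (finiteDomain t J (Icc (t J) (t (J + 1)))) φ u) (hτ : (φ (t (J + 1)) J).τ = 0) :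
    (P.errSystem L H T₁ T₂).IsExtendable (finiteDomain t J (Icc (t J) (t (J + 1)))) φ u := by
  classical
  have hle : t J ≤ t (J + 1) := hm J.le_succ
  set d := t (J + 1) with hd
  set I := Icc (t J) d with hI
  set E := finiteDomain t J I with hE
  -- Freezing the sequence after `J + 1` makes the new slice the singleton `{d}`, whatever `t (J +
  -- 2)` was.
  set t' : ℕ → ℝ := fun k => t (min k (J + 1)) with ht'def
  have hm' : Monotone t' := fun a b hab => hm (min_le_min_right _ hab)
  have h0' : t' 0 = 0 := by simpa [ht'def] using h0
  have htt : ∀ k, k ≤ J + 1 → t' k = t k := fun k hk => by simp [ht'def, hk]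
  have ht2 : t' (J + 1 + 1) = d := by simp [ht'def, hd]
  set I' := Icc (t' (J + 1)) (t' (J + 1 + 1)) with hI'
  have hI'd : I' = {d} := by rw [hI', ht2, htt _ le_rfl, Icc_self]
  set E' := finiteDomain t' (J + 1) I' with hE'
  have ht : IsSliceSeq E t := isSliceSeq_finiteDomain h0 hm (Or.inl rfl)
  have ht' : IsSliceSeq E' t' := isSliceSeq_finiteDomain h0' hm' (Or.inl rfl)
  have hsJ : slice E J = I := slice_finiteDomain_self ..
  have hsJ' : slice E' (J + 1) = {d} := by rw [hE', slice_finiteDomain_self, hI'd]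
  have hsl : ∀ j, j ≠ J + 1 → slice E' j = slice E j := fun j hj => by
    rcases lt_trichotomy j J with h | rfl | h
    · rw [hE, hE', slice_finiteDomain_of_lt h, slice_finiteDomain_of_lt (by omega),
        htt _ (by omega), htt _ (by omega)]
    · rw [hsJ, hE', slice_finiteDomain_of_lt (by omega), htt _ (by omega), htt _ (by omega)]
    · rw [hE, hE', slice_finiteDomain_of_gt h, slice_finiteDomain_of_gt (by omega)]
  have hnone : slice E (J + 1) = ∅ := slice_finiteDomain_of_gt (Nat.lt_succ_self J)
  have hsub : E ⊆ E' := by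
    rintro ⟨s, j⟩ hp
    have hp' : s ∈ slice E j := hp
    have hj : j ≠ J + 1 := by
      rintro rfl
      rw [hnone] at hp'
      exact hp'
    rw [← hsl j hj] at hp'
    exact hp'
  have hdE : (d, J) ∈ E := by
    change d ∈ slice E J
    rw [hsJ]
    exact ⟨hle, le_rfl⟩
  have hdn : (d, J + 1) ∉ E := fun h => by
    have h' : d ∈ slice E (J + 1) := h
    rw [hnone] at h'
    exact h'
  have hd' : (d, J + 1) ∈ E' := by
    change d ∈ slice E' (J + 1)
    rw [hsJ']
    exact mem_singleton d
  -- Any timer value in `[T₁, T₂]` would do after the jump.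
  set l : ErrState nz ny := ErrState.mk (φ d J).z (φ d J).ε (-(u d J).snd) T₁ with hl
  set φ' : ℝ → ℕ → ErrState nz ny := fun s j => if (s, j) ∈ E then φ s j else l with hφ'
  have hag : ∀ s j, (s, j) ∈ E → φ' s j = φ s j := fun s j h => if_pos h
  have hφd : φ' d (J + 1) = l := if_neg hdn
  have hsol' := hsol.extend (E' := E') (φ' := φ')
    ⟨t', h0', hm', Or.inr ⟨J + 1, I', Or.inl rfl, rfl⟩⟩ hag ?_ ?_ ?_ ?_
  · exact ⟨E', φ', _, hsol', hsub, fun s j hs => ⟨hag s j hs, if_pos hs⟩,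
      fun h => hdn (h ▸ hd')⟩
  · intro j hj a b hab hs
    obtain rfl : j = J + 1 := by_contra fun h => hj (hsl j h)
    rw [hsJ'] at hs
    have ha : a = d := hs ⟨le_rfl, hab⟩
    have hb : b = d := hs ⟨hab, le_rfl⟩
    rw [ha, hb]
    have : LipschitzOnWith 0 (fun s => φ' s (J + 1)) (uIcc d d) := by
      rw [uIcc_self]
      exact LipschitzOnWith.of_dist_le_mul fun x hx y hy => by
        rw [mem_singleton_iff.1 hx, mem_singleton_iff.1 hy]; simp
    exact this.absolutelyContinuousOnInterval
  · intro j hj s hs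
    obtain rfl : j = J + 1 := by_contra fun h => hj (hsl j h)
    rw [hsJ', interior_singleton] at hs
    exact hs.elim
  · intro j hj
    obtain rfl : j = J + 1 := by_contra fun h => hj (hsl j h)
    rw [hsJ', Measure.restrict_singleton]
    simp
  · intro s j hj hj'
    have h1 := (ht'.mem_jumpTimes_finiteDomain ⟨d, by rw [hI'd]; exact mem_singleton d⟩).1 hj
    have h2 := mt (ht.mem_jumpTimes_finiteDomain ⟨d, hle, le_rfl⟩).2 hj'
    rw [htt _ (by omega)] at h1
    obtain rfl : j = J := by
      by_contra h
      exact h2 ⟨by omega, h1.2⟩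
    obtain rfl : s = d := h1.2
    refine ⟨hdE, hτ, ?_⟩
    rw [hφd]
    exact ⟨T₁, ⟨le_rfl, hT⟩, rfl⟩

/-- The solution flows on with zero input for exactly the time `δ` left on the timer, so it stays in
the flow set. -/
theorem isExtendable_of_timer_pos (hψ : IsLip P.ψ) (hT₁ : 0 < T₁) (hT : T₁ ≤ T₂) (h0 : t 0 = 0)
    (hm : Monotone t) (hsol : (P.errSystem L H T₁ T₂).IsSolutionPair
      (finiteDomain t J (Icc (t J) (t (J + 1)))) φ u) (hτ : 0 < (φ (t (J + 1)) J).τ) :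
    (P.errSystem L H T₁ T₂).IsExtendable (finiteDomain t J (Icc (t J) (t (J + 1)))) φ u := by
  classical
  have hle : t J ≤ t (J + 1) := hm J.le_succ
  set c := t J with hc
  set d := t (J + 1) with hd
  set δ := (φ d J).τ with hδ
  set I := Icc c d with hI
  set E := finiteDomain t J I with hE
  set t' : ℕ → ℝ := fun k => if k ≤ J then t k else t k + δ with ht'def
  have htt : ∀ k, k ≤ J → t' k = t k := fun k hk => if_pos hk
  have ht2 : t' (J + 1) = d + δ := if_neg (by omega)
  have hm' : Monotone t' := fun a b hab => by
    have := hm hab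
    simp only [ht'def]
    split_ifs <;> first | omega | linarith
  have h0' : t' 0 = 0 := by rw [htt 0 (Nat.zero_le _), h0]
  set I' := Icc (t' J) (t' (J + 1)) with hI'
  have hI'd : I' = Icc c (d + δ) := by rw [hI', ht2, htt _ le_rfl]
  set E' := finiteDomain t' J I' with hE'
  have ht : IsSliceSeq E t := isSliceSeq_finiteDomain h0 hm (Or.inl rfl)
  have ht' : IsSliceSeq E' t' := isSliceSeq_finiteDomain h0' hm' (Or.inl rfl)
  have hsJ : slice E J = I := slice_finiteDomain_self ..
  have hsJ' : slice E' J = Icc c (d + δ) := by rw [hE', slice_finiteDomain_self, hI'd]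
  have hsl : ∀ j, j ≠ J → slice E' j = slice E j := fun j hj => by
    rcases lt_or_gt_of_ne hj with h | h
    · rw [hE, hE', slice_finiteDomain_of_lt h, slice_finiteDomain_of_lt h, htt _ h.le, htt _ h]
    · rw [hE, hE', slice_finiteDomain_of_gt h, slice_finiteDomain_of_gt h]
  have hsub : E ⊆ E' := by
    rintro ⟨s, j⟩ hp
    have hp' : s ∈ slice E j := hp
    change s ∈ slice E' j
    by_cases hj : j = J
    · subst hj
      rw [hsJ] at hp'
      rw [hsJ']
      exact ⟨hp'.1, hp'.2.trans (by linarith)⟩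
    · rwa [hsl j hj]
  have memE : ∀ s, (s, J) ∈ E ↔ s ∈ I := fun s => by
    rw [← hsJ]; rfl
  have hdn : (d + δ, J) ∉ E := fun h => by
    have := ((memE _).1 h).2
    linarith
  have hd' : (d + δ, J) ∈ E' := by
    change d + δ ∈ slice E' J
    rw [hsJ']
    exact ⟨by linarith, le_rfl⟩
  obtain ⟨α, hα0, hα, hατ⟩ := exists_flow (nw := nw) hψ L H (φ d J)
  set φ' : ℝ → ℕ → ErrState nz ny := fun s j => if (s, j) ∈ E then φ s j else α (s - d) with hφ'
  have hag : ∀ s j, (s, j) ∈ E → φ' s j = φ s j := fun s j h => if_pos h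
  have hφI : ∀ s ∈ I, φ' s J = φ s J := fun s hs => hag s J ((memE s).2 hs)
  have hφα : ∀ s, d ≤ s → φ' s J = α (s - d) := fun s hs => by
    rcases hs.eq_or_lt with rfl | hs
    · rw [hφI _ ⟨hle, le_rfl⟩, sub_self, hα0]
    · exact if_neg fun h => hs.not_ge ((memE s).1 h).2
  obtain ⟨M, hM⟩ := exists_lipschitzOnWith_slice hψ hsol ht J d
  rw [hsJ] at hM
  have hαc : ContinuousOn α (Icc 0 δ) := fun s hs =>
    (hα s hs.1).continuousWithinAt.mono Icc_subset_Ici_self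
  obtain ⟨K, hK⟩ := exists_norm_errFlow_le (nw := nw) L H hψ
  obtain ⟨R, hR⟩ := isCompact_Icc.exists_bound_of_continuousOn hαc
  have hαlip : ∀ x ∈ Icc 0 δ, ∀ y ∈ Icc 0 δ, ‖α y - α x‖ ≤ K * (R + 0 + 1) * ‖y - x‖ :=
    fun x hx y hy => (convex_Icc 0 δ).norm_image_sub_le_of_norm_hasDerivWithin_le
      (fun s hs => (hα s hs.1).mono Icc_subset_Ici_self)
      (fun s hs => (hK.2 _ _).trans (by
        rw [norm_zero]
        have := hR s hs
        have := hK.1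
        gcongr)) hx hy
  set M' : ℝ≥0 := max M (K * (R + 0 + 1)).toNNReal with hM'
  have hMM' : (M : ℝ) ≤ M' := NNReal.coe_le_coe.2 (le_max_left _ _)
  have hKM' : K * (R + 0 + 1) ≤ M' :=
    (Real.le_coe_toNNReal _).trans (NNReal.coe_le_coe.2 (le_max_right _ _))
  have hl : ∀ x ∈ I, ∀ y ∈ I, x ≤ y → ‖φ' y J - φ' x J‖ ≤ M' * (y - x) :=
    fun x hx y hy hxy => by
      rw [hφI x hx, hφI y hy]
      refine (hM x y hx hy hxy hy.2).trans ?_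
      have : 0 ≤ y - x := by linarith
      gcongr
  have hr : ∀ x ∈ Icc d (d + δ), ∀ y ∈ Icc d (d + δ), x ≤ y →
      ‖φ' y J - φ' x J‖ ≤ M' * (y - x) := fun x hx y hy hxy => by
    rw [hφα x hx.1, hφα y hy.1]
    refine (hαlip (x - d) ⟨by linarith [hx.1], by linarith [hx.2]⟩ (y - d)
      ⟨by linarith [hy.1], by linarith [hy.2]⟩).trans ?_
    have h1 : y - d - (x - d) = y - x := by ring
    have h2 : 0 ≤ y - x := by linarith
    rw [h1, Real.norm_of_nonneg h2]
    gcongr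
  -- The old and the new curve share their value at `d`, so a common Lipschitz constant survives the
  -- gluing.
  have hlip : LipschitzOnWith M' (fun s => φ' s J) (Icc c (d + δ)) := by
    refine lipschitzOnWith_of_norm_sub_le fun x hx y hy hxy => ?_
    rcases le_total y d with h1 | h1
    · exact hl x ⟨hx.1, hxy.trans h1⟩ y ⟨hy.1, h1⟩ hxy
    rcases le_total d x with h2 | h2
    · exact hr x ⟨h2, hx.2⟩ y ⟨h1, hy.2⟩ hxy
    have h3 := hl x ⟨hx.1, h2⟩ d ⟨hle, le_rfl⟩ h2
    have h4 := hr d ⟨le_rfl, by linarith⟩ y ⟨h1, hy.2⟩ h1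
    have h5 := norm_sub_le_norm_sub_add_norm_sub (φ' y J) (φ' d J) (φ' x J)
    linarith
  have hsol' := hsol.extend (E' := E') (φ' := φ')
    ⟨t', h0', hm', Or.inr ⟨J, I', Or.inl rfl, rfl⟩⟩ hag ?_ ?_ ?_ ?_
  · exact ⟨E', φ', _, hsol', hsub, fun s j hs => ⟨hag s j hs, if_pos hs⟩,
      fun h => hdn (h ▸ hd')⟩
  · intro j hj a b hab hs
    obtain rfl : j = J := by_contra fun h => hj (hsl j h)
    rw [hsJ'] at hs
    refine (hlip.mono ?_).absolutelyContinuousOnInterval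
    rwa [uIcc_of_le hab]
  · intro j hj s hs
    obtain rfl : j = J := by_contra fun h => hj (hsl j h)
    rw [hsJ', interior_Icc] at hs
    rcases le_total s d with h1 | h1
    · have hsI : s ∈ I := ⟨hs.1.le, h1⟩
      rw [hφI s hsI]
      exact timer_mem hsol ht hT₁ hT ((memE s).2 hsI)
    · rw [hφα s h1]
      have h2 := hατ (s - d) (by linarith)
      have h3 := timer_mem hsol ht hT₁ hT ((memE d).2 ⟨hle, le_rfl⟩)
      change (α (s - d)).τ ∈ Icc 0 T₂
      rw [h2]
      exact ⟨by linarith [hs.2], by linarith [h3.2]⟩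
  · intro j hj
    obtain rfl : j = J := by_contra fun h => hj (hsl j h)
    have h1 := hsol.flow j
    rw [hsJ, ae_restrict_iff' measurableSet_Icc] at h1
    rw [hsJ', ← restrict_Ioo_eq_restrict_Icc, ae_restrict_iff' measurableSet_Ioo]
    filter_upwards [h1, Measure.ae_ne volume d] with s hs hsd hmem
    rcases lt_or_gt_of_ne hsd with h2 | h2
    · have hsI : s ∈ I := ⟨hmem.1.le, h2.le⟩
      rw [if_pos ((memE s).2 hsI), hφI s hsI]
      refine (hs hsI).congr_of_eventuallyEq ?_
      filter_upwards [isOpen_Ioo.mem_nhds ⟨hmem.1, h2⟩] with r hr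
      exact hφI r ⟨hr.1.le, hr.2.le⟩
    · rw [if_neg fun h => h2.not_ge ((memE s).1 h).2, hφα s h2.le]
      have h3 : HasDerivAt α (P.errFlow L H (α (s - d)) 0) (s - d) :=
        (hα (s - d) (by linarith)).hasDerivAt (Ici_mem_nhds (by linarith))
      refine (h3.comp_sub_const s d).congr_of_eventuallyEq ?_
      filter_upwards [isOpen_Ioi.mem_nhds h2] with r hr
      exact hφα r (le_of_lt hr)
  · intro s j hj hj'
    have h1 := (ht'.mem_jumpTimes_finiteDomain
      ⟨c, by rw [hI'd]; exact ⟨le_rfl, by linarith⟩⟩).1 hj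
    have h2 := mt (ht.mem_jumpTimes_finiteDomain ⟨d, hle, le_rfl⟩).2 hj'
    rw [htt _ h1.1] at h1
    exact (h2 h1).elim

theorem isCompleteDom_of_isMaximalPair (hψ : IsLip P.ψ) (hT₁ : 0 < T₁) (hT : T₁ ≤ T₂)
    {E : Set (ℝ × ℕ)} (hmax : (P.errSystem L H T₁ T₂).IsMaximalPair E φ u) :
    HybridSystem.IsCompleteDom E := by
  have hext := hmax.not_isExtendable
  have hsol := hmax.1
  obtain ⟨t, h0, hm, h⟩ := hsol.dom
  have hnn : ∀ j, 0 ≤ t j := fun j => h0 ▸ hm j.zero_le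
  intro M
  rcases h with rfl | ⟨J, I, hI, rfl⟩
  -- Infinitely many jumps: the domain is unbounded through the jump counter alone.
  · obtain ⟨j, hj⟩ := exists_nat_gt M
    exact ⟨(t j, j), ⟨le_rfl, hm j.le_succ⟩, by have := hnn j; dsimp only; linarith⟩
  · change (P.errSystem L H T₁ T₂).IsSolutionPair (finiteDomain t J I) φ u at hsol
    change ¬ (P.errSystem L H T₁ T₂).IsExtendable (finiteDomain t J I) φ u at hext
    rcases hI with rfl | ⟨hlt, rfl⟩ | rfl
    · refine (hext ?_).elim
      have ht := isSliceSeq_finiteDomain h0 hm (J := J) (Or.inl rfl)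
      have hmem : (t (J + 1), J) ∈ finiteDomain t J (Icc (t J) (t (J + 1))) :=
        Or.inr ⟨rfl, hm J.le_succ, le_rfl⟩
      rcases (timer_mem hsol ht hT₁ hT hmem).1.eq_or_lt with h | h
      · exact isExtendable_of_timer_zero hT h0 hm hsol h.symm
      · exact isExtendable_of_timer_pos hψ hT₁ hT h0 hm hsol h
    · exact (hext (isExtendable_of_Ico hψ h0 hm hlt hsol)).elim
    · obtain ⟨n, hn⟩ := exists_nat_gt M
      refine ⟨(t J + n, J), Or.inr ⟨rfl, by simp⟩, ?_⟩
      have := hnn J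
      have : (0 : ℝ) ≤ J := J.cast_nonneg
      dsimp only
      linarith

end Plant

/-! ### Trajectories of the interconnection as hybrid solutions -/

/-- The mean value inequality on the open interval passes to the closure by continuity. No
derivative is needed at the end points, where resets occur. -/
theorem lipschitzOnWith_Icc_of_hasDerivAt {E : Type*} [NormedAddCommGroup E] [NormedSpace ℝ E]
    {f f' : ℝ → E} {a b M : ℝ} (hf : ContinuousOn f (Icc a b))
    (hd : ∀ s ∈ Ioo a b, HasDerivAt f (f' s) s) (hM : ∀ s ∈ Ioo a b, ‖f' s‖ ≤ M) :
    LipschitzOnWith M.toNNReal f (Icc a b) := by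
  rcases lt_or_ge a b with hab | hab
  · rw [← closure_Ioo hab.ne] at hf ⊢
    refine LipschitzOnWith.closure hf (LipschitzOnWith.of_dist_le_mul fun x hx y hy => ?_)
    rw [dist_eq_norm, dist_eq_norm]
    refine ((convex_Ioo a b).norm_image_sub_le_of_norm_hasDerivWithin_le
      (fun s hs => (hd s hs).hasDerivWithinAt) hM hy hx).trans ?_
    gcongr
    exact Real.le_coe_toNNReal _
  · refine LipschitzOnWith.of_dist_le_mul fun x hx y hy => ?_
    have h1 : x = y := le_antisymm (hx.2.trans (hab.trans hy.1)) (hy.2.trans (hab.trans hx.1))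
    simp [h1]

section MulE

variable {m n k : ℕ}

theorem mulE_add_matrix (M N : Matrix (Fin m) (Fin n) ℝ) (v : Eu n) :
    mulE (M + N) v = mulE M v + mulE N v := by
  simp [mulE]

theorem mulE_sub_matrix (M N : Matrix (Fin m) (Fin n) ℝ) (v : Eu n) :
    mulE (M - N) v = mulE M v - mulE N v := by
  simp [mulE]

theorem mulE_add (M : Matrix (Fin m) (Fin n) ℝ) (v w : Eu n) :
    mulE M (v + w) = mulE M v + mulE M w :=
  map_add _ _ _

theorem mulE_sub (M : Matrix (Fin m) (Fin n) ℝ) (v w : Eu n) :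
    mulE M (v - w) = mulE M v - mulE M w :=
  map_sub _ _ _

theorem mulE_mul (M : Matrix (Fin m) (Fin n) ℝ) (N : Matrix (Fin n) (Fin k) ℝ) (v : Eu k) :
    mulE (M * N) v = mulE M (mulE N v) := by
  simp [mulE, Matrix.toLpLin_apply, Matrix.mulVec_mulVec]

end MulE

/-- The state is a sum of four linear images, one for each coordinate, and linear maps are
Lipschitz. -/
theorem ErrState.absolutelyContinuousOnInterval_mk {nz ny : ℕ} {z ε : ℝ → Eu nz} {θ : ℝ → Eu ny}
    {τ : ℝ → ℝ} {a b : ℝ} (hz : AbsolutelyContinuousOnInterval z a b)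
    (hε : AbsolutelyContinuousOnInterval ε a b) (hθ : AbsolutelyContinuousOnInterval θ a b)
    (hτ : AbsolutelyContinuousOnInterval τ a b) :
    AbsolutelyContinuousOnInterval (fun s => mk (z s) (ε s) (θ s) (τ s)) a b := by
  have h₁ := (mkL.comp (.inl ℝ (Eu nz) (Eu nz × Eu ny × ℝ))).lipschitz
    |>.comp_absolutelyContinuousOnInterval hz
  have h₂ := (mkL.comp ((ContinuousLinearMap.inr ℝ (Eu nz) (Eu nz × Eu ny × ℝ)).comp
    (.inl ℝ (Eu nz) (Eu ny × ℝ)))).lipschitz.comp_absolutelyContinuousOnInterval hε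
  have h₃ := (mkL.comp ((ContinuousLinearMap.inr ℝ (Eu nz) (Eu nz × Eu ny × ℝ)).comp
    ((ContinuousLinearMap.inr ℝ (Eu nz) (Eu ny × ℝ)).comp
      (.inl ℝ (Eu ny) ℝ)))).lipschitz.comp_absolutelyContinuousOnInterval hθ
  have h₄ := (mkL.comp ((ContinuousLinearMap.inr ℝ (Eu nz) (Eu nz × Eu ny × ℝ)).comp
    ((ContinuousLinearMap.inr ℝ (Eu nz) (Eu ny × ℝ)).comp
      (.inr ℝ (Eu ny) ℝ)))).lipschitz.comp_absolutelyContinuousOnInterval hτ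
  refine (((h₁.fun_add h₂).fun_add h₃).fun_add h₄).congr fun s _ => ?_
  simp only [ContinuousLinearMap.comp_apply, ← map_add]
  simp

namespace Plant

variable {nz nw ny ns nq np : ℕ}

/-- The times at which the slices of the hybrid solution of a trajectory start. -/
def switchTime (t : ℕ → ℝ) : ℕ → ℝ
  | 0 => 0
  | k + 1 => t k

/-- The hybrid time domain with jumps at the sampling times. -/
def samplingDomain (t : ℕ → ℝ) : Set (ℝ × ℕ) :=
  {p | p.1 ∈ Icc (switchTime t p.2) (switchTime t (p.2 + 1))}

theorem slice_samplingDomain (t : ℕ → ℝ) (j : ℕ) :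
    slice (samplingDomain t) j = Icc (switchTime t j) (switchTime t (j + 1)) := rfl

/-- The injected signal `θ` on the `j`-th slice, with the value after the reset at the left end
point. -/
noncomputable def injection (P : Plant nz nw ny ns nq np) (t : ℕ → ℝ) (η : ℝ → Eu ny)
    (z zh : ℝ → Eu nz) (θ : ℝ → Eu ny) (s : ℝ) : ℕ → Eu ny
  | 0 => θ s
  | k + 1 => if s ≤ t k then mulE P.C (z (t k)) + η (t k) - mulE P.C (zh (t k)) else θ s

/-- The hybrid arc of a trajectory. -/
noncomputable def trajectoryArc (P : Plant nz nw ny ns nq np) (t : ℕ → ℝ) (η : ℝ → Eu ny)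
    (z zh : ℝ → Eu nz) (θ : ℝ → Eu ny) (s : ℝ) (j : ℕ) : ErrState nz ny :=
  ErrState.mk (z s) (z s - zh s) (mulE P.C (z s - zh s) - P.injection t η z zh θ s j)
    (switchTime t (j + 1) - s)

/-- The hybrid input of a trajectory; `η` only matters at jumps. -/
noncomputable def trajectoryInput (t : ℕ → ℝ) (w : ℝ → Eu nw) (η : ℝ → Eu ny) (s : ℝ) (j : ℕ) :
    WithLp 2 (Eu nw × Eu ny) :=
  WithLp.toLp 2 (w s, if s = t j then η s else 0)

section

variable {P : Plant nz nw ny ns nq np} {L : Matrix (Fin nz) (Fin ny) ℝ}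
  {H : Matrix (Fin ny) (Fin ny) ℝ} {T₁ T₂ : ℝ} {t : ℕ → ℝ} {w : ℝ → Eu nw} {η : ℝ → Eu ny}
  {z zh : ℝ → Eu nz} {θ : ℝ → Eu ny}

namespace IsSamplingSeq

theorem strictMono (ht : IsSamplingSeq T₁ T₂ t) (hT₁ : 0 < T₁) : StrictMono t :=
  strictMono_nat_of_lt_succ fun k => by linarith [(ht.2.2 k).1]

theorem nonneg (ht : IsSamplingSeq T₁ T₂ t) (hT₁ : 0 < T₁) (k : ℕ) : 0 ≤ t k :=
  ht.1.trans ((ht.strictMono hT₁).monotone k.zero_le)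

theorem exists_le (ht : IsSamplingSeq T₁ T₂ t) (hT₁ : 0 < T₁) (s : ℝ) : ∃ k, s ≤ t k := by
  have h : ∀ k : ℕ, k * T₁ ≤ t k := fun k => by
    induction k with
    | zero => simpa using ht.1
    | succ k ih => push_cast; linarith [(ht.2.2 k).1]
  obtain ⟨k, hk⟩ := exists_nat_ge (s / T₁)
  rw [div_le_iff₀ hT₁] at hk
  exact ⟨k, hk.trans (h k)⟩

theorem switchTime_succ_le (ht : IsSamplingSeq T₁ T₂ t) (j : ℕ) :
    switchTime t (j + 1) - switchTime t j ≤ T₂ := by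
  cases j with
  | zero => simpa [switchTime] using ht.2.1
  | succ j => exact (ht.2.2 j).2

theorem switchTime_mono (ht : IsSamplingSeq T₁ T₂ t) (hT₁ : 0 < T₁) :
    Monotone (switchTime t) :=
  monotone_nat_of_le_succ fun k => by
    cases k with
    | zero => exact ht.1
    | succ k => exact (ht.strictMono hT₁).monotone k.le_succ

theorem switchTime_nonneg (ht : IsSamplingSeq T₁ T₂ t) (hT₁ : 0 < T₁) (j : ℕ) :
    0 ≤ switchTime t j :=
  ht.switchTime_mono hT₁ j.zero_le

theorem notMem_range (ht : IsSamplingSeq T₁ T₂ t) (hT₁ : 0 < T₁) {j : ℕ} {s : ℝ}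
    (hs : s ∈ Ioo (switchTime t j) (switchTime t (j + 1))) : s ∉ range t := by
  rintro ⟨k, rfl⟩
  have h2 : k < j := (ht.strictMono hT₁).lt_iff_lt.1 hs.2
  obtain ⟨i, rfl⟩ := Nat.exists_eq_succ_of_ne_zero (Nat.ne_zero_of_lt h2)
  have h1 : i < k := (ht.strictMono hT₁).lt_iff_lt.1 hs.1
  omega

theorem isSliceSeq (ht : IsSamplingSeq T₁ T₂ t) (hT₁ : 0 < T₁) :
    IsSliceSeq (samplingDomain t) (switchTime t) :=
  ⟨rfl, ht.switchTime_mono hT₁, ⟨0, le_rfl, ht.1⟩, fun _ => Or.inr (Or.inl rfl), fun _ _ => rfl⟩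

theorem domT_samplingDomain (ht : IsSamplingSeq T₁ T₂ t) (hT₁ : 0 < T₁) :
    domT (samplingDomain t) = Ici 0 := by
  ext s
  constructor
  · rintro ⟨j, hj⟩
    exact (ht.switchTime_nonneg hT₁ j).trans hj.1
  · intro hs
    obtain ⟨k, hk⟩ := ht.exists_le hT₁ s
    induction k with
    | zero => exact ⟨0, hs, hk⟩
    | succ k ih =>
      rcases le_total s (t k) with h | h
      · exact ih h
      · exact ⟨k + 1, h, hk⟩

end IsSamplingSeq

/-- At positive times, `θ` is the injected signal on a suitable slice. -/
theorem exists_injection_eq (ht : IsSamplingSeq T₁ T₂ t) (hT₁ : 0 < T₁) {s : ℝ} (hs : 0 ≤ s) :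
    ∃ j, (s, j) ∈ samplingDomain t ∧ P.injection t η z zh θ s j = θ s := by
  obtain ⟨k, hk⟩ := ht.exists_le hT₁ s
  induction k with
  | zero => exact ⟨0, ⟨hs, hk⟩, rfl⟩
  | succ k ih =>
    rcases le_or_gt s (t k) with h | h
    · exact ih h
    · exact ⟨k + 1, ⟨h.le, hk⟩, if_neg h.not_ge⟩

theorem injection_eventuallyEq {j : ℕ} {s : ℝ}
    (hs : s ∈ Ioo (switchTime t j) (switchTime t (j + 1))) :
    (fun r => P.injection t η z zh θ r j) =ᶠ[𝓝 s] θ := by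
  filter_upwards [isOpen_Ioo.mem_nhds hs] with r hr
  cases j with
  | zero => rfl
  | succ j => exact if_neg (not_le.2 hr.1)

/-- `θ` is left continuous at positive samples. Replacing its value at the left end of a slice by
the reset value, which is its limit from the right, removes the only discontinuity. -/
theorem IsTrajectory.continuousOn_injection (hx : P.IsTrajectory L H t w η z zh θ)
    (ht : IsSamplingSeq T₁ T₂ t) (hT₁ : 0 < T₁) (j : ℕ) :
    ContinuousOn (fun s => P.injection t η z zh θ s j)
      (Icc (switchTime t j) (switchTime t (j + 1))) := by
  rcases (ht.switchTime_mono hT₁ j.le_succ).eq_or_lt with heq | hlt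
  · rw [← heq, Icc_self]
    exact continuousOn_singleton _ _
  intro s hs
  have hpos : 0 < switchTime t (j + 1) := (ht.switchTime_nonneg hT₁ j).trans_lt hlt
  rcases hs.1.eq_or_lt with rfl | h1
  · cases j with
    | zero =>
      have h0 : (0 : ℝ) ∉ range t := by
        rintro ⟨k, hk⟩
        have : t 0 ≤ t k := (ht.strictMono hT₁).monotone k.zero_le
        have h' : 0 < t 0 := hpos
        linarith
      exact (hx.inj_zero h0).mono Icc_subset_Ici_self
    | succ j =>
      have h2 : ContinuousWithinAt (fun s => P.injection t η z zh θ s (j + 1)) (Ioi (t j)) (t j) := by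
        have h3 : P.injection t η z zh θ (t j) (j + 1) =
          mulE P.C (z (t j)) + η (t j) - mulE P.C (zh (t j)) := if_pos le_rfl
        have h4 : Tendsto (fun s => P.injection t η z zh θ s (j + 1)) (𝓝[>] t j)
            (𝓝 (P.injection t η z zh θ (t j) (j + 1))) := by
          rw [h3]
          refine (hx.inj_reset j).congr' ?_
          filter_upwards [self_mem_nhdsWithin] with r hr
          exact (if_neg (not_le.2 hr)).symm
        exact h4
      exact (continuousWithinAt_Ioi_iff_Ici.1 h2).mono Icc_subset_Ici_self
  rcases hs.2.lt_or_eq with h2 | rfl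
  · have h3 := (hx.inj_ode s ((ht.switchTime_nonneg hT₁ j).trans_lt h1)
      (ht.notMem_range hT₁ ⟨h1, h2⟩)).continuousAt
    exact (h3.congr_of_eventuallyEq (injection_eventuallyEq ⟨h1, h2⟩)).continuousWithinAt
  · have h3 : ContinuousWithinAt θ (Icc (switchTime t j) (t j)) (t j) :=
      (hx.inj_left j hpos).mono Icc_subset_Iic_self
    have h4 : ∀ r, switchTime t j < r → P.injection t η z zh θ r j = θ r := fun r hr => by
      cases j with
      | zero => rfl
      | succ j => exact if_neg (not_le.2 hr)
    refine h3.congr_of_eventuallyEq ?_ (h4 _ h1)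
    filter_upwards [mem_nhdsWithin_of_mem_nhds (isOpen_Ioi.mem_nhds h1)] with r hr
    exact h4 r hr

/-- The error flow in terms of the velocities of the plant and of the observer. -/
theorem errFlow_mk (P : Plant nz nw ny ns nq np) (L : Matrix (Fin nz) (Fin ny) ℝ)
    (H : Matrix (Fin ny) (Fin ny) ℝ) (z zh : Eu nz) (θ : Eu ny) (τ : ℝ) (w : Eu nw)
    {dz dzh : Eu nz} (hz : dz = mulE P.A z + mulE P.B (P.ψ (mulE P.S z)) + mulE P.N w)
    (hzh : dzh = mulE P.A zh + mulE P.B (P.ψ (mulE P.S zh)) + mulE L θ) :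
    P.errFlow L H (ErrState.mk z (z - zh) (mulE P.C (z - zh) - θ) τ) w =
      ErrState.mk dz (dz - dzh) (mulE P.C (dz - dzh) - mulE H θ) (-1) := by
  subst hz hzh
  simp only [errFlow, ErrState.mk_z, ErrState.mk_ε, ErrState.mk_θ, ζ, sub_sub_cancel,
    mulE_add_matrix, mulE_sub_matrix, mulE_mul, mulE_sub, mulE_add]
  congr 1
  · abel
  · abel

/-- With the time to the next sample as timer, samples become jumps: the timer is zero there, and
its new value is the next sampling interval. -/
theorem IsTrajectory.isSolutionPair (hx : P.IsTrajectory L H t w η z zh θ)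
    (hψ : IsLip P.ψ) (hw : IsLocBddInput w) (ht : IsSamplingSeq T₁ T₂ t) (hT₁ : 0 < T₁) :
    (P.errSystem L H T₁ T₂).IsSolutionPair (samplingDomain t) (P.trajectoryArc t η z zh θ)
      (trajectoryInput t w η) := by
  have hsl := ht.isSliceSeq hT₁
  have hsub : ∀ j, Icc (switchTime t j) (switchTime t (j + 1)) ⊆ Ici 0 := fun j s hs =>
    (ht.switchTime_nonneg hT₁ j).trans hs.1
  -- On each slice `η` enters at a single time, so the input is measurable although `η` is
  -- arbitrary.
  have hu : ∀ j, (fun s => trajectoryInput t w η s j) =ᵐ[volume]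
      fun s => (WithLp.toLp 2 (w s, 0) : WithLp 2 (Eu nw × Eu ny)) := fun j => by
    filter_upwards [Measure.ae_ne volume (t j)] with s hs
    simp [trajectoryInput, hs]
  have hest : ∀ j, ∀ s ∈ Ioo (switchTime t j) (switchTime t (j + 1)), HasDerivAt zh
      (mulE P.A (zh s) + mulE P.B (P.ψ (mulE P.S (zh s))) +
        mulE L (P.injection t η z zh θ s j)) s := fun j s hs => by
    rw [(injection_eventuallyEq hs).eq_of_nhds]
    exact hx.est_ode s ((ht.switchTime_nonneg hT₁ j).trans_lt hs.1) (ht.notMem_range hT₁ hs)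
  have hinj : ∀ j, ∀ s ∈ Ioo (switchTime t j) (switchTime t (j + 1)),
      HasDerivAt (fun s => P.injection t η z zh θ s j)
        (mulE H (P.injection t η z zh θ s j)) s := fun j s hs => by
    have h := hx.inj_ode s ((ht.switchTime_nonneg hT₁ j).trans_lt hs.1) (ht.notMem_range hT₁ hs)
    rw [(injection_eventuallyEq hs).eq_of_nhds]
    exact h.congr_of_eventuallyEq (injection_eventuallyEq hs)
  have hψc : Continuous P.ψ := let ⟨_, h⟩ := hψ; h.continuous
  refine ⟨⟨switchTime t, rfl, ht.switchTime_mono hT₁, Or.inl rfl⟩, fun j a b hab hs => ?_,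
    fun j => ⟨?_, fun T => ?_⟩, Or.inl ?_, fun j s hs => ?_, fun j => ?_, fun s j hs => ?_⟩
  · rw [slice_samplingDomain] at hs
    set a' := switchTime t j
    set b' := switchTime t (j + 1)
    have hb0 : 0 ≤ b := hsub j (hs ⟨hab, le_rfl⟩)
    have ha0 : 0 ≤ a := hsub j (hs ⟨le_rfl, hab⟩)
    have hzc : ContinuousOn zh (Icc a' b') := hx.est_cont.mono (hsub j)
    have hθc := hx.continuousOn_injection ht hT₁ j
    have hz : AbsolutelyContinuousOnInterval z a b := by
      refine (hx.plant_ac b hb0).mono ?_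
      rw [uIcc_of_le hab, uIcc_of_le hb0]
      exact Icc_subset_Icc_left ha0
    have ac : ∀ {n : ℕ} {f f' : ℝ → Eu n}, ContinuousOn f (Icc a' b') →
        (∀ s ∈ Ioo a' b', HasDerivAt f (f' s) s) → ContinuousOn f' (Icc a' b') →
        AbsolutelyContinuousOnInterval f a b := by
      intro n f f' hf hd hf'
      obtain ⟨M, hM⟩ := isCompact_Icc.exists_bound_of_continuousOn hf'
      refine ((lipschitzOnWith_Icc_of_hasDerivAt hf hd
        fun s hs => hM s (Ioo_subset_Icc_self hs)).mono ?_).absolutelyContinuousOnInterval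
      rwa [uIcc_of_le hab]
    have hzh : AbsolutelyContinuousOnInterval zh a b := by
      refine ac hzc (hest j) ((((mulL P.A).continuous.comp_continuousOn hzc).add
        ((mulL P.B).continuous.comp_continuousOn (hψc.comp_continuousOn
          ((mulL P.S).continuous.comp_continuousOn hzc)))).add
        ((mulL L).continuous.comp_continuousOn hθc))
    have hθ : AbsolutelyContinuousOnInterval (fun s => P.injection t η z zh θ s j) a b :=
      ac hθc (hinj j) ((mulL H).continuous.comp_continuousOn hθc)
    have hε := hz.fun_sub hzh
    have hτ : AbsolutelyContinuousOnInterval (fun s => b' - s) a b :=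
      (by fun_prop : ContDiff ℝ 1 fun s => b' - s).contDiffOn.absolutelyContinuousOnInterval
    exact ErrState.absolutelyContinuousOnInterval_mk hz hε
      (((mulL P.C).lipschitz.comp_absolutelyContinuousOnInterval hε).fun_sub hθ) hτ
  · have h1 : AEStronglyMeasurable w (volume.restrict (slice (samplingDomain t) j)) :=
      hw.1.mono_set (hsub j)
    have h2 := ((WithLp.prodContinuousLinearEquiv 2 ℝ (Eu nw) (Eu ny)).symm.continuous.comp
      (Continuous.prodMk_left (0 : Eu ny))).comp_aestronglyMeasurable h1
    exact h2.congr (EventuallyEq.symm (ae_restrict_of_ae (hu j)))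
  · obtain ⟨M, hM⟩ := hw.2 T
    refine ⟨M, ?_⟩
    have h1 : slice (samplingDomain t) j ∩ Iic T ⊆ Icc 0 T := fun s hs => ⟨hsub j hs.1, hs.2⟩
    filter_upwards [ae_restrict_of_ae_restrict_of_subset h1 hM, ae_restrict_of_ae (hu j)]
      with s h2 h3
    rw [h3]
    have h4 : ‖(WithLp.toLp 2 (w s, 0) : WithLp 2 (Eu nw × Eu ny))‖ = ‖w s‖ := by simp
    rwa [h4]
  · change switchTime t 1 - 0 ∈ Icc 0 T₂
    rw [sub_zero]
    exact ⟨ht.1, ht.2.1⟩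
  · have hs' : s ∈ slice (samplingDomain t) j := interior_subset hs
    change switchTime t (j + 1) - s ∈ Icc 0 T₂
    have := ht.switchTime_succ_le j
    exact ⟨by linarith [hs'.2], by linarith [hs'.1]⟩
  · rw [slice_samplingDomain]
    have h1 := ae_restrict_of_ae_restrict_of_subset (hsub j) hx.plant_ode
    rw [← restrict_Ioo_eq_restrict_Icc] at h1 ⊢
    filter_upwards [h1, ae_restrict_mem measurableSet_Ioo] with s hz hs
    have hε := hz.sub (hest j s hs)
    have hθ := ((mulL P.C).hasFDerivAt.comp_hasDerivAt s hε).sub (hinj j s hs)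
    have hτ := (hasDerivAt_id s).const_sub (switchTime t (j + 1))
    have h := ErrState.mkL.hasFDerivAt.comp_hasDerivAt s
      (hz.prodMk (hε.prodMk (hθ.prodMk hτ)))
    refine (HasDerivAt.congr_deriv h ?_)
    exact (P.errFlow_mk L H (z s) (zh s) _ _ (w s) rfl rfl).symm
  · obtain rfl : s = t j := hsl.eq_of_jump hs
    refine ⟨sub_self _, t (j + 1) - t j, ht.2.2 j, ?_⟩
    have h1 : P.injection t η z zh θ (t j) (j + 1) =
      mulE P.C (z (t j)) + η (t j) - mulE P.C (zh (t j)) := if_pos le_rfl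
    have h2 : (trajectoryInput t w η (t j) j).snd = η (t j) := if_pos rfl
    rw [h2]
    simp only [trajectoryArc, h1, ErrState.mk_z, ErrState.mk_ε, switchTime]
    congr 1
    rw [mulE_sub]
    abel

end

end Plant

/-! ### Bounds for the trajectories of the interconnection -/

section Distance

variable {nz ny : ℕ}

theorem norm_obsState_sq (z zh : Eu nz) (θ : Eu ny) :
    ‖Plant.obsState z zh θ‖ ^ 2 = ‖z‖ ^ 2 + (‖zh‖ ^ 2 + ‖θ‖ ^ 2) := by
  simp [Plant.obsState, WithLp.prod_norm_sq_eq_of_L2]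

theorem obsState_sub (z zh z' zh' : Eu nz) (θ θ' : Eu ny) :
    Plant.obsState z zh θ - Plant.obsState z' zh' θ' =
      Plant.obsState (z - z') (zh - zh') (θ - θ') := rfl

theorem targetSet_nonempty : (Plant.targetSet nz ny).Nonempty :=
  ⟨Plant.obsState 0 0 0, 0, rfl⟩

theorem infDist_targetSet_sq_le (z zh : Eu nz) (θ : Eu ny) :
    Metric.infDist (Plant.obsState z zh θ) (Plant.targetSet nz ny) ^ 2 ≤
      ‖z - zh‖ ^ 2 + ‖θ‖ ^ 2 := by
  have h1 : Metric.infDist (Plant.obsState z zh θ) (Plant.targetSet nz ny) ≤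
      dist (Plant.obsState z zh θ) (Plant.obsState z z 0) :=
    Metric.infDist_le_dist_of_mem ⟨z, rfl⟩
  refine (pow_le_pow_left₀ Metric.infDist_nonneg h1 2).trans ?_
  rw [dist_eq_norm, obsState_sub, norm_obsState_sq, sub_self, sub_zero, norm_sub_rev zh z]
  simp

/-- For a target point `(v, v, 0)`, both `z - v` and `zh - v` are bounded by the distance. The
factor `2` could be `√2`. -/
theorem norm_sub_le_infDist_targetSet (z zh : Eu nz) (θ : Eu ny) :
    ‖z - zh‖ ≤ 2 * Metric.infDist (Plant.obsState z zh θ) (Plant.targetSet nz ny) := by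
  suffices h : ‖z - zh‖ / 2 ≤ Metric.infDist (Plant.obsState z zh θ) (Plant.targetSet nz ny) by
    linarith
  refine (Metric.le_infDist targetSet_nonempty).2 ?_
  rintro _ ⟨v, rfl⟩
  have h1 := norm_obsState_sq (z - v) (zh - v) (θ - 0)
  rw [← obsState_sub, ← dist_eq_norm] at h1
  have h2 : ‖z - v‖ ≤ dist (Plant.obsState z zh θ) (Plant.obsState v v 0) :=
    abs_le_of_sq_le_sq' (by nlinarith [sq_nonneg ‖zh - v‖, sq_nonneg ‖θ - 0‖]) dist_nonneg |>.2
  have h3 : ‖zh - v‖ ≤ dist (Plant.obsState z zh θ) (Plant.obsState v v 0) :=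
    abs_le_of_sq_le_sq' (by nlinarith [sq_nonneg ‖z - v‖, sq_nonneg ‖θ - 0‖]) dist_nonneg |>.2
  have h4 : ‖z - zh‖ ≤ ‖z - v‖ + ‖zh - v‖ := by
    simpa using norm_sub_le (z - v) (zh - v)
  linarith

theorem norm_le_infDist_targetSet (z zh : Eu nz) (θ : Eu ny) :
    ‖θ‖ ≤ Metric.infDist (Plant.obsState z zh θ) (Plant.targetSet nz ny) := by
  refine (Metric.le_infDist targetSet_nonempty).2 ?_
  rintro _ ⟨v, rfl⟩
  have h1 := norm_obsState_sq (z - v) (zh - v) (θ - 0)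
  rw [← obsState_sub, ← dist_eq_norm, sub_zero] at h1
  exact abs_le_of_sq_le_sq' (by nlinarith [sq_nonneg ‖zh - v‖, sq_nonneg ‖z - v‖])
    dist_nonneg |>.2

/-- The squared norm of the error in the coordinates `(ε, θ̃)`, against the distance to the target
set. -/
theorem error_sq_le_infDist_targetSet_sq (C : Matrix (Fin ny) (Fin nz) ℝ) (z zh : Eu nz)
    (θ : Eu ny) :
    ‖z - zh‖ ^ 2 + ‖mulE C (z - zh) - θ‖ ^ 2 ≤ (4 + (2 * ‖mulL C‖ + 1) ^ 2) *
      Metric.infDist (Plant.obsState z zh θ) (Plant.targetSet nz ny) ^ 2 := by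
  have h1 := norm_sub_le_infDist_targetSet z zh θ
  have h2 := norm_le_infDist_targetSet z zh θ
  set D := Metric.infDist (Plant.obsState z zh θ) (Plant.targetSet nz ny)
  have h3 : ‖mulE C (z - zh)‖ ≤ ‖mulL C‖ * (2 * D) :=
    ((mulL C).le_opNorm _).trans (by gcongr)
  have h4 : ‖mulE C (z - zh) - θ‖ ≤ (2 * ‖mulL C‖ + 1) * D :=
    (norm_sub_le _ _).trans (by linarith)
  have h5 := pow_le_pow_left₀ (norm_nonneg _) h1 2
  have h6 := pow_le_pow_left₀ (norm_nonneg _) h4 2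
  rw [mul_pow] at h5 h6
  linarith

/-- The distance is at most that to `(z, z, 0)`, and `θ = C ε - θ̃` is controlled by `ε` and `θ̃`.
-/
theorem infDist_targetSet_sq_le_error_sq (C : Matrix (Fin ny) (Fin nz) ℝ) (z zh : Eu nz)
    (θ : Eu ny) :
    Metric.infDist (Plant.obsState z zh θ) (Plant.targetSet nz ny) ^ 2 ≤
      (3 + 2 * ‖mulL C‖ ^ 2) * (‖z - zh‖ ^ 2 + ‖mulE C (z - zh) - θ‖ ^ 2) := by
  have h1 := infDist_targetSet_sq_le z zh θ
  have h2 : ‖mulE C (z - zh)‖ ≤ ‖mulL C‖ * ‖z - zh‖ := (mulL C).le_opNorm _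
  have h3 : ‖θ‖ ≤ ‖mulE C (z - zh)‖ + ‖mulE C (z - zh) - θ‖ := by
    simpa using norm_sub_le (mulE C (z - zh)) (mulE C (z - zh) - θ)
  have h4 : ‖θ‖ ^ 2 ≤ 2 * (‖mulL C‖ * ‖z - zh‖) ^ 2 + 2 * ‖mulE C (z - zh) - θ‖ ^ 2 := by
    refine (pow_le_pow_left₀ (norm_nonneg _) (h3.trans (add_le_add_left h2 _)) 2).trans ?_
    nlinarith [sq_nonneg (‖mulL C‖ * ‖z - zh‖ - ‖mulE C (z - zh) - θ‖)]
  nlinarith [sq_nonneg ‖z - zh‖, sq_nonneg ‖mulE C (z - zh) - θ‖,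
    mul_nonneg (sq_nonneg ‖mulL C‖) (sq_nonneg ‖mulE C (z - zh) - θ‖)]

end Distance

namespace Plant

variable {nz nw ny ns nq np : ℕ} {P : Plant nz nw ny ns nq np} {L : Matrix (Fin nz) (Fin ny) ℝ}
  {H : Matrix (Fin ny) (Fin ny) ℝ} {T₁ T₂ lt γ a b : ℝ} {V : ErrState nz ny → ℝ}

theorem isLocBddInput_zero : IsLocBddInput (fun _ => (0 : Eu nw)) :=
  ⟨aestronglyMeasurable_const, fun _ => ⟨0, by simp⟩⟩

/-- The error estimate along trajectories. -/
theorem IsTrajectory.error_sq_le (hV : P.IsLyapunov L H T₂ lt γ V a b) (hψ : IsLip P.ψ)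
    (hT₁ : 0 < T₁) (hT : T₁ ≤ T₂) (hlt : 0 < lt) {t : ℕ → ℝ} (ht : IsSamplingSeq T₁ T₂ t)
    {w : ℝ → Eu nw} {η : ℝ → Eu ny} {z zh : ℝ → Eu nz} {θ : ℝ → Eu ny} (hw : IsLocBddInput w)
    {r : ℝ} (hwr : ∀ᵐ s ∂(volume.restrict (Ici 0)), ‖w s‖ ≤ r) (hηr : ∀ k, ‖η (t k)‖ ≤ r)
    (hx : P.IsTrajectory L H t w η z zh θ) {s : ℝ} (hs : 0 ≤ s) :
    ‖z s - zh s‖ ^ 2 + ‖mulE P.C (z s - zh s) - θ s‖ ^ 2 ≤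
      b / a * (Real.exp (-2 * lt * s) *
        (‖z 0 - zh 0‖ ^ 2 + ‖mulE P.C (z 0 - zh 0) - θ 0‖ ^ 2)) +
      (γ ^ 2 / (2 * lt) + b / (1 - Real.exp (-2 * lt * T₁))) / a * r ^ 2 := by
  obtain ⟨j, hj, hθ⟩ := exists_injection_eq (P := P) (η := η) (z := z) (zh := zh) (θ := θ)
    ht hT₁ hs
  have h := Plant.error_sq_le hV (hx.isSolutionPair hψ hw ht hT₁) hT₁ hT hlt (r := r)
    (fun j => ae_restrict_of_ae_restrict_of_subset
      (fun s hs => (ht.switchTime_nonneg hT₁ j).trans hs.1) hwr)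
    (fun s j hsj => ?_) hj
  · simp only [trajectoryArc, ErrState.mk_ε, ErrState.mk_θ, hθ] at h
    exact h
  · obtain rfl : s = t j := (ht.isSliceSeq hT₁).eq_of_jump hsj
    simpa [trajectoryInput] using hηr j

theorem exp_stable_of_isLyapunov (hV : P.IsLyapunov L H T₂ lt γ V a b) (hψ : IsLip P.ψ)
    (hT₁ : 0 < T₁) (hT : T₁ ≤ T₂) (hlt : 0 < lt) :
    ∃ κ : ℝ, 0 < κ ∧ ∀ t, IsSamplingSeq T₁ T₂ t → ∀ z zh θ,
      P.IsTrajectory L H t (fun _ => 0) (fun _ => 0) z zh θ → ∀ s, 0 ≤ s →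
        Metric.infDist (obsState (z s) (zh s) (θ s)) (targetSet nz ny) ≤
          κ * Real.exp (-lt * s) *
            Metric.infDist (obsState (z 0) (zh 0) (θ 0)) (targetSet nz ny) := by
  have ha := hV.a_pos
  have hb := hV.b_pos
  set k := 4 + (2 * ‖mulL P.C‖ + 1) ^ 2 with hk
  set k' := 3 + 2 * ‖mulL P.C‖ ^ 2 with hk'
  have hkpos : 0 < k := by positivity
  have hkpos' : 0 < k' := by positivity
  refine ⟨√(k' * (b / a) * k), by positivity, fun t ht z zh θ hx s hs => ?_⟩
  refine abs_le_of_sq_le_sq' ?_ (mul_nonneg (by positivity) Metric.infDist_nonneg) |>.2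
  -- With `r = 0` the disturbance term vanishes; the rate `2 λ_t` for squares becomes `λ_t` for
  -- distances.
  have h1 := hx.error_sq_le hV hψ hT₁ hT hlt ht isLocBddInput_zero (r := 0) (by simp) (by simp) hs
  have h2 := infDist_targetSet_sq_le_error_sq P.C (z s) (zh s) (θ s)
  have h3 := error_sq_le_infDist_targetSet_sq P.C (z 0) (zh 0) (θ 0)
  rw [← hk] at h3
  rw [← hk'] at h2
  set D₀ := Metric.infDist (obsState (z 0) (zh 0) (θ 0)) (targetSet nz ny)
  have h4 : Real.exp (-2 * lt * s) = Real.exp (-lt * s) ^ 2 := by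
    rw [← Real.exp_nat_mul]; congr 1; push_cast; ring
  rw [h4] at h1
  refine h2.trans ((mul_le_mul_of_nonneg_left h1 hkpos'.le).trans ?_)
  rw [mul_pow, mul_pow, Real.sq_sqrt (by positivity)]
  calc k' * (b / a * (Real.exp (-lt * s) ^ 2 *
        (‖z 0 - zh 0‖ ^ 2 + ‖mulE P.C (z 0 - zh 0) - θ 0‖ ^ 2)) +
      (γ ^ 2 / (2 * lt) + b / (1 - Real.exp (-2 * lt * T₁))) / a * 0 ^ 2)
      = k' * (b / a) * Real.exp (-lt * s) ^ 2 *
        (‖z 0 - zh 0‖ ^ 2 + ‖mulE P.C (z 0 - zh 0) - θ 0‖ ^ 2) := by ring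
    _ ≤ k' * (b / a) * Real.exp (-lt * s) ^ 2 * (k * D₀ ^ 2) := by gcongr
    _ = _ := by ring

theorem bounded_of_isLyapunov (hV : P.IsLyapunov L H T₂ lt γ V a b) (hψ : IsLip P.ψ)
    (hT₁ : 0 < T₁) (hT : T₁ ≤ T₂) (hlt : 0 < lt) (r : ℝ) :
    ∃ M : ℝ, ∀ t, IsSamplingSeq T₁ T₂ t → ∀ (w : ℝ → Eu nw) (η : ℝ → Eu ny),
      IsLocBddInput w → (∀ᵐ s ∂(volume.restrict (Ici 0)), ‖w s‖ ≤ r) → (∀ k, ‖η (t k)‖ ≤ r) →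
      ∀ z zh θ, P.IsTrajectory L H t w η z zh θ →
        Metric.infDist (obsState (z 0) (zh 0) (θ 0)) (targetSet nz ny) ≤ r →
        ∀ s, 0 ≤ s → ‖z s - zh s‖ ≤ M := by
  have ha := hV.a_pos
  have hb := hV.b_pos
  set k := 4 + (2 * ‖mulL P.C‖ + 1) ^ 2 with hk
  refine ⟨√(b / a * (k * r ^ 2) +
    (γ ^ 2 / (2 * lt) + b / (1 - Real.exp (-2 * lt * T₁))) / a * r ^ 2),
    fun t ht w η hw hwr hηr z zh θ hx h0 s hs => Real.le_sqrt_of_sq_le ?_⟩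
  have h1 := hx.error_sq_le hV hψ hT₁ hT hlt ht hw hwr hηr hs
  have h3 := error_sq_le_infDist_targetSet_sq P.C (z 0) (zh 0) (θ 0)
  rw [← hk] at h3
  have h4 : Real.exp (-2 * lt * s) ≤ 1 := Real.exp_le_one_iff.2 (by nlinarith)
  have h5 := pow_le_pow_left₀ Metric.infDist_nonneg h0 2
  have h6 : Real.exp (-2 * lt * s) * (‖z 0 - zh 0‖ ^ 2 + ‖mulE P.C (z 0 - zh 0) - θ 0‖ ^ 2) ≤
      k * r ^ 2 := by
    refine (mul_le_of_le_one_left (by positivity) h4).trans (h3.trans ?_)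
    gcongr
  have h7 := mul_le_mul_of_nonneg_left h6 (div_pos hb ha).le
  nlinarith [sq_nonneg ‖mulE P.C (z s - zh s) - θ s‖]

theorem l2_gain_of_isLyapunov (hV : P.IsLyapunov L H T₂ lt γ V a b) (hψ : IsLip P.ψ)
    (hT₁ : 0 < T₁) (hT : T₁ ≤ T₂) (hlt : 0 < lt) (hγ : 0 < γ) :
    ∃ α : ℝ, 0 < α ∧ ∀ t, IsSamplingSeq T₁ T₂ t → ∀ w : ℝ → Eu nw, IsLocBddInput w →
      ∀ z zh θ, P.IsTrajectory L H t w (fun _ => 0) z zh θ →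
        (∫⁻ s in Ici 0, ‖mulE P.Cp (z s - zh s)‖ₑ ^ 2) ^ (1 / 2 : ℝ) ≤
          ENNReal.ofReal
              (α * Metric.infDist (obsState (z 0) (zh 0) (θ 0)) (targetSet nz ny)) +
            ENNReal.ofReal γ * (∫⁻ s in Ici 0, ‖w s‖ₑ ^ 2) ^ (1 / 2 : ℝ) := by
  have hb := hV.b_pos
  set k := 4 + (2 * ‖mulL P.C‖ + 1) ^ 2 with hk
  have hkpos : 0 < k := by positivity
  refine ⟨√b * √k, by positivity, fun t ht w hw z zh θ hx => ?_⟩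
  have h := l2_gain_hybrid hV (hx.isSolutionPair hψ hw ht hT₁) hT₁ hT hlt hγ
    (fun s j _ => by simp [trajectoryInput])
  rw [ht.domT_samplingDomain hT₁] at h
  refine h.trans (add_le_add_left (ENNReal.ofReal_le_ofReal ?_) _)
  rw [mul_assoc]
  refine mul_le_mul_of_nonneg_left ?_ (Real.sqrt_nonneg _)
  refine Real.sqrt_le_iff.2 ⟨mul_nonneg (Real.sqrt_nonneg _) Metric.infDist_nonneg, ?_⟩
  rw [mul_pow, Real.sq_sqrt hkpos.le]
  exact error_sq_le_infDist_targetSet_sq P.C (z 0) (zh 0) (θ 0)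

end Plant

/-! ### Existence of trajectories of the interconnection -/

namespace Plant

variable {nz nw ny ns nq np : ℕ} {T₁ T₂ : ℝ} {t : ℕ → ℝ}

theorem IsLocBddInput.locallyIntegrable_indicator {w : ℝ → Eu nw} (hw : IsLocBddInput w) :
    LocallyIntegrable ((Ici 0).indicator w) volume := by
  rw [locallyIntegrable_iff]
  intro K hK
  obtain ⟨T, hT⟩ := hK.bddAbove
  obtain ⟨M, hM⟩ := hw.2 T
  have h1 : AEStronglyMeasurable ((Ici 0).indicator w) volume :=
    (aestronglyMeasurable_indicator_iff measurableSet_Ici).2 hw.1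
  refine Measure.integrableOn_of_bounded (M := max M 0) hK.measure_lt_top.ne h1 ?_
  rw [ae_restrict_iff' measurableSet_Icc] at hM
  rw [ae_restrict_iff' hK.measurableSet]
  filter_upwards [hM] with s hs hsK
  by_cases h0 : s ∈ Ici (0 : ℝ)
  · rw [indicator_of_mem h0]
    exact (hs ⟨h0, hT hsK⟩).trans (le_max_left _ _)
  · rw [indicator_of_notMem h0, norm_zero]
    exact le_max_right _ _

/-- The primitive of a locally bounded function is locally Lipschitz, and Lebesgue's theorem
differentiates it almost everywhere. Extending `w` by zero to negative times avoids one-sided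
statements. -/
theorem IsLocBddInput.exists_primitive {w : ℝ → Eu nw} (hw : IsLocBddInput w) :
    ∃ W : ℝ → Eu nw, W 0 = 0 ∧ Continuous W ∧
      (∀ b, 0 ≤ b → AbsolutelyContinuousOnInterval W 0 b) ∧
      ∀ᵐ s ∂(volume.restrict (Ici 0)), HasDerivAt W (w s) s := by
  have hloc := hw.locallyIntegrable_indicator
  have hint : ∀ a b : ℝ, IntervalIntegrable ((Ici 0).indicator w) volume a b := fun a b =>
    (hloc.integrableOn_isCompact isCompact_uIcc).intervalIntegrable
  refine ⟨fun s => ∫ r in (0 : ℝ)..s, (Ici 0).indicator w r, by simp,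
    intervalIntegral.continuous_primitive hint 0, fun b hb => ?_, ?_⟩
  · obtain ⟨M, hM⟩ := hw.2 b
    rw [ae_restrict_iff' measurableSet_Icc] at hM
    refine (LipschitzOnWith.of_dist_le_mul (K := M.toNNReal)
      fun x hx y hy => ?_).absolutelyContinuousOnInterval
    rw [dist_eq_norm, dist_eq_norm, intervalIntegral.integral_interval_sub_left (hint _ _)
      (hint _ _)]
    rw [uIcc_of_le hb] at hx hy
    refine (intervalIntegral.norm_integral_le_of_norm_le_const_ae (C := M.toNNReal) ?_)
    filter_upwards [hM] with s hs hsI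
    have h1 : s ∈ Icc 0 b := uIcc_subset_Icc hy hx (uIoc_subset_uIcc hsI)
    rw [indicator_of_mem (mem_Ici.2 h1.1)]
    exact (hs h1).trans (Real.le_coe_toNNReal M)
  · have h1 := ae_restrict_of_ae (s := Ici 0)
      (_root_.LocallyIntegrable.ae_hasDerivAt_integral hloc)
    filter_upwards [h1, ae_restrict_mem measurableSet_Ici] with s hs h0
    have h2 := hs 0
    rwa [indicator_of_mem h0] at h2

/-- With `W` a primitive of `w`, the curve `α = z - N W` solves an equation that is Lipschitz in the
state and continuous in time. So a merely measurable input needs no Carathéodory theory. -/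
theorem exists_plant_trajectory {P : Plant nz nw ny ns nq np} (hψ : IsLip P.ψ) {w : ℝ → Eu nw}
    (hw : IsLocBddInput w) (z₀ : Eu nz) :
    ∃ z : ℝ → Eu nz, z 0 = z₀ ∧ (∀ b, 0 ≤ b → AbsolutelyContinuousOnInterval z 0 b) ∧
      ∀ᵐ s ∂(volume.restrict (Ici 0)), HasDerivAt z
        (mulE P.A (z s) + mulE P.B (P.ψ (mulE P.S (z s))) + mulE P.N (w s)) s := by
  obtain ⟨W, hW0, hWc, hWac, hWd⟩ := hw.exists_primitive
  have hNW : Continuous fun s => mulE P.N (W s) := (mulL P.N).continuous.comp hWc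
  obtain ⟨K, hK⟩ : IsLip fun x : Eu nz => mulE P.A x + mulE P.B (P.ψ (mulE P.S x)) :=
    (IsLip.mulE P.A ⟨1, LipschitzWith.id⟩).add
      (IsLip.mulE P.B (hψ.comp (IsLip.mulE P.S ⟨1, LipschitzWith.id⟩)))
  set g : Eu nz → Eu nz := fun x => mulE P.A x + mulE P.B (P.ψ (mulE P.S x)) with hg
  obtain ⟨α, h0, hα⟩ := exists_hasDerivWithinAt_Ici_of_lipschitz
    (f := fun s x => g (x + mulE P.N (W s))) (K := K)
    (fun s => LipschitzWith.of_dist_le_mul fun x y => by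
      simpa using hK.dist_le_mul (x + mulE P.N (W s)) (y + mulE P.N (W s)))
    (fun x => hK.continuous.comp (continuous_const.add hNW)) z₀
  refine ⟨fun s => α s + mulE P.N (W s), ?_, fun b hb => ?_, ?_⟩
  · simp only [h0, hW0, map_zero, add_zero]
  · have hαc : ContinuousOn α (Icc 0 b) := fun s hs =>
      (hα s hs.1).continuousWithinAt.mono Icc_subset_Ici_self
    obtain ⟨M, hM⟩ := isCompact_Icc.exists_bound_of_continuousOn
      (hK.continuous.comp_continuousOn (hαc.add hNW.continuousOn))
    have h1 : LipschitzOnWith M.toNNReal α (Icc 0 b) := lipschitzOnWith_Icc_of_hasDerivAt hαc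
      (fun s hs => (hα s hs.1.le).hasDerivAt (Ici_mem_nhds hs.1))
      (fun s hs => hM s (Ioo_subset_Icc_self hs))
    rw [← uIcc_of_le hb] at h1
    exact h1.absolutelyContinuousOnInterval.fun_add
      ((mulL P.N).lipschitz.comp_absolutelyContinuousOnInterval (hWac b hb))
  · rw [← restrict_Ioi_eq_restrict_Ici] at hWd ⊢
    filter_upwards [hWd, ae_restrict_mem measurableSet_Ioi] with s hs hpos
    exact ((hα s (le_of_lt hpos)).hasDerivAt (Ici_mem_nhds hpos)).add
      ((mulL P.N).hasFDerivAt.comp_hasDerivAt s hs)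

/-- The observer has a trajectory for every measured output `y`. -/
theorem exists_observer_trajectory {P : Plant nz nw ny ns nq np} (L : Matrix (Fin nz) (Fin ny) ℝ)
    (H : Matrix (Fin ny) (Fin ny) ℝ) (hψ : IsLip P.ψ) (ht : IsSamplingSeq T₁ T₂ t) (hT₁ : 0 < T₁)
    (y : ℝ → Eu ny) (zh₀ : Eu nz) (θ₀ : Eu ny) :
    ∃ (zh : ℝ → Eu nz) (θ : ℝ → Eu ny), zh 0 = zh₀ ∧ θ 0 = θ₀ ∧ ContinuousOn zh (Ici 0) ∧
      (∀ s, 0 < s → s ∉ range t →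
        HasDerivAt zh (mulE P.A (zh s) + mulE P.B (P.ψ (mulE P.S (zh s))) + mulE L (θ s)) s) ∧
      (∀ s, 0 < s → s ∉ range t → HasDerivAt θ (mulE H (θ s)) s) ∧
      (0 ∉ range t → ContinuousWithinAt θ (Ici 0) 0) ∧
      (∀ k, 0 < t k → ContinuousWithinAt θ (Iic (t k)) (t k)) ∧
      ∀ k, Tendsto θ (𝓝[>] (t k)) (𝓝 (y (t k) - mulE P.C (zh (t k)))) := by
  obtain ⟨K, hK⟩ : IsLip fun x : Eu nz × Eu ny =>
      (mulE P.A x.1 + mulE P.B (P.ψ (mulE P.S x.1)) + mulE L x.2, mulE H x.2) :=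
    (((IsLip.mulE P.A .fst).add (IsLip.mulE P.B (hψ.comp (IsLip.mulE P.S .fst)))).add
      (IsLip.mulE L .snd)).prodMk (IsLip.mulE H .snd)
  choose Φ hΦ0 hΦ using fun X₀ => exists_hasDerivWithinAt_Ici_of_lipschitz (fun _ : ℝ => hK)
    (fun _ => continuous_const) X₀
  -- `X k` is the observer state with which piece `k` starts, after the reset when `k > 0`. If `t 0
  -- = 0`, the first piece is a single time.
  let X : ℕ → Eu nz × Eu ny := fun k => Nat.rec (zh₀, θ₀) (fun k X =>
    ((Φ X (t k - switchTime t k)).1, y (t k) - mulE P.C (Φ X (t k - switchTime t k)).1)) k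
  let G : ℕ → ℝ → Eu nz × Eu ny := fun k s => Φ (X k) (s - switchTime t k)
  have hG0 : ∀ k, G k (switchTime t k) = X k := fun k => by simp only [G, sub_self, hΦ0]
  have hX : ∀ k, X (k + 1) = ((G k (t k)).1, y (t k) - mulE P.C (G k (t k)).1) := fun k => rfl
  have hGd : ∀ k s, switchTime t k ≤ s → HasDerivWithinAt (G k)
      (mulE P.A (G k s).1 + mulE P.B (P.ψ (mulE P.S (G k s).1)) + mulE L (G k s).2,
        mulE H (G k s).2) (Ici (switchTime t k)) s := fun k s hs => by
    have h1 : HasDerivWithinAt (fun r => r - switchTime t k) 1 (Ici (switchTime t k)) s :=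
      ((hasDerivAt_id s).sub_const _).hasDerivWithinAt
    have h2 := (hΦ (X k) (s - switchTime t k) (sub_nonneg.2 hs)).scomp s h1
      (fun r hr => sub_nonneg.2 hr)
    rwa [one_smul] at h2
  have hGc : ∀ k, ContinuousOn (G k) (Ici (switchTime t k)) := fun k s hs =>
    (hGd k s hs).continuousWithinAt
  -- The index of the first sample not before `s`. At a sampling instant this selects the earlier
  -- piece, hence the value of `θ` before the reset.
  let i : ℝ → ℕ := fun s => Nat.find (ht.exists_le hT₁ s)
  have hi : ∀ s, s ≤ t (i s) := fun s => Nat.find_spec (ht.exists_le hT₁ s)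
  have hi_succ : ∀ k s, t k < s → s ≤ t (k + 1) → i s = k + 1 := fun k s h1 h2 =>
    (Nat.find_eq_iff _).2 ⟨h2, fun n hn => not_le.2
      (((ht.strictMono hT₁).monotone (Nat.lt_succ_iff.1 hn)).trans_lt h1)⟩
  have hi_zero : ∀ s, s ≤ t 0 → i s = 0 := fun s h => (Nat.find_eq_zero _).2 h
  have hi_lt : ∀ s, 0 < s → switchTime t (i s) < s := fun s hs => by
    rcases hk : i s with _ | k
    · exact hs
    · exact not_le.1 (Nat.find_min (ht.exists_le hT₁ s) (hk ▸ k.lt_succ_self : k < i s))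
  have hi_Ioc : ∀ k s, s ∈ Ioc (switchTime t k) (switchTime t (k + 1)) → i s = k := fun k s hs => by
    cases k with
    | zero => exact hi_zero s hs.2
    | succ k => exact hi_succ k s hs.1 hs.2
  let x : ℝ → Eu nz × Eu ny := fun s => G (i s) s
  have hx : ∀ k s, s ∈ Ioc (switchTime t k) (switchTime t (k + 1)) → x s = G k s := fun k s hs => by
    simp only [x, hi_Ioc k s hs]
  -- Time zero lies in none of the half-open intervals above and needs its own statement.
  have hx0 : ∀ s, s ≤ t 0 → x s = G 0 s := fun s hs => by simp only [x, hi_zero s hs]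
  have hxt : ∀ k, x (t k) = G k (t k) := fun k => by
    cases k with
    | zero => exact hx0 _ le_rfl
    | succ k => exact hx (k + 1) _ ⟨ht.strictMono hT₁ k.lt_succ_self, le_rfl⟩
  have hd : ∀ s, 0 < s → s ∉ range t → HasDerivAt x
      (mulE P.A (x s).1 + mulE P.B (P.ψ (mulE P.S (x s).1)) + mulE L (x s).2,
        mulE H (x s).2) s := fun s hs hst => by
    have h1 : s ∈ Ioo (switchTime t (i s)) (switchTime t (i s + 1)) :=
      ⟨hi_lt s hs, (hi s).lt_of_ne fun h => hst ⟨_, h.symm⟩⟩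
    refine ((hGd (i s) s h1.1.le).hasDerivAt (Ici_mem_nhds h1.1)).congr_of_eventuallyEq ?_
    filter_upwards [isOpen_Ioo.mem_nhds h1] with r hr using hx _ _ (Ioo_subset_Ioc_self hr)
  have hright : ∀ k, Tendsto x (𝓝[>] (t k)) (𝓝 (X (k + 1))) := fun k => by
    have h1 : ContinuousWithinAt (G (k + 1)) (Ioi (t k)) (t k) :=
      (hGc (k + 1) (t k) self_mem_Ici).mono Ioi_subset_Ici_self
    rw [← hG0 (k + 1)]
    refine Tendsto.congr' ?_ h1
    filter_upwards [Ioc_mem_nhdsGT (ht.strictMono hT₁ k.lt_succ_self)] with r hr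
      using (hx (k + 1) r hr).symm
  have hzh : ∀ k, ContinuousOn (fun s => (x s).1) (Icc 0 (t k)) := fun k => by
    induction k with
    | zero =>
      exact (continuous_fst.comp_continuousOn ((hGc 0).mono Icc_subset_Ici_self)).congr
        fun s hs => by simp only [hx0 s hs.2, Function.comp]
    | succ k ih =>
      have hle := (ht.strictMono hT₁ k.lt_succ_self).le
      rw [← Icc_union_Icc_eq_Icc (ht.nonneg hT₁ k) hle]
      refine ih.union_of_isClosed ?_ isClosed_Icc isClosed_Icc
      refine (continuous_fst.comp_continuousOn
        ((hGc (k + 1)).mono Icc_subset_Ici_self)).congr fun s hs => ?_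
      -- Consecutive pieces have the same first component at `t k`, because the reset does not touch
      -- `ẑ`.
      rcases hs.1.eq_or_lt with heq | hlt
      · have h1 : G (k + 1) (t k) = X (k + 1) := hG0 (k + 1)
        obtain rfl : t k = s := heq
        simp only [hxt, Function.comp, h1, hX]
      · simp only [hx (k + 1) s ⟨hlt, hs.2⟩, Function.comp]
  refine ⟨fun s => (x s).1, fun s => (x s).2, ?_, ?_, fun s hs => ?_,
    fun s hs hst => (hd s hs hst).fst, fun s hs hst => (hd s hs hst).snd, fun h0 => ?_,
    fun k hk => ?_, fun k => ?_⟩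
  · exact congrArg Prod.fst ((hx0 0 ht.1).trans (hG0 0))
  · exact congrArg Prod.snd ((hx0 0 ht.1).trans (hG0 0))
  · obtain ⟨k, hk⟩ := ht.exists_le hT₁ (s + 1)
    refine (hzh k s ⟨hs, by linarith⟩).mono_of_mem_nhdsWithin ?_
    filter_upwards [self_mem_nhdsWithin,
      mem_nhdsWithin_of_mem_nhds (Iio_mem_nhds (by linarith : s < t k))] with r h1 h2
    exact ⟨h1, le_of_lt h2⟩
  · have hpos : 0 < t 0 := ht.1.lt_of_ne fun h => h0 ⟨0, h.symm⟩
    refine ((hGc 0 0 self_mem_Ici).snd).congr_of_eventuallyEq ?_ (by rw [hx0 0 hpos.le])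
    filter_upwards [mem_nhdsWithin_of_mem_nhds (Iio_mem_nhds hpos)] with r hr
    rw [hx0 r (le_of_lt hr)]
  · have hlt : switchTime t k < t k := by
      cases k with
      | zero => exact hk
      | succ k => exact ht.strictMono hT₁ k.lt_succ_self
    have h1 := ((hGd k (t k) hlt.le).hasDerivAt (Ici_mem_nhds hlt)).continuousAt.snd
    refine (h1.continuousWithinAt (s := Iic (t k))).congr_of_eventuallyEq ?_ (by rw [hxt])
    filter_upwards [self_mem_nhdsWithin, mem_nhdsWithin_of_mem_nhds (Ioi_mem_nhds hlt)]
      with r h2 h3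
    rw [hx k r ⟨h3, h2⟩]
  · have h1 := (continuous_snd.tendsto _).comp (hright k)
    rw [hX] at h1
    simp only [hxt]
    exact h1

theorem exists_isTrajectory {P : Plant nz nw ny ns nq np} (L : Matrix (Fin nz) (Fin ny) ℝ)
    (H : Matrix (Fin ny) (Fin ny) ℝ) (hψ : IsLip P.ψ) (ht : IsSamplingSeq T₁ T₂ t) (hT₁ : 0 < T₁)
    {w : ℝ → Eu nw} (η : ℝ → Eu ny) (hw : IsLocBddInput w) (z₀ zh₀ : Eu nz) (θ₀ : Eu ny) :
    ∃ z zh θ, P.IsTrajectory L H t w η z zh θ ∧ z 0 = z₀ ∧ zh 0 = zh₀ ∧ θ 0 = θ₀ := by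
  obtain ⟨z, hz0, hac, hode⟩ := exists_plant_trajectory hψ hw z₀
  obtain ⟨zh, θ, hzh0, hθ0, h1, h2, h3, h4, h5, h6⟩ := exists_observer_trajectory L H hψ ht hT₁
    (fun s => mulE P.C (z s) + η s) zh₀ θ₀
  exact ⟨z, zh, θ, ⟨hac, hode, h1, h2, h3, h4, h5, h6⟩, hz0, hzh0, hθ0⟩

end Plant

/-! ### The main theorem -/

theorem theorem1 {nz nw ny ns nq np : ℕ} (P : Plant nz nw ny ns nq np)
    (L : Matrix (Fin nz) (Fin ny) ℝ) (H : Matrix (Fin ny) (Fin ny) ℝ)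
    (ℓ T₁ T₂ lt γ : ℝ) (hℓ : 0 < ℓ)
    (hψ : ∀ v₁ v₂, ‖P.ψ v₁ - P.ψ v₂‖ ≤ ℓ * ‖v₁ - v₂‖)
    (hT₁ : 0 < T₁) (hT : T₁ ≤ T₂) (hlt : 0 < lt) (hγ : 0 < γ)
    (hA : P.DissipationAssumption L H T₂ lt γ) :
    (P.errSystem L H T₁ T₂).IsEISS (Plant.errSet nz ny T₂) ∧
    (∃ α : ℝ, 0 < α ∧ ∀ E φ u, (P.errSystem L H T₁ T₂).IsSolutionPair E φ u →
      (∀ t j, (t, j) ∈ E → (u t j).snd = 0) →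
      (∫⁻ s in domT E, ‖mulE P.Cp (φ s (jmin E s)).ε‖ₑ ^ 2) ^ (1 / 2 : ℝ) ≤
        ENNReal.ofReal (α * Metric.infDist (φ 0 0) (Plant.errSet nz ny T₂)) +
          ENNReal.ofReal γ * (∫⁻ s in domT E, ‖(u s (jmin E s)).fst‖ₑ ^ 2) ^ (1 / 2 : ℝ)) ∧
    P.SolvesEstimationProblem L H T₁ T₂ lt γ := by
  obtain ⟨V, a, b, hV⟩ := hA.exists_isLyapunov
  have hψ' : IsLip P.ψ := Plant.isLip_psi hℓ hψ
  have hb := hV.b_pos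
  refine ⟨⟨Plant.isPreEISS hV hT₁ hT hlt,
      fun E φ u h => Plant.isCompleteDom_of_isMaximalPair hψ' hT₁ hT h⟩,
    -- The initial storage is at most `b` times the squared initial distance, whence `α = √b`.
    ⟨√b, by positivity, fun E φ u hsol hη => ?_⟩,
    ⟨fun t ht w η hw z₀ zh₀ θ₀ => Plant.exists_isTrajectory L H hψ' ht hT₁ η hw z₀ zh₀ θ₀,
      Plant.exp_stable_of_isLyapunov hV hψ' hT₁ hT hlt,
      Plant.bounded_of_isLyapunov hV hψ' hT₁ hT hlt,
      Plant.l2_gain_of_isLyapunov hV hψ' hT₁ hT hlt hγ⟩⟩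
  refine (Plant.l2_gain_hybrid hV hsol hT₁ hT hlt hγ hη).trans
    (add_le_add_left (ENNReal.ofReal_le_ofReal ?_) _)
  refine mul_le_mul_of_nonneg_left ?_ (Real.sqrt_nonneg _)
  exact Real.sqrt_le_iff.2
    ⟨Metric.infDist_nonneg, ErrState.le_infDist_errSet_sq (hT₁.le.trans hT) (φ 0 0)⟩
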